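/- Let $\mathbb D$ be the open unit disc, $\mathbb T$ the unit circle, $dA=\frac1\pi\,dx\,dy$, and $H^2$ the Hardy space with $\|\sum a_nz^n\|_{H^2}^2=\sum|a_n|^2$. Let $k\ge 1$ be an integer, let $\mu$ be a finite positive Borel measure on $\mathbb C$ supported on $\overline{\mathbb D}$, and put, for $z\in\mathbb D$, $$U_{\mu,k}(z)=\frac1{((k-1)!)^2}\int_{\mathbb D}\frac{(-1)^{k+1}G_k(z,\zeta)}{(1-|\zeta|^2)^k}\,d\mu(\zeta)+\frac1{k!\,(k-1)!}\int_{\mathbb T}\frac{(1-|z|^2)^k}{|z-\zeta|^2}\,d\mu(\zeta),$$ $$G_k(z,\zeta)=|\zeta-z|^{2(k-1)}\log\left|\frac{1-z\overline\zeta}{\zeta-z}\right|^2+\sum_{l=1}^{k-1}\frac{(-1)^l}{l}|\zeta-z|^{2(k-1-l)}(1-|\zeta|^2)^l(1-|z|^2)^l .$$ For $f$ holomorphic on $\mathbb D$ let $D_{\mu,k}(f)=\int_{\mathbb D}|f^{(k)}|^2U_{\mu,k}\,dA\in[0,\infty]$, and let $\mathscr D_{\mu,k}$ be the space of all $f\in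 H^2$ with $D_{\mu,k}(f)<\infty$, with norm $\|f\|^2=\|f\|_{H^2}^2+D_{\mu,k}(f)$. If $\mu\ne0$, every holomorphic $f$ on $\mathbb D$ with $D_{\mu,k}(f)<\infty$ belongs to $H^2$. For every $\mu$ as above, $\mathscr D_{\mu,k}$ is a Hilbert space, multiplication by the coordinate function, $(M_zf)(z)=zf(z)$, is a bounded operator on it, and, with $B_n(T)=\sum_{j=0}^n(-1)^j\binom nj T^{*j}T^j$, the following hold. 1. $M_z$ is a Dirichlet type operator of order $k$, that is, $(-1)^kB_n(M_z)\ge0$ for all $n\ge k$. In particular, if $k$ is odd, $M_z$ is completely hyperexpansive of order $k$ ($B_n(M_z)\le0$ for all $n\ge k$), and if $k$ is even, $M_z$ is completely hypercontractive of order $k$ ($B_n(M_z)\ge0$ for all $n\ge k$). 2. $M_z$ is a $(k+1)$-isometry, that is, $B_{k+1}(M_z)=0$, if and only if $\mu$ is supported on $\mathbb T$, that is, $\mu(\mathbb C\setminus\mathbb T)=0$. -/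

import Mathlib

open MeasureTheory Metric
open scoped ENNReal ComplexConjugate Nat

noncomputable section

namespace HigherDirichlet

/-- The space `Hol(𝔻)` of holomorphic functions on the open unit disc. A function on the disc is
represented by its extension by zero to `ℂ`, so that equality of functions is equality on `𝔻`. -/
def hol : Submodule ℂ (ℂ → ℂ) where
  carrier := {f | DifferentiableOn ℂ f (ball 0 1) ∧ ∀ z ∉ ball (0 : ℂ) 1, f z = 0}
  add_mem' := fun {f g} hf hg =>
    ⟨hf.1.add hg.1, fun z hz => by simp [hf.2 z hz, hg.2 z hz]⟩
  zero_mem' := ⟨differentiableOn_const 0, fun _ _ => rfl⟩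
  smul_mem' := fun c f hf => ⟨hf.1.const_smul c, fun z hz => by simp [hf.2 z hz]⟩

/-- The `n`-th Taylor coefficient of `f` at the origin. -/
def taylorCoeff (f : ℂ → ℂ) (n : ℕ) : ℂ := iteratedDeriv n f 0 / (n ! : ℂ)

/-- The square `‖f‖²_{H²} = ∑ |aₙ|²` of the Hardy norm of `f = ∑ aₙ zⁿ`, possibly `∞`. -/
def hardyNormSq (f : ℂ → ℂ) : ℝ≥0∞ := ∑' n : ℕ, ‖taylorCoeff f n‖ₑ ^ 2

/-- The normalized area measure `dA = π⁻¹ dx dy` on the open unit disc. -/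
def areaMeasure : Measure ℂ := ENNReal.ofReal Real.pi⁻¹ • volume.restrict (ball 0 1)

/-- The polyharmonic Green-Almansi function `G_k(z, ζ)`. -/
def greenAlmansi (k : ℕ) (z ζ : ℂ) : ℝ :=
  ‖ζ - z‖ ^ (2 * (k - 1)) * Real.log (‖(1 - z * conj ζ) / (ζ - z)‖ ^ 2) +
    ∑ l ∈ Finset.Icc 1 (k - 1), (-1 : ℝ) ^ l / l * ‖ζ - z‖ ^ (2 * (k - 1 - l)) *
      (1 - ‖ζ‖ ^ 2) ^ l * (1 - ‖z‖ ^ 2) ^ l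

/-- The weight `U_{μ,k}` on the disc, for `k ≥ 1`. Both integrands are nonnegative for
`z ∈ 𝔻`, so the integrals are taken with values in `[0, ∞]`. -/
def weight (μ : Measure ℂ) (k : ℕ) (z : ℂ) : ℝ≥0∞ :=
  ENNReal.ofReal (1 / ((k - 1)! : ℝ) ^ 2) *
      ∫⁻ ζ in ball 0 1,
        ENNReal.ofReal ((-1) ^ (k + 1) * greenAlmansi k z ζ / (1 - ‖ζ‖ ^ 2) ^ k) ∂μ +
    ENNReal.ofReal (1 / ((k ! : ℝ) * ((k - 1)! : ℝ))) *
      ∫⁻ ζ in sphere 0 1, ENNReal.ofReal ((1 - ‖z‖ ^ 2) ^ k / ‖z - ζ‖ ^ 2) ∂μ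

/-- The weighted Dirichlet integral `D_{μ,k}(f) = ∫_𝔻 |f^{(k)}|² U_{μ,k} dA`. -/
def dirichletIntegral (μ : Measure ℂ) (k : ℕ) (f : ℂ → ℂ) : ℝ≥0∞ :=
  ∫⁻ z, ‖iteratedDeriv k f z‖ₑ ^ 2 * weight μ k z ∂areaMeasure

/-- The measure `U_{μ,k} dA`. -/
def weightedArea (μ : Measure ℂ) (k : ℕ) : Measure ℂ := areaMeasure.withDensity (weight μ k)

theorem measurable_weight (μ : Measure ℂ) [IsFiniteMeasure μ] (k : ℕ) :
    Measurable (weight μ k) := by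
  unfold weight
  refine (Measurable.const_mul ?_ _).add (Measurable.const_mul ?_ _)
  · apply Measurable.lintegral_prod_right'
      (f := fun p : ℂ × ℂ => ENNReal.ofReal
        ((-1) ^ (k + 1) * greenAlmansi k p.1 p.2 / (1 - ‖p.2‖ ^ 2) ^ k))
    unfold greenAlmansi
    have hc : Measurable (fun p : ℂ × ℂ => conj p.2) :=
      (Complex.continuous_conj.comp continuous_snd).measurable
    fun_prop
  · apply Measurable.lintegral_prod_right'
      (f := fun p : ℂ × ℂ => ENNReal.ofReal ((1 - ‖p.1‖ ^ 2) ^ k / ‖p.1 - p.2‖ ^ 2))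
    fun_prop

theorem contDiffAt_of_mem_hol {f : ℂ → ℂ} (hf : f ∈ hol) {z : ℂ} (hz : z ∈ ball (0 : ℂ) 1)
    (n : ℕ) : ContDiffAt ℂ n f z :=
  (hf.1.analyticAt (isOpen_ball.mem_nhds hz)).contDiffAt

theorem aestronglyMeasurable_iteratedDeriv {f : ℂ → ℂ} (hf : f ∈ hol) (μ : Measure ℂ) (k : ℕ) :
    AEStronglyMeasurable (iteratedDeriv k f) (weightedArea μ k) := by
  have h1 : ContinuousOn (iteratedDeriv k f) (ball 0 1) := by
    intro z hz
    have ha : AnalyticOnNhd ℂ f (ball 0 1) := hf.1.analyticOnNhd isOpen_ball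
    rw [iteratedDeriv_eq_iterate]
    exact (ha.iterated_deriv k z hz).continuousAt.continuousWithinAt
  have h2 : AEStronglyMeasurable (iteratedDeriv k f) (volume.restrict (ball (0 : ℂ) 1)) :=
    h1.aestronglyMeasurable measurableSet_ball
  have h3 : AEStronglyMeasurable (iteratedDeriv k f) areaMeasure :=
    h2.mono_ac Measure.smul_absolutelyContinuous
  exact h3.mono_ac (withDensity_absolutelyContinuous _ _)

theorem dirichletIntegral_eq (μ : Measure ℂ) [IsFiniteMeasure μ] (k : ℕ) {f : ℂ → ℂ}
    (hf : f ∈ hol) :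
    dirichletIntegral μ k f = ∫⁻ z, ‖iteratedDeriv k f z‖ₑ ^ 2 ∂weightedArea μ k := by
  unfold weightedArea
  rw [lintegral_withDensity_eq_lintegral_mul₀' (measurable_weight μ k).aemeasurable
    ((aestronglyMeasurable_iteratedDeriv hf μ k).enorm.pow_const 2)]
  simp [dirichletIntegral, mul_comm]

theorem dirichletIntegral_lt_top_iff (μ : Measure ℂ) [IsFiniteMeasure μ] (k : ℕ) {f : ℂ → ℂ}
    (hf : f ∈ hol) :
    dirichletIntegral μ k f < ∞ ↔ MemLp (iteratedDeriv k f) 2 (weightedArea μ k) := by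
  rw [dirichletIntegral_eq μ k hf, MemLp,
    eLpNorm_lt_top_iff_lintegral_rpow_enorm_lt_top (by norm_num) (by norm_num)]
  simp [aestronglyMeasurable_iteratedDeriv hf μ k]

theorem hardyNormSq_lt_top_iff (f : ℂ → ℂ) :
    hardyNormSq f < ∞ ↔ Summable (fun n => ‖taylorCoeff f n‖ ^ 2) := by
  have h : ∀ n, ‖taylorCoeff f n‖ₑ ^ 2 = ENNReal.ofReal (‖taylorCoeff f n‖ ^ 2) := fun n => by
    rw [ENNReal.ofReal_pow (norm_nonneg _), ofReal_norm]
  unfold hardyNormSq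
  simp_rw [h]
  constructor
  · intro hlt
    have := ENNReal.summable_toReal hlt.ne
    simpa [ENNReal.toReal_ofReal, sq_nonneg] using this
  · intro hs
    exact hs.tsum_ofReal_lt_top

theorem taylorCoeff_add {f g : ℂ → ℂ} (hf : f ∈ hol) (hg : g ∈ hol) (n : ℕ) :
    taylorCoeff (f + g) n = taylorCoeff f n + taylorCoeff g n := by
  have h0 : (0 : ℂ) ∈ ball (0 : ℂ) 1 := by simp
  unfold taylorCoeff
  rw [iteratedDeriv_add (contDiffAt_of_mem_hol hf h0 n) (contDiffAt_of_mem_hol hg h0 n), add_div]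

theorem taylorCoeff_smul (c : ℂ) {f : ℂ → ℂ} (n : ℕ) :
    taylorCoeff (c • f) n = c * taylorCoeff f n := by
  unfold taylorCoeff
  rw [iteratedDeriv_const_smul_field]
  simp [mul_div_assoc]

theorem iteratedDeriv_add_ae {f g : ℂ → ℂ} (hf : f ∈ hol) (hg : g ∈ hol) (μ : Measure ℂ)
    (k : ℕ) :
    iteratedDeriv k (f + g) =ᵐ[weightedArea μ k] iteratedDeriv k f + iteratedDeriv k g := by
  apply (withDensity_absolutelyContinuous _ _).ae_eq
  apply Measure.smul_absolutelyContinuous.ae_eq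
  filter_upwards [ae_restrict_mem measurableSet_ball] with z hz
  exact iteratedDeriv_add (contDiffAt_of_mem_hol hf hz k) (contDiffAt_of_mem_hol hg hz k)

/-- The Hardy space `H²`. -/
def hardySpace : Submodule ℂ (ℂ → ℂ) where
  carrier := {f | f ∈ hol ∧ hardyNormSq f < ∞}
  add_mem' := fun {f g} hf hg => by
    refine ⟨hol.add_mem hf.1 hg.1, ?_⟩
    rw [hardyNormSq_lt_top_iff]
    have h1 := (hardyNormSq_lt_top_iff f).1 hf.2
    have h2 := (hardyNormSq_lt_top_iff g).1 hg.2
    refine Summable.of_nonneg_of_le (fun _ => sq_nonneg _) (fun n => ?_)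
      ((h1.mul_left 2).add (h2.mul_left 2))
    rw [taylorCoeff_add hf.1 hg.1]
    have := norm_add_le (taylorCoeff f n) (taylorCoeff g n)
    nlinarith [sq_nonneg (‖taylorCoeff f n‖ - ‖taylorCoeff g n‖),
      norm_nonneg (taylorCoeff f n + taylorCoeff g n)]
  zero_mem' := by
    refine ⟨hol.zero_mem, ?_⟩
    have h (n : ℕ) : taylorCoeff 0 n = 0 := by
      simpa using taylorCoeff_smul 0 (f := 0) n
    simp [hardyNormSq, h]
  smul_mem' := fun c f hf => by
    refine ⟨hol.smul_mem c hf.1, ?_⟩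
    rw [hardyNormSq_lt_top_iff]
    have h1 := (hardyNormSq_lt_top_iff f).1 hf.2
    simp only [taylorCoeff_smul, norm_mul, mul_pow]
    exact h1.mul_left _

/-- The space of all `f ∈ Hol(𝔻)` with `D_{μ,k}(f) < ∞`. -/
def finiteDirichlet (μ : Measure ℂ) [IsFiniteMeasure μ] (k : ℕ) : Submodule ℂ (ℂ → ℂ) where
  carrier := {f | f ∈ hol ∧ dirichletIntegral μ k f < ∞}
  add_mem' := fun {f g} hf hg => by
    have h := hol.add_mem hf.1 hg.1
    refine ⟨h, (dirichletIntegral_lt_top_iff μ k h).2 ?_⟩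
    exact (memLp_congr_ae (iteratedDeriv_add_ae hf.1 hg.1 μ k)).2
      (((dirichletIntegral_lt_top_iff μ k hf.1).1 hf.2).add
        ((dirichletIntegral_lt_top_iff μ k hg.1).1 hg.2))
  zero_mem' := by
    refine ⟨hol.zero_mem, ?_⟩
    simp [dirichletIntegral]
  smul_mem' := fun c f hf => by
    have h := hol.smul_mem c hf.1
    refine ⟨h, (dirichletIntegral_lt_top_iff μ k h).2 ?_⟩
    have e : iteratedDeriv k (c • f) = c • iteratedDeriv k f := by
      funext z
      simp
    rw [e]
    exact ((dirichletIntegral_lt_top_iff μ k hf.1).1 hf.2).const_smul c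

/-- The Dirichlet type space `𝒟_{μ,k}` as a normed space: the functions `f` in `H²` with
`D_{μ,k}(f) < ∞`. For `μ ≠ 0` supported on the closed disc and `k ≥ 1`, membership in `H²` is
automatic (this is part of what is claimed); for `μ = 0` the space is `H²`. -/
def DirichletSpace (μ : Measure ℂ) [IsFiniteMeasure μ] (k : ℕ) : Type :=
  ↥(hardySpace ⊓ finiteDirichlet μ k)

namespace DirichletSpace

variable {μ : Measure ℂ} [IsFiniteMeasure μ] {k : ℕ}

instance : AddCommGroup (DirichletSpace μ k) :=
  inferInstanceAs (AddCommGroup ↥(hardySpace ⊓ finiteDirichlet μ k))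

instance : Module ℂ (DirichletSpace μ k) :=
  inferInstanceAs (Module ℂ ↥(hardySpace ⊓ finiteDirichlet μ k))

/-- The underlying function of an element of `𝒟_{μ,k}`. -/
def toFun (f : DirichletSpace μ k) : ℂ → ℂ := f.1

instance : CoeFun (DirichletSpace μ k) (fun _ => ℂ → ℂ) := ⟨toFun⟩

theorem mem_hol (f : DirichletSpace μ k) : f.toFun ∈ hol := f.2.1.1

theorem summable_sq (f : DirichletSpace μ k) :
    Summable (fun n => ‖taylorCoeff f.toFun n‖ ^ 2) :=
  (hardyNormSq_lt_top_iff _).1 f.2.1.2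

theorem memLp (f : DirichletSpace μ k) :
    MemLp (iteratedDeriv k f.toFun) 2 (weightedArea μ k) :=
  (dirichletIntegral_lt_top_iff μ k f.mem_hol).1 f.2.2.2

theorem toFun_add (f g : DirichletSpace μ k) : (f + g).toFun = f.toFun + g.toFun := rfl

theorem toFun_smul (c : ℂ) (f : DirichletSpace μ k) : (c • f).toFun = c • f.toFun := rfl

theorem summable_inner (f g : DirichletSpace μ k) :
    Summable (fun n => conj (taylorCoeff f.toFun n) * taylorCoeff g.toFun n) := by
  refine Summable.of_norm_bounded (f.summable_sq.add g.summable_sq) (fun n => ?_)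
  rw [norm_mul, RCLike.norm_conj]
  nlinarith [sq_nonneg (‖taylorCoeff f.toFun n‖ - ‖taylorCoeff g.toFun n‖),
    sq_nonneg ‖taylorCoeff f.toFun n‖, sq_nonneg ‖taylorCoeff g.toFun n‖]

theorem integrable_inner (f g : DirichletSpace μ k) :
    Integrable (fun z => conj (iteratedDeriv k f.toFun z) * iteratedDeriv k g.toFun z)
      (weightedArea μ k) :=
  MemLp.integrable_mul (p := 2) (q := 2) f.memLp.star g.memLp

/-- `⟪f, g⟫ = ∑ conj aₙ bₙ + ∫_𝔻 conj (f^{(k)}) g^{(k)} U_{μ,k} dA`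
(conjugate-linear in the first variable). -/
instance : Inner ℂ (DirichletSpace μ k) where
  inner f g := ∑' n, conj (taylorCoeff f.toFun n) * taylorCoeff g.toFun n +
    ∫ z, conj (iteratedDeriv k f.toFun z) * iteratedDeriv k g.toFun z ∂weightedArea μ k

theorem inner_def (f g : DirichletSpace μ k) :
    inner ℂ f g = ∑' n, conj (taylorCoeff f.toFun n) * taylorCoeff g.toFun n +
      ∫ z, conj (iteratedDeriv k f.toFun z) * iteratedDeriv k g.toFun z ∂weightedArea μ k := rfl

theorem inner_self_eq (f : DirichletSpace μ k) :
    inner ℂ f f = ((∑' n, ‖taylorCoeff f.toFun n‖ ^ 2 +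
      ∫ z, ‖iteratedDeriv k f.toFun z‖ ^ 2 ∂weightedArea μ k : ℝ) : ℂ) := by
  rw [inner_def]
  simp only [RCLike.conj_mul]
  push_cast
  congr 1
  rw [← integral_complex_ofReal]
  simp

theorem eq_zero_of_taylorCoeff (f : DirichletSpace μ k) (h : ∀ n, taylorCoeff f.toFun n = 0) :
    f = 0 := by
  apply Subtype.ext
  change f.toFun = 0
  funext z
  by_cases hz : z ∈ ball (0 : ℂ) 1
  · have := Complex.hasSum_taylorSeries_on_ball (c := 0) (r := 1) f.mem_hol.1 hz
    have h' : ∀ n, iteratedDeriv n f.toFun 0 = 0 := fun n => by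
      have := h n
      unfold taylorCoeff at this
      rcases div_eq_zero_iff.1 this with h1 | h1
      · exact h1
      · exact absurd h1 (by exact_mod_cast n.factorial_ne_zero)
    simp only [h', smul_zero] at this
    exact this.unique hasSum_zero
  · exact f.mem_hol.2 z hz

/-- The inner product axioms. -/
@[reducible] def core : InnerProductSpace.Core ℂ (DirichletSpace μ k) where
  toInner := inferInstance
  conj_inner_symm f g := by
    rw [inner_def, inner_def, map_add, Complex.conj_tsum, ← integral_conj]
    simp [mul_comm]
  re_inner_nonneg f := by
    rw [inner_self_eq, RCLike.re_to_complex, Complex.ofReal_re]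
    exact add_nonneg (tsum_nonneg fun _ => sq_nonneg _) (integral_nonneg fun _ => sq_nonneg _)
  add_left f g h := by
    have e : ∫ z, conj (iteratedDeriv k (f + g).toFun z) * iteratedDeriv k h.toFun z
          ∂weightedArea μ k =
        ∫ z, (conj (iteratedDeriv k f.toFun z) * iteratedDeriv k h.toFun z +
          conj (iteratedDeriv k g.toFun z) * iteratedDeriv k h.toFun z) ∂weightedArea μ k := by
      apply integral_congr_ae
      filter_upwards [iteratedDeriv_add_ae f.mem_hol g.mem_hol μ k] with z hz
      rw [toFun_add, hz, Pi.add_apply, map_add, add_mul]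
    rw [inner_def, inner_def, inner_def, e,
      integral_add (integrable_inner f h) (integrable_inner g h)]
    simp only [toFun_add, taylorCoeff_add f.mem_hol g.mem_hol, map_add, add_mul]
    rw [(summable_inner f h).tsum_add (summable_inner g h)]
    ring
  smul_left f g c := by
    have e : ∀ z, iteratedDeriv k (c • f.toFun) z = c * iteratedDeriv k f.toFun z := fun z => by
      simp
    rw [inner_def, inner_def]
    simp only [toFun_smul, e, taylorCoeff_smul, map_mul, mul_assoc]
    rw [tsum_mul_left, integral_const_mul, mul_add]
  definite f hf := by
    rw [inner_self_eq, Complex.ofReal_eq_zero] at hf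
    have h1 : 0 ≤ ∑' n, ‖taylorCoeff f.toFun n‖ ^ 2 := tsum_nonneg fun _ => sq_nonneg _
    have h2 : 0 ≤ ∫ z, ‖iteratedDeriv k f.toFun z‖ ^ 2 ∂weightedArea μ k :=
      integral_nonneg fun _ => sq_nonneg _
    have h3 : ∑' n, ‖taylorCoeff f.toFun n‖ ^ 2 = 0 := by linarith
    have h4 := (f.summable_sq.hasSum_iff.2 h3)
    rw [hasSum_zero_iff_of_nonneg (fun _ => sq_nonneg _)] at h4
    apply f.eq_zero_of_taylorCoeff
    intro n
    simpa using congrFun h4 n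

instance : NormedAddCommGroup (DirichletSpace μ k) := core.toNormedAddCommGroup

instance : InnerProductSpace ℂ (DirichletSpace μ k) := InnerProductSpace.ofCore core.toCore

/-- The norm of `𝒟_{μ,k}` is given by `‖f‖² = ‖f‖²_{H²} + D_{μ,k}(f)`. -/
theorem norm_sq_eq (f : DirichletSpace μ k) :
    ENNReal.ofReal (‖f‖ ^ 2) = hardyNormSq f + dirichletIntegral μ k f := by
  have h0 : ‖f‖ ^ 2 = ∑' n, ‖taylorCoeff f.toFun n‖ ^ 2 +
      ∫ z, ‖iteratedDeriv k f.toFun z‖ ^ 2 ∂weightedArea μ k := by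
    have := inner_self_eq_norm_sq_to_K (𝕜 := ℂ) f
    rw [inner_self_eq] at this
    exact Complex.ofReal_injective ((Complex.ofReal_pow _ _).trans this.symm)
  rw [h0, ENNReal.ofReal_add (tsum_nonneg fun _ => sq_nonneg _)
    (integral_nonneg fun _ => sq_nonneg _), dirichletIntegral_eq μ k f.mem_hol,
    ENNReal.ofReal_tsum_of_nonneg (fun _ => sq_nonneg _) f.summable_sq,
    ofReal_integral_eq_lintegral_ofReal (f.memLp.integrable_norm_pow two_ne_zero)
      (Filter.Eventually.of_forall fun _ => sq_nonneg _)]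
  simp only [ENNReal.ofReal_pow (norm_nonneg _), ofReal_norm]
  rfl

end DirichletSpace

section Operators

variable {H : Type*} [NormedAddCommGroup H] [InnerProductSpace ℂ H] [CompleteSpace H]

/-- The `n`-th backward difference `B_n(T) = ∑_{j ≤ n} (-1)^j (n choose j) (T*)^j T^j`. -/
def backwardDiff (n : ℕ) (T : H →L[ℂ] H) : H →L[ℂ] H :=
  ∑ j ∈ Finset.range (n + 1),
    ((-1 : ℂ) ^ j * (n.choose j : ℂ)) • (ContinuousLinearMap.adjoint T ^ j * T ^ j)

/-- `T` is a Dirichlet type operator of order `k`: `(-1)^k B_n(T) ≥ 0` for all `n ≥ k`. -/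
def IsDirichletType (k : ℕ) (T : H →L[ℂ] H) : Prop :=
  ∀ n, k ≤ n → 0 ≤ ((-1 : ℂ) ^ k) • backwardDiff n T

/-- `T` is completely hyperexpansive of order `k`: `B_n(T) ≤ 0` for all `n ≥ k`. -/
def IsCompletelyHyperexpansive (k : ℕ) (T : H →L[ℂ] H) : Prop :=
  ∀ n, k ≤ n → backwardDiff n T ≤ 0

/-- `T` is completely hypercontractive of order `k`: `B_n(T) ≥ 0` for all `n ≥ k`. -/
def IsCompletelyHypercontractive (k : ℕ) (T : H →L[ℂ] H) : Prop :=
  ∀ n, k ≤ n → 0 ≤ backwardDiff n T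

/-- `T` is an `m`-isometry: `B_m(T) = 0`. -/
def IsMIsometry (m : ℕ) (T : H →L[ℂ] H) : Prop := backwardDiff m T = 0

end Operators

end HigherDirichlet

end

noncomputable section

namespace HigherDirichlet

/-! By Tonelli, `D_{μ,k}(f)` is the `μ`-average of local integrals `D_ζ(f)`, one for each point `ζ`
of the closed disc. Everything rests on a higher order local Douglas formula: `D_ζ(f) = ∑ (p choose
k-1) |g_p|²`, where `g` is the difference quotient in `f = f(ζ) + (z - ζ) g`. At a boundary point
`f(ζ)` is not given in advance; there `g` is a solution of `a_{p+1} = g_p - ζ g_{p+1}` with finite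
sum, unique because such a solution tends to zero (`exists_isQuot_of_localEnergy_ne_top`,
`localEnergy_eq_quotEnergy`).

For `|ζ| < 1` the formula is proved by induction on `k` (`discEnergy_eq`). Order one is the
Littlewood-Paley formula transported by a disc automorphism; the step uses a recursion of the
Green-Almansi kernel whose right side is radial, so that Parseval applies. For `|ζ| = 1` it is a
discrete Hardy type identity between the coefficients of `f^(k) / (z - ζ)` and those of `g^(k-1)`
(`circleEnergy_of_ne_top`, `circleEnergy_of_isQuot`).

Once the formula is known, the operator theory is combinatorial. The quotient of `z f` is `f(ζ) + z
g`, so by Pascal's rule multiplication by `z` adds to the energy of order `k` the energy of order `k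
- 1`, and at order one it adds `|f(ζ)|²`, which itself scales by `|ζ|²`. Taking `n ≥ k` differences
gives `⟪B_n(M_z) f, f⟫ = (-1)^k ∫ (1 - |ζ|²)^(n-k) |f(ζ)|² dμ(ζ)`, since the Hardy norm is invariant
under `M_z` and drops out (`altSum_localEnergy`). The sign is read off at once. For `n = k + 1` the
integral vanishes if `μ` lives on the circle, and conversely `f = 1` forces `∫ (1 - |ζ|²) dμ = 0`.
Boundedness follows from the same recursion, completeness from Fatou's lemma. -/

/-! ### Power series, their derivatives and Taylor coefficients -/

/-- The sum of the power series with coefficients `b`. -/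
def powerSum (b : ℕ → ℂ) (z : ℂ) : ℂ := ∑' m, b m * z ^ m

/-- The power series with coefficients `b` converges absolutely on the disc of radius `R`. -/
def AbsConv (b : ℕ → ℂ) (R : ℝ) : Prop :=
  ∀ r, 0 ≤ r → r < R → Summable fun m => ‖b m‖ * r ^ m

/-- The coefficients of the `k`-th derivative of a power series. -/
def derivCoeff (k : ℕ) (b : ℕ → ℂ) (m : ℕ) : ℂ := ((m + k)! : ℂ) / (m ! : ℂ) * b (m + k)

theorem AbsConv.summable {b : ℕ → ℂ} {R : ℝ} (hb : AbsConv b R) {z : ℂ} (hz : ‖z‖ < R) :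
    Summable fun m => b m * z ^ m := by
  refine Summable.of_norm ?_
  simpa [norm_mul, norm_pow] using hb ‖z‖ (norm_nonneg _) hz

theorem AbsConv.mono {b : ℕ → ℂ} {R S : ℝ} (hb : AbsConv b R) (h : S ≤ R) : AbsConv b S :=
  fun r h0 h1 => hb r h0 (h1.trans_le h)

theorem AbsConv.summable_norm {b : ℕ → ℂ} {R : ℝ} (hb : AbsConv b R) (hR : 1 < R) :
    Summable fun m => ‖b m‖ := by simpa using hb 1 zero_le_one hR

theorem absConv_of_bounded {b : ℕ → ℂ} {C : ℝ} (hb : ∀ m, ‖b m‖ ≤ C) : AbsConv b 1 := by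
  intro r h0 h1
  refine Summable.of_nonneg_of_le (fun m => by positivity)
    (fun m => mul_le_mul_of_nonneg_right (hb m) (pow_nonneg h0 m))
    ((summable_geometric_of_lt_one h0 h1).mul_left C)

theorem derivCoeff_zero (b : ℕ → ℂ) : derivCoeff 0 b = b := by
  funext m
  simp [derivCoeff, Nat.factorial_ne_zero]

theorem derivCoeff_one (b : ℕ → ℂ) (m : ℕ) : derivCoeff 1 b m = (m + 1) * b (m + 1) := by
  have : (m ! : ℂ) ≠ 0 := by exact_mod_cast m.factorial_ne_zero
  rw [derivCoeff, Nat.factorial_succ]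
  push_cast
  field_simp

theorem derivCoeff_succ (k : ℕ) (b : ℕ → ℂ) :
    derivCoeff (k + 1) b = derivCoeff 1 (derivCoeff k b) := by
  funext m
  have : (m ! : ℂ) ≠ 0 := by exact_mod_cast m.factorial_ne_zero
  have h2 : (m + 1 : ℂ) ≠ 0 := by exact_mod_cast m.succ_ne_zero
  rw [derivCoeff_one, derivCoeff, derivCoeff, show m + 1 + k = m + (k + 1) by ring,
    Nat.factorial_succ m]
  push_cast
  field_simp

/-- At a larger radius `s` the terms are bounded by some `C`, so at `r < s` the differentiated
series is dominated by `m (r/s)^m` and a geometric series. -/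
theorem AbsConv.derivCoeff_one {b : ℕ → ℂ} {R : ℝ} (hb : AbsConv b R) :
    AbsConv (derivCoeff 1 b) R := by
  intro r h0 h1
  obtain ⟨s, hs1, hs2⟩ := exists_between h1
  have hs0 : 0 < s := h0.trans_lt hs1
  have h3 := hb s hs0.le hs2
  obtain ⟨C, hC⟩ := h3.tendsto_atTop_zero.bddAbove_range
  have hC' : ∀ m, ‖b m‖ * s ^ m ≤ C := fun m => hC ⟨m, rfl⟩
  have hq : ‖r / s‖ < 1 := by
    rw [Real.norm_of_nonneg (by positivity), div_lt_one hs0]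
    exact hs1
  have h4 := ((summable_pow_mul_geometric_of_norm_lt_one 1 hq).add
    (summable_geometric_of_norm_lt_one hq)).mul_left (C / s)
  refine Summable.of_nonneg_of_le (fun m => by positivity) (fun m => ?_) h4
  rw [HigherDirichlet.derivCoeff_one, norm_mul]
  have e : ‖(m + 1 : ℂ)‖ = m + 1 := by
    have : (m + 1 : ℂ) = ((m + 1 : ℕ) : ℂ) := by push_cast; rfl
    rw [this, Complex.norm_natCast]; push_cast; rfl
  rw [e]
  have h5 := hC' (m + 1)
  have h6 : ‖b (m + 1)‖ ≤ C / s ^ (m + 1) := by rwa [le_div_iff₀ (by positivity)]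
  calc (m + 1) * ‖b (m + 1)‖ * r ^ m ≤ (m + 1) * (C / s ^ (m + 1)) * r ^ m := by gcongr
    _ = C / s * ((m : ℝ) ^ 1 * (r / s) ^ m + (r / s) ^ m) := by
      rw [div_pow, pow_succ]
      field_simp

theorem AbsConv.derivCoeff {b : ℕ → ℂ} {R : ℝ} (hb : AbsConv b R) (k : ℕ) :
    AbsConv (derivCoeff k b) R := by
  induction k with
  | zero => rwa [derivCoeff_zero]
  | succ k ih => rw [derivCoeff_succ]; exact ih.derivCoeff_one

theorem AbsConv.hasDerivAt {b : ℕ → ℂ} {R : ℝ} (hb : AbsConv b R) {z : ℂ} (hz : ‖z‖ < R) :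
    HasDerivAt (powerSum b) (powerSum (HigherDirichlet.derivCoeff 1 b) z) z := by
  obtain ⟨r, hr1, hr2⟩ := exists_between hz
  have hr0 : 0 ≤ r := (norm_nonneg z).trans hr1.le
  have h1 := hb.derivCoeff_one r hr0 hr2
  -- At `m = 0` the truncated exponent `m - 1` is harmless, because the factor `m` vanishes.
  have hu : Summable fun m : ℕ => ‖(m : ℂ) * b m‖ * r ^ (m - 1) := by
    rw [← summable_nat_add_iff 1]
    refine h1.congr (fun m => ?_)
    rw [HigherDirichlet.derivCoeff_one]
    simp
  have h2 := hasDerivAt_tsum_of_isPreconnected (𝕜 := ℂ) (t := ball (0 : ℂ) r)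
    (g := fun m z => b m * z ^ m) (g' := fun m z => b m * (m * z ^ (m - 1))) (y₀ := 0) (y := z)
    hu isOpen_ball (convex_ball 0 r).isPreconnected
    (fun n y _ => (hasDerivAt_pow n y).const_mul (b n))
    (fun n y hy => by
      rw [← mul_assoc, mul_comm (b n), norm_mul, norm_pow]
      have : ‖y‖ < r := by simpa using hy
      gcongr)
    (by simpa using (norm_nonneg z).trans_lt hr1)
    (hb.summable (by simpa using (norm_nonneg z).trans_lt hz)) (by simpa using hr1)
  have e : ∑' m : ℕ, b m * (m * z ^ (m - 1)) = powerSum (HigherDirichlet.derivCoeff 1 b) z := by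
    have hs : Summable fun m : ℕ => b m * (m * z ^ (m - 1)) := by
      rw [← summable_nat_add_iff 1]
      refine (hb.derivCoeff_one.summable hz).congr (fun m => ?_)
      rw [HigherDirichlet.derivCoeff_one]
      simp; ring
    rw [hs.tsum_eq_zero_add]
    simp only [Nat.cast_zero, zero_mul, mul_zero, zero_add, powerSum]
    refine tsum_congr fun m => ?_
    rw [HigherDirichlet.derivCoeff_one]
    simp; ring
  rw [e] at h2
  exact h2

theorem AbsConv.differentiableOn {b : ℕ → ℂ} {R : ℝ} (hb : AbsConv b R) :
    DifferentiableOn ℂ (powerSum b) (ball 0 R) := fun z hz =>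
  (hb.hasDerivAt (by simpa using hz)).differentiableAt.differentiableWithinAt

theorem AbsConv.iteratedDeriv {b : ℕ → ℂ} {R : ℝ} (hb : AbsConv b R) (k : ℕ) {z : ℂ}
    (hz : ‖z‖ < R) : iteratedDeriv k (powerSum b) z = powerSum (HigherDirichlet.derivCoeff k b) z := by
  induction k generalizing z with
  | zero => rw [derivCoeff_zero, iteratedDeriv_zero]
  | succ k ih =>
    have : _root_.iteratedDeriv k (powerSum b) =ᶠ[nhds z]
        powerSum (HigherDirichlet.derivCoeff k b) := by
      filter_upwards [isOpen_ball.mem_nhds (show z ∈ ball (0 : ℂ) R by simpa using hz)] with y hy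
      exact ih (by simpa using hy)
    rw [iteratedDeriv_succ, this.deriv_eq, derivCoeff_succ]
    exact ((hb.derivCoeff k).hasDerivAt hz).deriv

theorem powerSum_zero (b : ℕ → ℂ) : powerSum b 0 = b 0 := by
  unfold powerSum
  rw [tsum_eq_single 0 (fun m hm => by simp [hm])]
  simp

theorem AbsConv.taylorCoeff {b : ℕ → ℂ} {R : ℝ} (hb : AbsConv b R) (hR : 0 < R) (n : ℕ) :
    taylorCoeff (powerSum b) n = b n := by
  have : (n ! : ℂ) ≠ 0 := by exact_mod_cast n.factorial_ne_zero
  rw [HigherDirichlet.taylorCoeff, hb.iteratedDeriv n (by simpa using hR), powerSum_zero,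
    HigherDirichlet.derivCoeff]
  simp
  field_simp

theorem taylorCoeff_congr {f g : ℂ → ℂ} (h : f =ᶠ[nhds 0] g) (n : ℕ) :
    taylorCoeff f n = taylorCoeff g n := by
  rw [taylorCoeff, taylorCoeff, h.iteratedDeriv_eq n]

theorem hasSum_taylorCoeff {f : ℂ → ℂ} {R : ℝ} (hf : DifferentiableOn ℂ f (ball 0 R)) {z : ℂ}
    (hz : ‖z‖ < R) : HasSum (fun m => taylorCoeff f m * z ^ m) (f z) := by
  have h := Complex.hasSum_taylorSeries_on_ball (c := 0) (r := R) hf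
    (show z ∈ ball 0 R by simpa using hz)
  refine h.congr_fun fun m => ?_
  simp [taylorCoeff, div_eq_mul_inv]
  ring

theorem absConv_taylorCoeff {f : ℂ → ℂ} {R : ℝ} (hf : DifferentiableOn ℂ f (ball 0 R)) :
    AbsConv (taylorCoeff f) R := by
  intro r h0 h1
  have h := (hasSum_taylorCoeff hf (z := (r : ℂ)) (by simpa [abs_of_nonneg h0] using h1)).summable.norm
  simpa [norm_mul, norm_pow, abs_of_nonneg h0] using h

theorem powerSum_taylorCoeff {f : ℂ → ℂ} {R : ℝ} (hf : DifferentiableOn ℂ f (ball 0 R)) {z : ℂ}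
    (hz : ‖z‖ < R) : powerSum (taylorCoeff f) z = f z := (hasSum_taylorCoeff hf hz).tsum_eq

theorem iteratedDeriv_eq_powerSum {f : ℂ → ℂ} {R : ℝ} (hf : DifferentiableOn ℂ f (ball 0 R))
    (k : ℕ) {z : ℂ} (hz : ‖z‖ < R) :
    iteratedDeriv k f z = powerSum (derivCoeff k (taylorCoeff f)) z := by
  rw [← (absConv_taylorCoeff hf).iteratedDeriv k hz]
  refine Filter.EventuallyEq.iteratedDeriv_eq k ?_
  filter_upwards [isOpen_ball.mem_nhds (show z ∈ ball (0 : ℂ) R by simpa using hz)] with y hy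
  exact (powerSum_taylorCoeff hf (by simpa using hy)).symm

/-! ### Parseval's identity and integration against radial weights -/

theorem norm_sum_le_tsum {b : ℕ → ℂ} (hb : Summable fun m => ‖b m‖) {z : ℂ} (hz : ‖z‖ ≤ 1)
    (s : Finset ℕ) : ‖∑ m ∈ s, b m * z ^ m‖ ≤ ∑' m, ‖b m‖ := by
  refine (norm_sum_le _ _).trans (le_trans (Finset.sum_le_sum fun m _ => ?_)
    (hb.sum_le_tsum s fun _ _ => norm_nonneg _))
  rw [norm_mul, norm_pow]
  exact mul_le_of_le_one_right (norm_nonneg _) (pow_le_one₀ (norm_nonneg _) hz)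

theorem summable_of_summable_norm {b : ℕ → ℂ} (hb : Summable fun m => ‖b m‖) {z : ℂ}
    (hz : ‖z‖ ≤ 1) : Summable fun m => b m * z ^ m :=
  Summable.of_norm_bounded hb fun m => by
    rw [norm_mul, norm_pow]
    exact mul_le_of_le_one_right (norm_nonneg _) (pow_le_one₀ (norm_nonneg _) hz)

theorem norm_powerSum_le {b : ℕ → ℂ} (hb : Summable fun m => ‖b m‖) {z : ℂ} (hz : ‖z‖ ≤ 1) :
    ‖powerSum b z‖ ≤ ∑' m, ‖b m‖ :=
  le_of_tendsto (summable_of_summable_norm hb hz).hasSum.norm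
    (Filter.Eventually.of_forall fun s => norm_sum_le_tsum hb hz s)

theorem summable_sq_norm {b : ℕ → ℂ} (hb : Summable fun m => ‖b m‖) :
    Summable fun m => ‖b m‖ ^ 2 := by
  refine Summable.of_nonneg_of_le (fun m => by positivity) (fun m => ?_)
    (hb.mul_left (∑' m, ‖b m‖))
  rw [sq]
  exact mul_le_mul_of_nonneg_right (hb.le_tsum m fun _ _ => norm_nonneg _) (norm_nonneg _)

/-- Parseval's identity on the unit circle for an absolutely convergent power series. -/
theorem circleAverage_norm_sq_powerSum {b : ℕ → ℂ} (hb : Summable fun m => ‖b m‖) :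
    Real.circleAverage (fun z => ‖powerSum b z‖ ^ 2) 0 1 = ∑' n, ‖b n‖ ^ 2 := by
  classical
  -- Parseval is applied to the truncations; dominated convergence with the constant `(∑ ‖b m‖)²`
  -- passes to the limit.
  let P : ℕ → Polynomial ℂ := fun N => ∑ i ∈ Finset.range N, Polynomial.monomial i (b i)
  have hev : ∀ N z, (P N).eval z = ∑ i ∈ Finset.range N, b i * z ^ i := fun N z => by
    simp [P, Polynomial.eval_finsetSum]
  have hco : ∀ N i, (P N).coeff i = if i < N then b i else 0 := fun N i => by
    simp [P, Polynomial.coeff_monomial]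
  have hsum : ∀ N, Real.circleAverage (fun z => ‖(P N).eval z‖ ^ 2) 0 1 =
      ∑ i ∈ Finset.range N, ‖b i‖ ^ 2 := fun N => by
    rw [← Polynomial.sum_sq_norm_coeff_eq_circleAverage]
    have h1 : (P N).support ⊆ Finset.range N := fun i hi => by
      rw [Polynomial.mem_support_iff, hco] at hi
      simp only [Finset.mem_range]
      by_contra h
      simp [h] at hi
    rw [Finset.sum_subset h1 (fun i _ hi => by
      rw [Polynomial.notMem_support_iff] at hi; simp [hi])]
    refine Finset.sum_congr rfl fun i hi => ?_
    rw [hco, if_pos (Finset.mem_range.1 hi)]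
  have h1 : Filter.Tendsto (fun N => Real.circleAverage (fun z => ‖(P N).eval z‖ ^ 2) 0 1)
      Filter.atTop (nhds (∑' n, ‖b n‖ ^ 2)) := by
    simp_rw [hsum]
    exact (summable_sq_norm hb).hasSum.tendsto_sum_nat
  refine tendsto_nhds_unique ?_ h1
  simp only [Real.circleAverage]
  refine Filter.Tendsto.const_smul ?_ _
  have hn : ∀ θ, ‖circleMap 0 1 θ‖ ≤ 1 := fun θ => by simp
  refine intervalIntegral.tendsto_integral_filter_of_dominated_convergence
    (fun _ => (∑' m, ‖b m‖) ^ 2) ?_ ?_ ?_ ?_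
  · refine Filter.Eventually.of_forall fun N => Continuous.aestronglyMeasurable ?_
    have := (P N).continuous
    have h2 := continuous_circleMap (0 : ℂ) 1
    fun_prop
  · refine Filter.Eventually.of_forall fun N => Filter.Eventually.of_forall fun θ _ => ?_
    rw [Real.norm_of_nonneg (by positivity), hev]
    gcongr
    exact norm_sum_le_tsum hb (hn θ) _
  · exact intervalIntegrable_const
  · refine Filter.Eventually.of_forall fun θ _ => ?_
    simp_rw [hev]
    exact ((summable_of_summable_norm hb (hn θ)).hasSum.tendsto_sum_nat.norm).pow 2

theorem powerSum_mul (b : ℕ → ℂ) (r z : ℂ) :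
    powerSum b (r * z) = powerSum (fun m => b m * r ^ m) z := by
  unfold powerSum
  refine tsum_congr fun m => ?_
  rw [mul_pow]; ring

theorem continuous_powerSum_circle {b : ℕ → ℂ} (hb : Summable fun m => ‖b m‖) :
    Continuous fun θ => powerSum b (circleMap 0 1 θ) := by
  unfold powerSum
  refine continuous_tsum (fun m => ?_) hb (fun m θ => ?_)
  · have h2 := continuous_circleMap (0 : ℂ) 1
    fun_prop
  · simp

/-- Parseval's identity on the circle of radius `r`, as a lower integral. -/
theorem lintegral_enorm_sq_powerSum {b : ℕ → ℂ} {r : ℝ} (h0 : 0 ≤ r)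
    (hb : Summable fun m => ‖b m‖ * r ^ m) :
    ∫⁻ θ in Set.Ioo (-Real.pi) Real.pi, ‖powerSum b (Complex.polarCoord.symm (r, θ))‖ₑ ^ 2 =
      ENNReal.ofReal (2 * Real.pi) * ∑' n, ‖b n‖ₑ ^ 2 * ENNReal.ofReal (r ^ (2 * n)) := by
  have hc : Summable fun m => ‖b m * (r : ℂ) ^ m‖ := by
    simpa [norm_mul, norm_pow, abs_of_nonneg h0] using hb
  have e : ∀ θ : ℝ, powerSum b (Complex.polarCoord.symm (r, θ)) =
      powerSum (fun m => b m * (r : ℂ) ^ m) (circleMap 0 1 θ) := fun θ => by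
    rw [← powerSum_mul, Complex.polarCoord_symm_apply]
    congr 2
    simp [circleMap, Complex.exp_mul_I]
  have hcont := continuous_powerSum_circle hc
  have h1 := circleAverage_norm_sq_powerSum hc
  rw [Real.circleAverage_eq_integral_add (-Real.pi),
    intervalIntegral.integral_comp_add_right (fun θ => ‖powerSum _ (circleMap 0 1 θ)‖ ^ 2)] at h1
  simp_rw [e]
  have hpi := Real.pi_pos
  have e2 : ∫ θ in Set.Ioo (-Real.pi) Real.pi,
      ‖powerSum (fun m => b m * (r : ℂ) ^ m) (circleMap 0 1 θ)‖ ^ 2 =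
      2 * Real.pi * ∑' n, ‖b n * (r : ℂ) ^ n‖ ^ 2 := by
    rw [← h1, ← integral_Ioc_eq_integral_Ioo, ← intervalIntegral.integral_of_le (by linarith),
      smul_eq_mul, zero_add, show 2 * Real.pi + -Real.pi = Real.pi by ring]
    field_simp
  have e3 : ∀ n, ‖b n‖ₑ ^ 2 * ENNReal.ofReal (r ^ (2 * n)) =
      ENNReal.ofReal (‖b n * (r : ℂ) ^ n‖ ^ 2) := fun n => by
    rw [← ofReal_norm, ← ENNReal.ofReal_pow (norm_nonneg _), ← ENNReal.ofReal_mul (by positivity),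
      norm_mul, norm_pow, Complex.norm_real, Real.norm_of_nonneg h0, mul_pow, ← pow_mul,
      mul_comm n 2]
  simp_rw [e3]
  rw [← ENNReal.ofReal_tsum_of_nonneg (fun _ => by positivity) (summable_sq_norm hc),
    ← ENNReal.ofReal_mul (by positivity), ← e2,
    ofReal_integral_eq_lintegral_ofReal _ (Filter.Eventually.of_forall fun _ => by positivity)]
  · refine lintegral_congr fun θ => ?_
    rw [ENNReal.ofReal_pow (norm_nonneg _), ofReal_norm]
  · exact ((hcont.norm.pow 2).integrableOn_Icc).mono_set Set.Ioo_subset_Icc_self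

theorem AbsConv.measurable_indicator {b : ℕ → ℂ} {R : ℝ} (hb : AbsConv b R) :
    Measurable ((ball (0 : ℂ) R).indicator (powerSum b)) := by
  classical
  rw [← Set.piecewise_eq_indicator]
  exact hb.differentiableOn.continuousOn.measurable_piecewise continuousOn_const
    measurableSet_ball

/-- The weighted area integral of `|h|²` for a radial weight. -/
theorem lintegral_enorm_sq_mul_radial {h : ℕ → ℂ} (hh : AbsConv h 1) {w : ℝ → ℝ≥0∞}
    (hw : Measurable w) :
    ∫⁻ z, ‖powerSum h z‖ₑ ^ 2 * w ‖z‖ ∂areaMeasure =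
      ∑' n, ‖h n‖ₑ ^ 2 * ∫⁻ r in Set.Ioo (0 : ℝ) 1, ENNReal.ofReal (2 * r ^ (2 * n + 1)) * w r := by
  -- The cut-off function is measurable on the whole plane, so polar coordinates apply; the cut
  -- reappears as the condition `r < 1`.
  set g := (ball (0 : ℂ) 1).indicator (powerSum h) with hg
  have hgm : Measurable g := hh.measurable_indicator
  have hpi := Real.pi_pos
  have hFm : Measurable fun z => ‖g z‖ₑ ^ 2 * w ‖z‖ :=
    (hgm.enorm.pow_const 2).mul (hw.comp measurable_norm)
  have e1 : ∀ z, (ball (0 : ℂ) 1).indicator (fun z => ‖powerSum h z‖ₑ ^ 2 * w ‖z‖) z =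
      ‖g z‖ₑ ^ 2 * w ‖z‖ := fun z => by
    by_cases hz : z ∈ ball (0 : ℂ) 1 <;> simp [hg, hz]
  rw [areaMeasure, lintegral_smul_measure, ← lintegral_indicator measurableSet_ball]
  simp_rw [e1]
  rw [← Complex.lintegral_comp_polarCoord_symm, polarCoord_target, Measure.volume_eq_prod,
    ← Measure.prod_restrict, lintegral_prod _ (by
      refine Measurable.aemeasurable ?_
      have hp : Measurable fun p : ℝ × ℝ => Complex.polarCoord.symm p := by
        simp only [Complex.polarCoord_symm_apply]
        fun_prop
      exact (ENNReal.measurable_ofReal.comp measurable_fst).smul (hFm.comp hp))]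
  have e2 : ∀ r : ℝ, 0 < r → ∫⁻ θ in Set.Ioo (-Real.pi) Real.pi, ENNReal.ofReal r •
      (‖g (Complex.polarCoord.symm (r, θ))‖ₑ ^ 2 * w ‖Complex.polarCoord.symm (r, θ)‖) =
      (Set.Iio 1).indicator (fun r => ENNReal.ofReal Real.pi * ∑' n, ‖h n‖ₑ ^ 2 *
        (ENNReal.ofReal (2 * r ^ (2 * n + 1)) * w r)) r := fun r hr => by
    have hnr : ∀ θ, ‖Complex.polarCoord.symm (r, θ)‖ = r := fun θ => by simp [abs_of_pos hr]
    simp_rw [hnr, smul_eq_mul]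
    by_cases h1 : r < 1
    · have hgr : ∀ θ, g (Complex.polarCoord.symm (r, θ)) =
          powerSum h (Complex.polarCoord.symm (r, θ)) := fun θ => by
        rw [hg, Set.indicator_of_mem]
        rw [mem_ball_zero_iff, hnr]
        exact h1
      simp_rw [hgr, ← mul_assoc, mul_comm _ (w r), ← mul_assoc]
      have hm : Measurable fun θ : ℝ => ‖powerSum h (Complex.polarCoord.symm (r, θ))‖ₑ ^ 2 := by
        simp_rw [← hgr]
        refine (hgm.comp ?_).enorm.pow_const 2
        simp only [Complex.polarCoord_symm_apply]
        fun_prop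
      rw [lintegral_const_mul _ hm, lintegral_enorm_sq_powerSum hr.le (hh r hr.le h1),
        Set.indicator_of_mem (by exact h1), ← mul_assoc, ← ENNReal.tsum_mul_left,
        ← ENNReal.tsum_mul_left]
      refine tsum_congr fun n => ?_
      have : ENNReal.ofReal (2 * Real.pi) * ENNReal.ofReal r * ENNReal.ofReal (r ^ (2 * n)) =
          ENNReal.ofReal Real.pi * ENNReal.ofReal (2 * r ^ (2 * n + 1)) := by
        rw [← ENNReal.ofReal_mul (by positivity), ← ENNReal.ofReal_mul (by positivity),
          ← ENNReal.ofReal_mul (by positivity)]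
        congr 1
        ring
      calc w r * ENNReal.ofReal r * ENNReal.ofReal (2 * Real.pi) *
            (‖h n‖ₑ ^ 2 * ENNReal.ofReal (r ^ (2 * n)))
          = w r * ‖h n‖ₑ ^ 2 * (ENNReal.ofReal (2 * Real.pi) * ENNReal.ofReal r *
            ENNReal.ofReal (r ^ (2 * n))) := by ring
        _ = _ := by rw [this]; ring
    · have hgr : ∀ θ, g (Complex.polarCoord.symm (r, θ)) = 0 := fun θ => by
        rw [hg, Set.indicator_of_notMem]
        rw [mem_ball_zero_iff, hnr]
        exact h1
      simp_rw [hgr]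
      simp [Set.indicator_of_notMem (show r ∉ Set.Iio 1 from h1)]
  rw [setLIntegral_congr_fun measurableSet_Ioi (fun r hr => e2 r hr),
    setLIntegral_indicator measurableSet_Iio, Set.inter_comm, Set.Ioi_inter_Iio,
    lintegral_const_mul' _ _ ENNReal.ofReal_ne_top, smul_eq_mul, ← mul_assoc,
    ← ENNReal.ofReal_mul (by positivity), inv_mul_cancel₀ hpi.ne', ENNReal.ofReal_one, one_mul,
    lintegral_tsum (fun n => by fun_prop)]
  refine tsum_congr fun n => ?_
  rw [lintegral_const_mul _ (by fun_prop)]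

/-! ### Radial moments and holomorphic change of variables -/

/-- A Beta integral in the variable `r²`; splitting off one factor `1 - r²` expresses order `k + 1`
through order `k` at `n` and `n + 1`. -/
theorem intervalIntegral_two_mul_pow (n k : ℕ) :
    ∫ r in (0 : ℝ)..1, 2 * r ^ (2 * n + 1) * (1 - r ^ 2) ^ k =
      (n ! : ℝ) * (k ! : ℝ) / ((n + k + 1)! : ℝ) := by
  induction k generalizing n with
  | zero =>
    simp [integral_pow, Nat.factorial_succ]
    field_simp
    ring
  | succ k ih =>
    have e : ∀ r : ℝ, 2 * r ^ (2 * n + 1) * (1 - r ^ 2) ^ (k + 1) =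
        2 * r ^ (2 * n + 1) * (1 - r ^ 2) ^ k - 2 * r ^ (2 * (n + 1) + 1) * (1 - r ^ 2) ^ k :=
      fun r => by ring
    simp_rw [e]
    rw [intervalIntegral.integral_sub (Continuous.intervalIntegrable (by fun_prop) _ _)
      (Continuous.intervalIntegrable (by fun_prop) _ _), ih, ih,
      show n + 1 + k + 1 = (n + k + 1) + 1 by ring, show n + (k + 1) + 1 = (n + k + 1) + 1 by ring]
    simp only [Nat.factorial_succ]
    push_cast
    field_simp
    ring

theorem lintegral_two_mul_pow (n k : ℕ) :
    ∫⁻ r in Set.Ioo (0 : ℝ) 1, ENNReal.ofReal (2 * r ^ (2 * n + 1)) *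
      ENNReal.ofReal ((1 - r ^ 2) ^ k) =
      ENNReal.ofReal ((n ! : ℝ) * (k ! : ℝ) / ((n + k + 1)! : ℝ)) := by
  rw [← intervalIntegral_two_mul_pow, intervalIntegral.integral_of_le zero_le_one,
    integral_Ioc_eq_integral_Ioo, ofReal_integral_eq_lintegral_ofReal]
  · refine setLIntegral_congr_fun measurableSet_Ioo fun r hr => ?_
    have := hr.1.le
    rw [← ENNReal.ofReal_mul (by positivity)]
  · exact (Continuous.integrableOn_Icc (by fun_prop)).mono_set Set.Ioo_subset_Icc_self
  · filter_upwards [ae_restrict_mem measurableSet_Ioo] with r hr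
    have h1 := hr.1.le
    have h2 : 0 ≤ 1 - r ^ 2 := by nlinarith [hr.1, hr.2]
    positivity

theorem intervalIntegral_two_mul_pow_log (n : ℕ) :
    IntervalIntegrable (fun r : ℝ => 2 * r ^ (2 * n + 1) * -Real.log (r ^ 2)) volume 0 1 ∧
    ∫ r in (0 : ℝ)..1, 2 * r ^ (2 * n + 1) * -Real.log (r ^ 2) = 1 / (n + 1 : ℝ) ^ 2 := by
  have hc : Continuous fun r : ℝ => r * Real.log r := Real.continuous_mul_log
  have e : ∀ r : ℝ, 2 * r ^ (2 * n + 1) * -Real.log (r ^ 2) =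
      -4 * r ^ (2 * n) * (r * Real.log r) := fun r => by
    rw [Real.log_pow]; push_cast; ring
  have hci : Continuous fun r : ℝ => 2 * r ^ (2 * n + 1) * -Real.log (r ^ 2) := by
    simp_rw [e]
    fun_prop
  refine ⟨hci.intervalIntegrable _ _, ?_⟩
  -- The antiderivative comes from integration by parts; written through `r * log r` it is
  -- continuous at `0`, where it vanishes.
  have h := intervalIntegral.integral_eq_sub_of_hasDeriv_right_of_le (a := 0) (b := 1)
    (f := fun r : ℝ => (-2 * r ^ (2 * n + 1) * (r * Real.log r)) / (n + 1) +
      r ^ (2 * n + 2) / (n + 1) ^ 2) zero_le_one (Continuous.continuousOn (by fun_prop))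
    (fun r hr => HasDerivAt.hasDerivWithinAt (f' := 2 * r ^ (2 * n + 1) * -Real.log (r ^ 2)) (by
      have h0 : r ≠ 0 := hr.1.ne'
      have h1 := (((hasDerivAt_pow (2 * n + 1) r).const_mul (-2)).mul
        (Real.hasDerivAt_mul_log h0)).div_const (n + 1 : ℝ)
      have h2 := (hasDerivAt_pow (2 * n + 2) r).div_const ((n + 1 : ℝ) ^ 2)
      refine (h1.add h2).congr_deriv ?_
      rw [Real.log_pow]
      simp only [Nat.add_sub_cancel, show 2 * n + 2 - 1 = 2 * n + 1 by omega]
      push_cast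
      field_simp
      ring)) (hci.intervalIntegrable _ _)
  rw [h]
  simp

theorem lintegral_two_mul_pow_log (n : ℕ) :
    ∫⁻ r in Set.Ioo (0 : ℝ) 1, ENNReal.ofReal (2 * r ^ (2 * n + 1)) *
      ENNReal.ofReal (-Real.log (r ^ 2)) = ENNReal.ofReal (1 / (n + 1 : ℝ) ^ 2) := by
  obtain ⟨hi, he⟩ := intervalIntegral_two_mul_pow_log n
  rw [← he, intervalIntegral.integral_of_le zero_le_one,
    integral_Ioc_eq_integral_Ioo, ofReal_integral_eq_lintegral_ofReal]
  · refine setLIntegral_congr_fun measurableSet_Ioo fun r hr => ?_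
    have := hr.1.le
    rw [← ENNReal.ofReal_mul (by positivity)]
  · exact (hi.1).mono_set Set.Ioo_subset_Ioc_self
  · filter_upwards [ae_restrict_mem measurableSet_Ioo] with r hr
    have h1 := hr.1.le
    have h2 : 0 ≤ -Real.log (r ^ 2) := by
      have := Real.log_nonpos (sq_nonneg r) (by nlinarith [hr.1, hr.2])
      linarith
    positivity

/-- Change of variables under an injective holomorphic map. -/
theorem lintegral_image_eq_lintegral_enorm_deriv {s : Set ℂ} (hs : MeasurableSet s) {u u' : ℂ → ℂ}
    (hu : ∀ z ∈ s, HasDerivAt u (u' z) z) (hi : Set.InjOn u s) (F : ℂ → ℝ≥0∞) :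
    ∫⁻ z in u '' s, F z = ∫⁻ z in s, ‖u' z‖ₑ ^ 2 * F (u z) := by
  rw [lintegral_image_eq_lintegral_abs_det_fderiv_mul volume hs
    (fun z hz => ((hu z hz).hasFDerivAt.restrictScalars ℝ).hasFDerivWithinAt) hi]
  refine setLIntegral_congr_fun hs fun z _ => ?_
  congr 1
  rw [← ofReal_norm, ← ENNReal.ofReal_pow (norm_nonneg _)]
  congr 1
  -- Multiplication by `u'` on the real plane has determinant `|u'|²`.
  simp [ContinuousLinearMap.det, LinearMap.det_restrictScalars, Algebra.norm_complex_eq,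
    Complex.normSq_eq_norm_sq]

/-! ### The Green-Almansi kernel -/

/-- The normalized Green-Almansi kernel `(-1)^(k+1) G_k(z, ζ) / (1 - |ζ|²)^k`. -/
def greenKernel (k : ℕ) (z ζ : ℂ) : ℝ := (-1) ^ (k + 1) * greenAlmansi k z ζ / (1 - ‖ζ‖ ^ 2) ^ k

/-- Every old term gains a factor `|ζ - z|²`, and the new term `l = k` carries no power of `|ζ -
z|`. -/
theorem greenAlmansi_succ {k : ℕ} (hk : 1 ≤ k) (z ζ : ℂ) :
    greenAlmansi (k + 1) z ζ = ‖ζ - z‖ ^ 2 * greenAlmansi k z ζ +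
      (-1) ^ k / k * (1 - ‖ζ‖ ^ 2) ^ k * (1 - ‖z‖ ^ 2) ^ k := by
  obtain ⟨m, rfl⟩ := Nat.exists_eq_add_of_le' hk
  unfold greenAlmansi
  simp only [Nat.add_sub_cancel]
  have : ∀ l ∈ Finset.Icc 1 m, (-1 : ℝ) ^ l / l * ‖ζ - z‖ ^ (2 * (m + 1 - l)) *
      (1 - ‖ζ‖ ^ 2) ^ l * (1 - ‖z‖ ^ 2) ^ l = ‖ζ - z‖ ^ 2 * ((-1 : ℝ) ^ l / l *
      ‖ζ - z‖ ^ (2 * (m - l)) * (1 - ‖ζ‖ ^ 2) ^ l * (1 - ‖z‖ ^ 2) ^ l) := fun l hl => by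
    rw [show 2 * (m + 1 - l) = 2 * (m - l) + 2 by
      have := (Finset.mem_Icc.1 hl).2; omega, pow_add]
    ring
  rw [Finset.sum_Icc_succ_top (by omega), Finset.sum_congr rfl this, ← Finset.mul_sum,
    Nat.sub_self, mul_zero, pow_zero, mul_one, show 2 * (m + 1) = 2 * m + 2 by ring, pow_add]
  ring

theorem one_sub_sq_pos {z : ℂ} (hz : ‖z‖ < 1) : 0 < 1 - ‖z‖ ^ 2 := by
  nlinarith [norm_nonneg z]

/-- The normalizing sign turns the recursion into one with nonnegative coefficients. Its right side
is radial in `z`, which is what makes induction on `k` work for the energies. -/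
theorem greenKernel_succ {k : ℕ} (hk : 1 ≤ k) (z : ℂ) {ζ : ℂ} (hζ : ‖ζ‖ < 1) :
    (1 - ‖ζ‖ ^ 2) * greenKernel (k + 1) z ζ + ‖ζ - z‖ ^ 2 * greenKernel k z ζ =
      (1 - ‖z‖ ^ 2) ^ k / k := by
  have h := one_sub_sq_pos hζ
  have hk' : (k : ℝ) ≠ 0 := by positivity
  have hs : ((-1 : ℝ) ^ k) ^ 2 = 1 := by rw [← pow_mul, mul_comm, pow_mul]; simp
  unfold greenKernel
  rw [greenAlmansi_succ hk, pow_succ (-1 : ℝ) (k + 1), pow_succ (-1 : ℝ) k,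
    pow_succ (1 - ‖ζ‖ ^ 2) k]
  generalize (-1 : ℝ) ^ k = e at hs
  generalize greenAlmansi k z ζ = G
  have h2 : (1 - ‖ζ‖ ^ 2) ^ k ≠ 0 := (pow_pos h k).ne'
  generalize (1 - ‖ζ‖ ^ 2) ^ k = A at h2
  generalize 1 - ‖ζ‖ ^ 2 = a at h
  field_simp
  linear_combination (1 - ‖z‖ ^ 2) ^ k * A * hs

theorem norm_one_sub_mul_conj_sq (z ζ : ℂ) :
    ‖1 - z * conj ζ‖ ^ 2 = ‖ζ - z‖ ^ 2 + (1 - ‖z‖ ^ 2) * (1 - ‖ζ‖ ^ 2) := by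
  rw [← Complex.normSq_eq_norm_sq, ← Complex.normSq_eq_norm_sq, ← Complex.normSq_eq_norm_sq,
    ← Complex.normSq_eq_norm_sq]
  simp [Complex.normSq_apply]
  ring

/-- The denominator of the integral representation of the kernel. -/
theorem kernel_denom_pos {z ζ : ℂ} (hne : z ≠ ζ) (hζ : ‖ζ‖ < 1) {s : ℝ} (hs : 0 ≤ s) :
    0 < ‖ζ - z‖ ^ 2 + s * (1 - ‖ζ‖ ^ 2) := by
  have h1 : 0 < ‖ζ - z‖ := norm_pos_iff.2 (sub_ne_zero.2 hne.symm)
  have h2 := one_sub_sq_pos hζ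
  positivity

theorem kernel_continuousOn {z ζ : ℂ} (hne : z ≠ ζ) (hζ : ‖ζ‖ < 1) (k : ℕ) (b : ℝ) (hb : 0 ≤ b) :
    ContinuousOn (fun s : ℝ => s ^ k / (‖ζ - z‖ ^ 2 + s * (1 - ‖ζ‖ ^ 2))) (Set.uIcc 0 b) := by
  refine ContinuousOn.div (by fun_prop) (by fun_prop) fun s hs => ?_
  rw [Set.uIcc_of_le hb] at hs
  exact (kernel_denom_pos hne hζ hs.1).ne'

/-- For `k = 1` the integral is a logarithm. Both sides satisfy the recursion `greenKernel_succ`,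
since the two integrands, with coefficients `1 - |ζ|²` and `|ζ - z|²`, add up to `s^(k-1)`.
Positivity and the comparison under dilation are visible only in this form. -/
theorem greenKernel_eq_integral {k : ℕ} (hk : 1 ≤ k) {z ζ : ℂ} (hz : ‖z‖ < 1) (hζ : ‖ζ‖ < 1)
    (hne : z ≠ ζ) : greenKernel k z ζ =
      ∫ s in (0 : ℝ)..(1 - ‖z‖ ^ 2), s ^ (k - 1) / (‖ζ - z‖ ^ 2 + s * (1 - ‖ζ‖ ^ 2)) := by
  have ha := one_sub_sq_pos hζ
  have hr := one_sub_sq_pos hz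
  have hd : 0 < ‖ζ - z‖ ^ 2 := by simpa using kernel_denom_pos hne hζ le_rfl
  have hii : ∀ k, IntervalIntegrable (fun s : ℝ => s ^ k / (‖ζ - z‖ ^ 2 + s * (1 - ‖ζ‖ ^ 2)))
      volume 0 (1 - ‖z‖ ^ 2) := fun k =>
    (kernel_continuousOn hne hζ k _ hr.le).intervalIntegrable
  induction k, hk using Nat.le_induction with
  | base =>
    have h := intervalIntegral.integral_eq_sub_of_hasDerivAt
      (f := fun s : ℝ => Real.log (‖ζ - z‖ ^ 2 + s * (1 - ‖ζ‖ ^ 2)) / (1 - ‖ζ‖ ^ 2))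
      (f' := fun s : ℝ => s ^ 0 / (‖ζ - z‖ ^ 2 + s * (1 - ‖ζ‖ ^ 2)))
      (a := 0) (b := 1 - ‖z‖ ^ 2) (fun s hs => by
        rw [Set.uIcc_of_le hr.le] at hs
        have hp := kernel_denom_pos hne hζ hs.1
        have h1 := ((((hasDerivAt_id s).mul_const (1 - ‖ζ‖ ^ 2)).const_add
          (‖ζ - z‖ ^ 2)).log hp.ne').div_const (1 - ‖ζ‖ ^ 2)
        refine h1.congr_deriv ?_
        simp only [id, pow_zero, one_mul]
        field_simp) (hii 0)
    rw [Nat.sub_self, h, greenKernel, greenAlmansi, norm_div, div_pow,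
      Real.log_div (by rw [norm_one_sub_mul_conj_sq]; positivity) hd.ne', norm_one_sub_mul_conj_sq]
    simp
    ring
  | succ k hk ih =>
    have h1 := greenKernel_succ hk z hζ
    have h2 : (1 - ‖ζ‖ ^ 2) * (∫ s in (0 : ℝ)..(1 - ‖z‖ ^ 2),
        s ^ (k + 1 - 1) / (‖ζ - z‖ ^ 2 + s * (1 - ‖ζ‖ ^ 2))) +
        ‖ζ - z‖ ^ 2 * (∫ s in (0 : ℝ)..(1 - ‖z‖ ^ 2),
        s ^ (k - 1) / (‖ζ - z‖ ^ 2 + s * (1 - ‖ζ‖ ^ 2))) = (1 - ‖z‖ ^ 2) ^ k / k := by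
      rw [← intervalIntegral.integral_const_mul, ← intervalIntegral.integral_const_mul,
        ← intervalIntegral.integral_add ((hii _).const_mul _) ((hii _).const_mul _)]
      have e : ∫ s in (0 : ℝ)..(1 - ‖z‖ ^ 2), s ^ (k - 1) = (1 - ‖z‖ ^ 2) ^ k / k := by
        obtain ⟨m, rfl⟩ := Nat.exists_eq_add_of_le' hk
        simp [integral_pow]
      rw [← e]
      refine intervalIntegral.integral_congr fun s hs => ?_
      rw [Set.uIcc_of_le hr.le] at hs
      have hp := kernel_denom_pos hne hζ hs.1
      obtain ⟨m, rfl⟩ := Nat.exists_eq_add_of_le' hk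
      simp only [Nat.add_sub_cancel]
      rw [← mul_div_assoc, ← mul_div_assoc, ← add_div, div_eq_iff hp.ne']
      ring
    rw [← ih] at h2
    exact mul_left_cancel₀ ha.ne' (by linarith)

theorem greenKernel_nonneg {k : ℕ} (hk : 1 ≤ k) {z ζ : ℂ} (hz : ‖z‖ < 1) (hζ : ‖ζ‖ < 1)
    (hne : z ≠ ζ) : 0 ≤ greenKernel k z ζ := by
  rw [greenKernel_eq_integral hk hz hζ hne]
  refine intervalIntegral.integral_nonneg (one_sub_sq_pos hz).le fun s hs => ?_
  have := kernel_denom_pos hne hζ hs.1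
  have := hs.1
  positivity

theorem greenKernel_one (z ζ : ℂ) : greenKernel 1 z ζ =
    Real.log (‖(1 - z * conj ζ) / (ζ - z)‖ ^ 2) / (1 - ‖ζ‖ ^ 2) := by
  simp [greenKernel, greenAlmansi]

/-- The constant is chosen so that, with `s = t / R²`, the two denominators compare: `lam ≥ 1`
handles the term without `t`, and `lam * (1 - |ζ|²/R²) = 1 - |ζ|²` the term with `t`. The interval
of integration only grows, from `R²(1 - |z|²)` to `1 - R²|z|²`. -/
theorem greenKernel_scale_le {k : ℕ} (hk : 1 ≤ k) {z ζ : ℂ} {R : ℝ} (hR : R < 1) (hζ : ‖ζ‖ < R)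
    (hz : ‖z‖ < 1) (hne : z ≠ ζ / R) :
    R ^ (2 * k - 2) * greenKernel k z (ζ / R) ≤
      (1 - ‖ζ‖ ^ 2) / (1 - ‖ζ‖ ^ 2 / R ^ 2) * greenKernel k (R * z) ζ := by
  have hR0 : 0 < R := (norm_nonneg ζ).trans_lt hζ
  have hζ1 : ‖ζ‖ < 1 := hζ.trans hR
  have hζR : ‖ζ / R‖ < 1 := by
    rw [norm_div, Complex.norm_real, Real.norm_of_nonneg hR0.le, div_lt_one hR0]; exact hζ
  have hRc : (R : ℂ) ≠ 0 := by exact_mod_cast hR0.ne'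
  have hne' : (R * z : ℂ) ≠ ζ := fun h => hne (by rw [← h]; field_simp)
  have hRz : ‖(R * z : ℂ)‖ = R * ‖z‖ := by
    rw [norm_mul, Complex.norm_real, Real.norm_of_nonneg hR0.le]
  have hRz1 : ‖(R * z : ℂ)‖ < 1 := by
    rw [hRz]; nlinarith [norm_nonneg z]
  rw [greenKernel_eq_integral hk hz hζR hne, greenKernel_eq_integral hk hRz1 hζ1 hne']
  have ha := one_sub_sq_pos hζ1
  have ha2 := one_sub_sq_pos hζR
  have hr := one_sub_sq_pos hz
  have e1 : ‖ζ / R‖ ^ 2 = ‖ζ‖ ^ 2 / R ^ 2 := by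
    rw [norm_div, Complex.norm_real, Real.norm_of_nonneg hR0.le, div_pow]
  have e2 : ‖ζ / R - z‖ ^ 2 = ‖ζ - R * z‖ ^ 2 / R ^ 2 := by
    rw [show ζ / R - z = (ζ - R * z) / R by field_simp, norm_div, Complex.norm_real,
      Real.norm_of_nonneg hR0.le, div_pow]
  rw [e1] at ha2
  have hR2 : 0 < R ^ 2 := by positivity
  set lam := (1 - ‖ζ‖ ^ 2) / (1 - ‖ζ‖ ^ 2 / R ^ 2) with hlam
  have hlam1 : 1 ≤ lam := by
    rw [hlam, one_le_div ha2]
    have : ‖ζ‖ ^ 2 ≤ ‖ζ‖ ^ 2 / R ^ 2 := by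
      rw [le_div_iff₀ hR2]
      exact mul_le_of_le_one_right (sq_nonneg _) (pow_le_one₀ hR0.le hR.le)
    linarith
  -- substitute `s = t / R ^ 2`
  have e3 : R ^ (2 * k - 2) * (∫ s in (0 : ℝ)..(1 - ‖z‖ ^ 2),
      s ^ (k - 1) / (‖ζ / R - z‖ ^ 2 + s * (1 - ‖ζ / R‖ ^ 2))) =
      ∫ t in (0 : ℝ)..(R ^ 2 * (1 - ‖z‖ ^ 2)),
        t ^ (k - 1) / (‖ζ - R * z‖ ^ 2 + t * (1 - ‖ζ‖ ^ 2 / R ^ 2)) := by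
    have := intervalIntegral.integral_comp_mul_left (a := 0) (b := 1 - ‖z‖ ^ 2)
      (fun t : ℝ => t ^ (k - 1) / (‖ζ - R * z‖ ^ 2 + t * (1 - ‖ζ‖ ^ 2 / R ^ 2))) hR2.ne'
    rw [mul_zero, smul_eq_mul, ← inv_mul_eq_iff_eq_mul₀ (inv_ne_zero hR2.ne'), inv_inv] at this
    rw [← this, ← intervalIntegral.integral_const_mul, ← intervalIntegral.integral_const_mul]
    refine intervalIntegral.integral_congr fun s _ => ?_
    simp only [e1, e2]
    rw [show 2 * k - 2 = 2 * (k - 1) by omega, mul_pow, pow_mul]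
    rw [show ‖ζ - R * z‖ ^ 2 + R ^ 2 * s * (1 - ‖ζ‖ ^ 2 / R ^ 2) =
      R ^ 2 * (‖ζ - R * z‖ ^ 2 / R ^ 2 + s * (1 - ‖ζ‖ ^ 2 / R ^ 2)) by field_simp]
    rw [← mul_div_assoc, ← mul_div_assoc, mul_div_mul_left _ _ hR2.ne']
  have hd : 0 < ‖ζ - R * z‖ ^ 2 := by simpa using kernel_denom_pos hne' hζ1 le_rfl
  have hb : R ^ 2 * (1 - ‖z‖ ^ 2) ≤ 1 - ‖(R * z : ℂ)‖ ^ 2 := by rw [hRz]; nlinarith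
  have hb0 : 0 ≤ R ^ 2 * (1 - ‖z‖ ^ 2) := by positivity
  rw [e3, ← intervalIntegral.integral_const_mul]
  have hpos : ∀ t : ℝ, 0 ≤ t → 0 ≤ lam * (t ^ (k - 1) / (‖ζ - R * z‖ ^ 2 + t * (1 - ‖ζ‖ ^ 2))) :=
    fun t ht => by
      have := kernel_denom_pos hne' hζ1 ht
      positivity
  refine (intervalIntegral.integral_mono_on hb0 ?_ ?_ (fun t ht => ?_)).trans
    (intervalIntegral.integral_mono_interval le_rfl hb0 hb ?_ ?_)
  · refine ContinuousOn.intervalIntegrable (ContinuousOn.div (by fun_prop) (by fun_prop) fun s hs => ?_)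
    rw [Set.uIcc_of_le hb0] at hs
    have := hs.1
    positivity
  · exact ((kernel_continuousOn hne' hζ1 _ _ hb0).const_smul lam).intervalIntegrable
  · have ht0 := ht.1
    have := kernel_denom_pos hne' hζ1 ht0
    rw [← mul_div_assoc, div_le_div_iff₀ (by positivity) this]
    have e4 : lam * (1 - ‖ζ‖ ^ 2 / R ^ 2) = 1 - ‖ζ‖ ^ 2 := div_mul_cancel₀ _ ha2.ne'
    have e5 : ‖ζ - R * z‖ ^ 2 + t * (1 - ‖ζ‖ ^ 2) ≤
        lam * (‖ζ - R * z‖ ^ 2 + t * (1 - ‖ζ‖ ^ 2 / R ^ 2)) := by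
      rw [mul_add, mul_left_comm, e4]
      nlinarith
    calc t ^ (k - 1) * (‖ζ - R * z‖ ^ 2 + t * (1 - ‖ζ‖ ^ 2)) ≤
        t ^ (k - 1) * (lam * (‖ζ - R * z‖ ^ 2 + t * (1 - ‖ζ‖ ^ 2 / R ^ 2))) := by gcongr
      _ = _ := by ring
  · filter_upwards [ae_restrict_mem measurableSet_Ioc] with t ht
    exact hpos t ht.1.le
  · exact ((kernel_continuousOn hne' hζ1 _ _ (hb0.trans hb)).const_smul lam).intervalIntegrable

theorem continuousAt_greenKernel (k : ℕ) {z ζ : ℂ} (hz : ‖z‖ < 1) (hζ : ‖ζ‖ < 1) (hne : z ≠ ζ) :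
    ContinuousAt (fun w => greenKernel k z w) ζ := by
  have h1 : ζ - z ≠ 0 := sub_ne_zero.2 hne.symm
  have h2 : 1 - z * conj ζ ≠ 0 := fun h => by
    have h3 := norm_one_sub_mul_conj_sq z ζ
    rw [h, norm_zero] at h3
    have h4 := one_sub_sq_pos hz
    have h5 := one_sub_sq_pos hζ
    have : 0 < ‖ζ - z‖ := norm_pos_iff.2 h1
    have : 0 < ‖ζ - z‖ ^ 2 + (1 - ‖z‖ ^ 2) * (1 - ‖ζ‖ ^ 2) := by positivity
    simp at h3
    linarith
  have h3 : ‖(1 - z * conj ζ) / (ζ - z)‖ ^ 2 ≠ 0 := by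
    simp [h1, h2]
  have hc : ContinuousAt (fun w : ℂ => conj w) ζ := Complex.continuous_conj.continuousAt
  have h4 : ContinuousAt (fun w : ℂ => ‖(1 - z * conj w) / (w - z)‖ ^ 2) ζ := by
    have i1 : ContinuousAt (fun w : ℂ => 1 - z * conj w) ζ :=
      continuousAt_const.sub (continuousAt_const.mul hc)
    have i2 : ContinuousAt (fun w : ℂ => w - z) ζ := continuousAt_id.sub continuousAt_const
    exact (i1.div i2 h1).norm.pow 2
  have h5 : ContinuousAt (fun w : ℂ => ‖w - z‖) ζ := by fun_prop
  have h6 : ContinuousAt (fun w : ℂ => 1 - ‖w‖ ^ 2) ζ := by fun_prop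
  have h7 : ContinuousAt (fun w => greenAlmansi k z w) ζ := by
    unfold greenAlmansi
    have i2 : ContinuousAt (fun w : ℂ => ‖w - z‖ ^ (2 * (k - 1)) *
        Real.log (‖(1 - z * conj w) / (w - z)‖ ^ 2)) ζ := (h5.pow _).mul (h4.log h3)
    refine i2.add (tendsto_finsetSum _ fun l _ => ?_)
    have i1 : ContinuousAt (fun w : ℂ => (-1 : ℝ) ^ l / l * ‖w - z‖ ^ (2 * (k - 1 - l))) ζ :=
      continuousAt_const.mul (h5.pow _)
    exact (i1.mul (h6.pow _)).mul continuousAt_const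
  exact (continuousAt_const.mul h7).div (h6.pow k) (pow_ne_zero _ (one_sub_sq_pos hζ).ne')

/-! ### Interior points, order one: disc automorphisms -/

/-- The weighted integral `∫ |f^(k)|² (-1)^(k+1) G_k(·, ζ) / (1 - |ζ|²)^k dA` of the power series
`f` with coefficients `a`. -/
def discEnergy (k : ℕ) (ζ : ℂ) (a : ℕ → ℂ) : ℝ≥0∞ :=
  ∫⁻ z, ‖powerSum (derivCoeff k a) z‖ₑ ^ 2 * ENNReal.ofReal (greenKernel k z ζ) ∂areaMeasure

/-- The coefficients of the difference quotient `(f - f(ζ)) / (z - ζ)`. -/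
def quotCoeff (ζ : ℂ) (a : ℕ → ℂ) (p : ℕ) : ℂ := powerSum (fun m => a (m + (p + 1))) ζ

/-- The involutive automorphism of the disc exchanging `0` and `ζ`. -/
def moebius (ζ w : ℂ) : ℂ := (ζ - w) / (1 - conj ζ * w)

theorem one_sub_conj_mul_ne_zero {ζ w : ℂ} (hζ : ‖ζ‖ < 1) (hw : ‖w‖ ≤ 1) : 1 - conj ζ * w ≠ 0 := by
  intro h
  have h1 : ‖conj ζ * w‖ = 1 := by rw [← sub_eq_zero.1 h, norm_one]
  rw [norm_mul, RCLike.norm_conj] at h1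
  nlinarith [norm_nonneg ζ, norm_nonneg w]

theorem norm_one_sub_conj_mul_sq (ζ w : ℂ) :
    ‖1 - conj ζ * w‖ ^ 2 = ‖ζ - w‖ ^ 2 + (1 - ‖w‖ ^ 2) * (1 - ‖ζ‖ ^ 2) := by
  rw [mul_comm, norm_one_sub_mul_conj_sq]

theorem norm_moebius_lt {ζ w : ℂ} (hζ : ‖ζ‖ < 1) (hw : ‖w‖ < 1) : ‖moebius ζ w‖ < 1 := by
  have h0 := norm_pos_iff.2 (one_sub_conj_mul_ne_zero hζ hw.le)
  rw [moebius, norm_div, div_lt_one h0]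
  refine lt_of_pow_lt_pow_left₀ 2 (norm_nonneg _) ?_
  rw [norm_one_sub_conj_mul_sq]
  nlinarith [mul_pos (one_sub_sq_pos hζ) (one_sub_sq_pos hw)]

theorem norm_moebius_eq_one {ζ w : ℂ} (hζ : ‖ζ‖ < 1) (hw : ‖w‖ = 1) : ‖moebius ζ w‖ = 1 := by
  have h0 := norm_pos_iff.2 (one_sub_conj_mul_ne_zero hζ hw.le)
  rw [moebius, norm_div, div_eq_one_iff_eq h0.ne']
  refine (pow_left_inj₀ (norm_nonneg _) (norm_nonneg _) two_ne_zero).1 ?_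
  rw [norm_one_sub_conj_mul_sq, hw]
  simp

theorem moebius_moebius {ζ w : ℂ} (hζ : ‖ζ‖ < 1) (hw : ‖w‖ < 1) :
    moebius ζ (moebius ζ w) = w := by
  have h0 := one_sub_conj_mul_ne_zero hζ hw.le
  have h1 : 1 - conj ζ * ζ ≠ 0 := one_sub_conj_mul_ne_zero hζ hζ.le
  have h2 := one_sub_conj_mul_ne_zero hζ (norm_moebius_lt hζ hw).le
  rw [moebius, div_eq_iff h2]
  have h3 : moebius ζ w * (1 - conj ζ * w) = ζ - w := div_mul_cancel₀ _ h0
  refine mul_right_cancel₀ h0 ?_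
  linear_combination (conj ζ * w - 1) * h3

theorem hasDerivAt_moebius {ζ w : ℂ} (h : 1 - conj ζ * w ≠ 0) :
    HasDerivAt (moebius ζ) (-(1 - conj ζ * ζ) / (1 - conj ζ * w) ^ 2) w := by
  have h1 := ((hasDerivAt_id w).const_sub ζ).div
    (((hasDerivAt_id w).const_mul (conj ζ)).const_sub 1) h
  refine h1.congr_deriv ?_
  simp only [id]
  congr 1
  ring

theorem image_moebius {ζ : ℂ} (hζ : ‖ζ‖ < 1) : moebius ζ '' ball 0 1 = ball 0 1 := by
  refine Set.Subset.antisymm ?_ fun w hw => ?_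
  · rintro _ ⟨w, hw, rfl⟩
    simpa using norm_moebius_lt hζ (by simpa using hw)
  · have hw' : ‖w‖ < 1 := by simpa using hw
    exact ⟨moebius ζ w, by simpa using norm_moebius_lt hζ hw', moebius_moebius hζ hw'⟩

theorem injOn_moebius {ζ : ℂ} (hζ : ‖ζ‖ < 1) : Set.InjOn (moebius ζ) (ball 0 1) :=
  fun x hx y hy h => by
    rw [← moebius_moebius hζ (show ‖x‖ < 1 by simpa using hx), h,
      moebius_moebius hζ (show ‖y‖ < 1 by simpa using hy)]

/-- The automorphism maps a slightly larger disc into any given larger disc. -/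
theorem exists_radius_moebius {ζ : ℂ} (hζ : ‖ζ‖ < 1) {R : ℝ} (hR : 1 < R) :
    ∃ S, 1 < S ∧ ∀ w, ‖w‖ < S → 1 - conj ζ * w ≠ 0 ∧ ‖moebius ζ w‖ < R := by
  have hU : IsOpen {w : ℂ | ‖ζ - w‖ < R * ‖1 - conj ζ * w‖} :=
    isOpen_lt (by fun_prop) (by fun_prop)
  have hsub : closedBall (0 : ℂ) 1 ⊆ {w : ℂ | ‖ζ - w‖ < R * ‖1 - conj ζ * w‖} := fun w hw => by
    have hw' : ‖w‖ ≤ 1 := by simpa using hw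
    have h0 := norm_pos_iff.2 (one_sub_conj_mul_ne_zero hζ hw')
    have h1 : ‖ζ - w‖ ≤ ‖1 - conj ζ * w‖ := by
      refine le_of_sq_le_sq ?_ (norm_nonneg _)
      rw [norm_one_sub_conj_mul_sq]
      have : 0 ≤ 1 - ‖w‖ ^ 2 := by nlinarith [norm_nonneg w]
      nlinarith [mul_nonneg this (one_sub_sq_pos hζ).le]
    simp only [Set.mem_ofPred_eq]
    nlinarith
  -- By compactness the strict inequality, valid on the closed disc, persists on a slightly larger
  -- disc.
  obtain ⟨δ, hδ, h⟩ := (isCompact_closedBall (0 : ℂ) 1).exists_thickening_subset_open hU hsub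
  rw [thickening_closedBall hδ zero_le_one] at h
  refine ⟨δ + 1, by linarith, fun w hw => ?_⟩
  have h1 : ‖ζ - w‖ < R * ‖1 - conj ζ * w‖ := h (show w ∈ ball 0 (δ + 1) by simpa using hw)
  have h2 : 1 - conj ζ * w ≠ 0 := fun h3 => by
    rw [h3, norm_zero, mul_zero] at h1
    exact absurd h1 (norm_nonneg _).not_gt
  refine ⟨h2, ?_⟩
  rw [moebius, norm_div, div_lt_iff₀ (norm_pos_iff.2 h2)]
  exact h1

/-- A point is Lebesgue null, so the value of a kernel at its singularity never matters. -/
theorem ae_areaMeasure_of_forall {p : ℂ → Prop} (ζ : ℂ) (h : ∀ z, ‖z‖ < 1 → z ≠ ζ → p z) :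
    ∀ᵐ z ∂areaMeasure, p z := by
  refine Measure.ae_smul_measure ?_ _
  rw [ae_restrict_iff' measurableSet_ball]
  filter_upwards [compl_mem_ae_iff.2 (measure_singleton ζ)] with z hz hz1
  exact h z (by simpa using hz1) (by simpa using hz)

/-- The circle average of `|f|²` composed with the automorphism. -/
def moebiusAverage (ζ : ℂ) (a : ℕ → ℂ) : ℝ :=
  Real.circleAverage (fun w => ‖powerSum a (moebius ζ w)‖ ^ 2) 0 1

/-- Littlewood-Paley formula at `ζ`: the automorphism moves `ζ` to `0`, where the kernel becomes
`-log |w|²`. Its moments `1/(n+1)²` cancel the squares produced by differentiation, leaving `∑_{n ≥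
1} |b n|²` for the transported function, that is, its circle average minus the squared value at the
centre. -/
theorem discEnergy_one_eq {ζ : ℂ} (hζ : ‖ζ‖ < 1) {a : ℕ → ℂ} {R : ℝ} (hR : 1 < R)
    (ha : AbsConv a R) : 0 ≤ moebiusAverage ζ a - ‖powerSum a ζ‖ ^ 2 ∧
      ENNReal.ofReal (1 - ‖ζ‖ ^ 2) * discEnergy 1 ζ a =
        ENNReal.ofReal (moebiusAverage ζ a - ‖powerSum a ζ‖ ^ 2) := by
  obtain ⟨S, hS, hmob⟩ := exists_radius_moebius hζ hR
  have hpos := one_sub_sq_pos hζ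
  set H : ℂ → ℂ := fun w => powerSum a (moebius ζ w) with hH
  have hHd : ∀ w, ‖w‖ < S → HasDerivAt H (powerSum (derivCoeff 1 a) (moebius ζ w) *
      (-(1 - conj ζ * ζ) / (1 - conj ζ * w) ^ 2)) w := fun w hw =>
    (ha.hasDerivAt (hmob w hw).2).comp w (hasDerivAt_moebius (hmob w hw).1)
  have hHdiff : DifferentiableOn ℂ H (ball 0 S) := fun w hw =>
    (hHd w (by simpa using hw)).differentiableAt.differentiableWithinAt
  set b := taylorCoeff H with hb
  have hbc : AbsConv b S := absConv_taylorCoeff hHdiff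
  have hbs := hbc.summable_norm hS
  have hHb : ∀ w, ‖w‖ < S → powerSum b w = H w := fun w hw => powerSum_taylorCoeff hHdiff hw
  have hb0 : b 0 = powerSum a ζ := by
    rw [← powerSum_zero b, hHb 0 (by simpa using zero_lt_one.trans hS), hH]
    simp [moebius]
  have hI : moebiusAverage ζ a = ∑' n, ‖b n‖ ^ 2 := by
    rw [← circleAverage_norm_sq_powerSum hbs, moebiusAverage]
    refine Real.circleAverage_congr_sphere fun w hw => ?_
    have : ‖w‖ < S := by
      have : ‖w‖ = 1 := by simpa using hw
      linarith
    simp only [hHb w this, hH]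
  have hsq := summable_sq_norm hbs
  have hE : moebiusAverage ζ a - ‖powerSum a ζ‖ ^ 2 = ∑' n, ‖b (n + 1)‖ ^ 2 := by
    rw [hI, hsq.tsum_eq_zero_add, hb0]
    ring
  refine ⟨hE ▸ tsum_nonneg fun _ => by positivity, ?_⟩
  have hdH : ∀ w, ‖w‖ < S → powerSum (derivCoeff 1 b) w =
      powerSum (derivCoeff 1 a) (moebius ζ w) * (-(1 - conj ζ * ζ) / (1 - conj ζ * w) ^ 2) :=
    fun w hw => by
      refine (hbc.hasDerivAt hw).unique ((hHd w hw).congr_of_eventuallyEq ?_)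
      filter_upwards [isOpen_ball.mem_nhds (show w ∈ ball (0 : ℂ) S by simpa using hw)] with y hy
      exact hHb y (by simpa using hy)
  have h1 : ENNReal.ofReal (1 - ‖ζ‖ ^ 2) * discEnergy 1 ζ a =
      ∫⁻ z, ‖powerSum (derivCoeff 1 a) z‖ₑ ^ 2 *
        ENNReal.ofReal (-Real.log (‖moebius ζ z‖ ^ 2)) ∂areaMeasure := by
    rw [discEnergy, ← lintegral_const_mul' _ _ ENNReal.ofReal_ne_top]
    refine lintegral_congr fun z => ?_
    rw [mul_left_comm, ← ENNReal.ofReal_mul hpos.le, greenKernel_one, mul_div_cancel₀ _ hpos.ne',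
      ← Real.log_inv, ← inv_pow, ← norm_inv, moebius, inv_div, mul_comm z]
  have h2 : ∫⁻ z, ‖powerSum (derivCoeff 1 a) z‖ₑ ^ 2 *
        ENNReal.ofReal (-Real.log (‖moebius ζ z‖ ^ 2)) ∂areaMeasure =
      ∫⁻ z, ‖powerSum (derivCoeff 1 b) z‖ₑ ^ 2 *
        ENNReal.ofReal (-Real.log (‖z‖ ^ 2)) ∂areaMeasure := by
    rw [areaMeasure, lintegral_smul_measure, lintegral_smul_measure]
    congr 1
    conv_lhs => rw [← image_moebius hζ]
    rw [lintegral_image_eq_lintegral_enorm_deriv measurableSet_ball (u := moebius ζ)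
      (fun z hz => hasDerivAt_moebius (hmob z ((by simpa using hz : ‖z‖ < 1).trans hS)).1)
      (injOn_moebius hζ)]
    refine setLIntegral_congr_fun measurableSet_ball fun z hz => ?_
    have hz' : ‖z‖ < 1 := by simpa using hz
    rw [moebius_moebius hζ hz', hdH z (hz'.trans hS), enorm_mul, mul_pow]
    ring
  rw [h1, h2, lintegral_enorm_sq_mul_radial ((hbc.derivCoeff 1).mono hS.le)
    (w := fun r => ENNReal.ofReal (-Real.log (r ^ 2))) (by fun_prop), hE,
    ENNReal.ofReal_tsum_of_nonneg (fun _ => by positivity) ((summable_nat_add_iff 1).2 hsq)]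
  refine tsum_congr fun n => ?_
  rw [lintegral_two_mul_pow_log, derivCoeff_one, ← ofReal_norm, ← ENNReal.ofReal_pow (norm_nonneg _),
    ← ENNReal.ofReal_mul (by positivity), norm_mul]
  congr 1
  have : ‖(n + 1 : ℂ)‖ = n + 1 := by
    rw [show (n + 1 : ℂ) = ((n + 1 : ℕ) : ℂ) by push_cast; rfl, Complex.norm_natCast]
    push_cast; rfl
  rw [this]
  field_simp

theorem AbsConv.shift {a : ℕ → ℂ} {R : ℝ} (ha : AbsConv a R) (N : ℕ) :
    AbsConv (fun m => a (m + N)) R := by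
  intro r h0 h1
  obtain ⟨s, hs1, hs2⟩ := exists_between h1
  have hs0 : 0 < s := h0.trans_lt hs1
  have h := ((summable_nat_add_iff N).2 (ha s hs0.le hs2)).mul_right (s ^ N)⁻¹
  refine Summable.of_nonneg_of_le (fun m => by positivity) (fun m => ?_) h
  rw [pow_add, mul_assoc, mul_assoc, mul_inv_cancel₀ (by positivity), mul_one]
  gcongr

theorem powerSum_eq_add_mul {a : ℕ → ℂ} {R : ℝ} (ha : AbsConv a R) {z : ℂ} (hz : ‖z‖ < R) :
    powerSum a z = a 0 + z * powerSum (fun m => a (m + 1)) z := by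
  rw [powerSum, (ha.summable hz).tsum_eq_zero_add, powerSum, ← tsum_mul_left]
  simp only [pow_zero, mul_one]
  congr 1
  refine tsum_congr fun m => ?_
  rw [pow_succ]; ring

theorem quotCoeff_rec {a : ℕ → ℂ} {R : ℝ} (ha : AbsConv a R) {ζ : ℂ} (hζ : ‖ζ‖ < R) (p : ℕ) :
    a (p + 1) = quotCoeff ζ a p - ζ * quotCoeff ζ a (p + 1) := by
  have h := powerSum_eq_add_mul (ha.shift (p + 1)) hζ
  unfold quotCoeff
  rw [h]
  simp only [zero_add]
  rw [show (fun m => a (m + 1 + (p + 1))) = fun m => a (m + (p + 1 + 1)) by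
    funext m; congr 1; ring]
  ring

/-- Stripping the coefficients one at a time: write `f = a₀ + z f₁`. The defect `E` ignores `a₀`,
and `z` has modulus one on the circle but `|ζ|` at `ζ`, so `E(f) = E(f₁) + (1 - |ζ|²) |f₁(ζ)|²`. The
values at `ζ` of the successive shifts are the coefficients of the difference quotient. -/
theorem hasSum_quotCoeff {ζ : ℂ} (hζ : ‖ζ‖ < 1) {a : ℕ → ℂ} {R : ℝ} (hR : 1 < R)
    (ha : AbsConv a R) : HasSum (fun p => (1 - ‖ζ‖ ^ 2) * ‖quotCoeff ζ a p‖ ^ 2)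
      (moebiusAverage ζ a - ‖powerSum a ζ‖ ^ 2) := by
  have hpos := one_sub_sq_pos hζ
  set E : (ℕ → ℂ) → ℝ := fun a => moebiusAverage ζ a - ‖powerSum a ζ‖ ^ 2 with hE
  have hstep : ∀ a : ℕ → ℂ, AbsConv a R → E a = E (fun m => a (m + 1)) +
      (1 - ‖ζ‖ ^ 2) * ‖powerSum (fun m => a (m + 1)) ζ‖ ^ 2 := fun a ha => by
    -- Removing the constant term does not change `E`, because the energy sees only the derivative.
    set a' : ℕ → ℂ := fun m => if m = 0 then 0 else a m with ha'
    have ha'c : AbsConv a' R := fun r h0 h1 => by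
      refine Summable.of_nonneg_of_le (fun m => by positivity) (fun m => ?_) (ha r h0 h1)
      by_cases hm : m = 0
      · simp only [ha', hm, if_true, norm_zero, zero_mul]; positivity
      · simp [ha', hm]
    have hEE : E a = E a' := by
      have h1 := discEnergy_one_eq hζ hR ha
      have h2 := discEnergy_one_eq hζ hR ha'c
      have h3 : discEnergy 1 ζ a = discEnergy 1 ζ a' := by
        have : derivCoeff 1 a = derivCoeff 1 a' := by
          funext m; simp [derivCoeff_one, ha']
        rw [discEnergy, discEnergy, this]
      rw [h3, h2.2] at h1
      exact ((ENNReal.ofReal_eq_ofReal_iff h2.1 h1.1).1 h1.2).symm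
    have hps : ∀ z : ℂ, ‖z‖ < R → powerSum a' z = z * powerSum (fun m => a (m + 1)) z :=
      fun z hz => by
        rw [powerSum_eq_add_mul ha'c hz]
        simp [ha']
    have hM : moebiusAverage ζ a' = moebiusAverage ζ (fun m => a (m + 1)) := by
      refine Real.circleAverage_congr_sphere fun w hw => ?_
      have h1 := norm_moebius_eq_one hζ (show ‖w‖ = 1 by simpa using hw)
      rw [hps _ (by rw [h1]; exact hR), norm_mul, h1, one_mul]
    rw [hEE]
    simp only [hE]
    rw [hM, hps ζ (hζ.trans hR), norm_mul]
    ring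
  have hiter : ∀ N, E a = ∑ p ∈ Finset.range N, (1 - ‖ζ‖ ^ 2) * ‖quotCoeff ζ a p‖ ^ 2 +
      E (fun m => a (m + N)) := fun N => by
    induction N with
    | zero => simp
    | succ N ih =>
      rw [ih, Finset.sum_range_succ, hstep _ (ha.shift N)]
      simp only [quotCoeff]
      rw [show (fun m => a (m + 1 + N)) = fun m => a (m + (N + 1)) by funext m; congr 1; ring]
      ring
  have hE0 : ∀ a : ℕ → ℂ, AbsConv a R → 0 ≤ E a := fun a ha => (discEnergy_one_eq hζ hR ha).1
  -- This bound, applied to the `N`-th shift, is a squared tail of `∑ ‖a m‖`, so the remainder of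
  -- the iteration tends to zero.
  have hEle : ∀ a : ℕ → ℂ, AbsConv a R → E a ≤ (∑' m, ‖a m‖) ^ 2 := fun a ha => by
    have hs := ha.summable_norm hR
    have h1 : moebiusAverage ζ a ≤ (∑' m, ‖a m‖) ^ 2 := by
      refine Real.circleAverage_mono_on_of_le_circle ?_ fun w hw => ?_
      · refine ContinuousOn.circleIntegrable zero_le_one fun w hw => ?_
        have hw' : ‖w‖ = 1 := by simpa using hw
        have h2 : ContinuousAt (powerSum a) (moebius ζ w) :=
          (ha.hasDerivAt (by rw [norm_moebius_eq_one hζ hw']; exact hR)).continuousAt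
        have h3 : ContinuousAt (moebius ζ) w :=
          (hasDerivAt_moebius (one_sub_conj_mul_ne_zero hζ hw'.le)).continuousAt
        exact ((h2.comp h3).norm.pow 2).continuousWithinAt
      · have h1 := norm_moebius_eq_one hζ (show ‖w‖ = 1 by simpa using hw)
        have := norm_powerSum_le hs h1.le
        gcongr
    simp only [hE]
    nlinarith [sq_nonneg ‖powerSum a ζ‖]
  have hlim : Filter.Tendsto (fun N => E (fun m => a (m + N))) Filter.atTop (nhds 0) := by
    have h1 := (tendsto_sum_nat_add (fun m => ‖a m‖)).pow 2
    rw [zero_pow two_ne_zero] at h1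
    exact squeeze_zero (fun N => hE0 _ (ha.shift N)) (fun N => hEle _ (ha.shift N)) h1
  rw [hasSum_iff_tendsto_nat_of_nonneg (fun p => by positivity)]
  have h2 := hlim.const_sub (E a)
  rw [sub_zero] at h2
  refine h2.congr fun N => ?_
  rw [hiter N]
  ring

theorem discEnergy_one {ζ : ℂ} (hζ : ‖ζ‖ < 1) {a : ℕ → ℂ} {R : ℝ} (hR : 1 < R)
    (ha : AbsConv a R) : discEnergy 1 ζ a = ∑' p, ‖quotCoeff ζ a p‖ₑ ^ 2 := by
  have hpos := one_sub_sq_pos hζ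
  have h1 := (discEnergy_one_eq hζ hR ha).2
  have h2 := hasSum_quotCoeff hζ hR ha
  rw [← h2.tsum_eq, ENNReal.ofReal_tsum_of_nonneg (fun _ => by positivity) h2.summable] at h1
  simp_rw [ENNReal.ofReal_mul hpos.le] at h1
  rw [ENNReal.tsum_mul_left] at h1
  have h3 := (ENNReal.mul_right_inj (ENNReal.ofReal_pos.2 hpos).ne' ENNReal.ofReal_ne_top).1 h1
  rw [h3]
  refine tsum_congr fun p => ?_
  rw [ENNReal.ofReal_pow (norm_nonneg _), ofReal_norm]

/-! ### Interior points: induction on the order, for series converging beyond the circle -/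

theorem AbsConv.add {a b : ℕ → ℂ} {R : ℝ} (ha : AbsConv a R) (hb : AbsConv b R) :
    AbsConv (fun m => a m + b m) R := fun r h0 h1 => by
  refine Summable.of_nonneg_of_le (fun m => by positivity) (fun m => ?_)
    ((ha r h0 h1).add (hb r h0 h1))
  rw [← add_mul]
  gcongr
  exact norm_add_le _ _

theorem AbsConv.const_mul {a : ℕ → ℂ} {R : ℝ} (ha : AbsConv a R) (c : ℂ) :
    AbsConv (fun m => c * a m) R := fun r h0 h1 => by
  simpa [mul_assoc] using (ha r h0 h1).mul_left ‖c‖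

theorem AbsConv.of_shift {a : ℕ → ℂ} {R : ℝ} (ha : AbsConv (fun m => a (m + 1)) R) :
    AbsConv a R := fun r h0 h1 => by
  rw [← summable_nat_add_iff 1]
  refine ((ha r h0 h1).mul_right r).congr fun m => ?_
  rw [pow_succ]; ring

theorem AbsConv.tendsto_zero {a : ℕ → ℂ} {R : ℝ} (ha : AbsConv a R) (hR : 1 < R) :
    Filter.Tendsto a Filter.atTop (nhds 0) :=
  tendsto_zero_iff_norm_tendsto_zero.2 (ha.summable_norm hR).tendsto_atTop_zero

theorem powerSum_add {a b : ℕ → ℂ} {R : ℝ} (ha : AbsConv a R) (hb : AbsConv b R) {z : ℂ}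
    (hz : ‖z‖ < R) : powerSum (fun m => a m + b m) z = powerSum a z + powerSum b z := by
  unfold powerSum
  rw [← (ha.summable hz).tsum_add (hb.summable hz)]
  exact tsum_congr fun m => by ring

theorem powerSum_const_mul (c : ℂ) (a : ℕ → ℂ) (z : ℂ) :
    powerSum (fun m => c * a m) z = c * powerSum a z := by
  unfold powerSum
  rw [← tsum_mul_left]
  exact tsum_congr fun m => by ring

/-- For `s` beyond both `r` and `|ζ|`, comparison with the series of `f` at `s` gives `|g_p| ≤ C
s^(-p-1)`. -/
theorem AbsConv.quotCoeff {a : ℕ → ℂ} {R : ℝ} (ha : AbsConv a R) {ζ : ℂ} (hζ : ‖ζ‖ < R) :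
    AbsConv (quotCoeff ζ a) R := by
  intro r h0 h1
  obtain ⟨s, hs1, hs2⟩ := exists_between (max_lt h1 hζ)
  have hrs : r < s := (le_max_left _ _).trans_lt hs1
  have hζs : ‖ζ‖ < s := (le_max_right _ _).trans_lt hs1
  have hs0 : 0 < s := h0.trans_lt hrs
  have hsum := ha s hs0.le hs2
  set C := ∑' m, ‖a m‖ * s ^ m with hC
  have hb : ∀ p, ‖HigherDirichlet.quotCoeff ζ a p‖ ≤ C / s * (s⁻¹) ^ p := fun p => by
    have h2 := (summable_nat_add_iff (p + 1)).2 hsum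
    have h3 : ∑' m, ‖a (m + (p + 1))‖ * s ^ (m + (p + 1)) ≤ C :=
      h2.tsum_le_tsum_of_inj (g := fun m => ‖a m‖ * s ^ m) (fun m => m + (p + 1))
        (add_left_injective _) (fun c _ => by positivity) (fun m => le_rfl) hsum
    have h4 : Summable fun m => ‖a (m + (p + 1)) * ζ ^ m‖ := by
      simpa [norm_mul, norm_pow] using ha.shift (p + 1) ‖ζ‖ (norm_nonneg _) hζ
    have h5 := h2.mul_right (s ^ (p + 1))⁻¹
    calc ‖HigherDirichlet.quotCoeff ζ a p‖ ≤ ∑' m, ‖a (m + (p + 1)) * ζ ^ m‖ :=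
        norm_tsum_le_tsum_norm h4
      _ ≤ ∑' m, ‖a (m + (p + 1))‖ * s ^ (m + (p + 1)) * (s ^ (p + 1))⁻¹ := by
        refine h4.tsum_le_tsum (fun m => ?_) h5
        rw [pow_add, mul_assoc, mul_assoc, mul_inv_cancel₀ (by positivity), mul_one, norm_mul,
          norm_pow]
        gcongr
      _ ≤ C * (s ^ (p + 1))⁻¹ := by
        rw [tsum_mul_right]
        gcongr
      _ = C / s * (s⁻¹) ^ p := by
        rw [pow_succ, inv_pow]
        field_simp
  have hg : Summable fun p : ℕ => C / s * (s⁻¹ * r) ^ p :=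
    (summable_geometric_of_lt_one (by positivity) (by
      rw [inv_mul_lt_iff₀ hs0]; linarith)).mul_left _
  refine Summable.of_nonneg_of_le (fun m => by positivity) (fun p => ?_) hg
  rw [mul_pow, ← mul_assoc]
  exact mul_le_mul_of_nonneg_right (hb p) (by positivity)

/-- `g` solves the recurrence for the coefficients of a difference quotient at `ζ`. -/
def IsQuot (ζ : ℂ) (a g : ℕ → ℂ) : Prop := ∀ p, a (p + 1) = g p - ζ * g (p + 1)

/-- The difference `d` of two solutions satisfies `d_p = ζ d_{p+1}`, so `|d_p|` is nondecreasing; as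
it tends to zero it vanishes. -/
theorem IsQuot.unique {ζ : ℂ} (hζ : ‖ζ‖ ≤ 1) {a g h : ℕ → ℂ} (hg : IsQuot ζ a g)
    (hh : IsQuot ζ a h) (hg0 : Filter.Tendsto g Filter.atTop (nhds 0))
    (hh0 : Filter.Tendsto h Filter.atTop (nhds 0)) : g = h := by
  have h1 : ∀ p, g p - h p = ζ * (g (p + 1) - h (p + 1)) := fun p => by
    linear_combination hh p - hg p
  have h2 : Monotone fun p => ‖g p - h p‖ := monotone_nat_of_le_succ fun p => by
    rw [h1, norm_mul]
    exact mul_le_of_le_one_left (norm_nonneg _) hζ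
  have h3 : Filter.Tendsto (fun p => ‖g p - h p‖) Filter.atTop (nhds 0) := by
    simpa using (hg0.sub hh0).norm
  funext p
  have h4 := h2.ge_of_tendsto h3 p
  exact sub_eq_zero.1 (norm_le_zero_iff.1 h4)

/-- The coefficients of `(z - ζ) f' - k f`. -/
def eulerCoeff (k : ℕ) (ζ : ℂ) (a : ℕ → ℂ) (m : ℕ) : ℂ :=
  (m - k) * a m - ζ * ((m + 1) * a (m + 1))

theorem AbsConv.eulerCoeff {a : ℕ → ℂ} {R : ℝ} (ha : AbsConv a R) (k : ℕ) (ζ : ℂ) :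
    AbsConv (eulerCoeff k ζ a) R := by
  have h1 : AbsConv (fun m => (m : ℂ) * a m) R := by
    refine AbsConv.of_shift ?_
    have := ha.derivCoeff_one
    intro r h0 h1
    refine (this r h0 h1).congr fun m => ?_
    rw [HigherDirichlet.derivCoeff_one]
    push_cast
    rfl
  have h2 := (h1.add (ha.const_mul (-k))).add (ha.derivCoeff_one.const_mul (-ζ))
  have e : HigherDirichlet.eulerCoeff k ζ a =
      fun m => m * a m + -k * a m + -ζ * HigherDirichlet.derivCoeff 1 a m := by
    funext m
    rw [HigherDirichlet.derivCoeff_one, HigherDirichlet.eulerCoeff]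
    ring
  rw [e]
  exact h2

theorem derivCoeff_eulerCoeff_zero (k : ℕ) (ζ : ℂ) (a : ℕ → ℂ) :
    derivCoeff k (eulerCoeff k ζ a) 0 = -ζ * derivCoeff (k + 1) a 0 := by
  unfold derivCoeff eulerCoeff
  simp [Nat.factorial_succ]
  ring

theorem derivCoeff_eulerCoeff_succ (k : ℕ) (ζ : ℂ) (a : ℕ → ℂ) (m : ℕ) :
    derivCoeff k (eulerCoeff k ζ a) (m + 1) =
      derivCoeff (k + 1) a m - ζ * derivCoeff (k + 1) a (m + 1) := by
  have h1 : (m ! : ℂ) ≠ 0 := by exact_mod_cast m.factorial_ne_zero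
  have h2 : (m + 1 : ℂ) ≠ 0 := by exact_mod_cast m.succ_ne_zero
  unfold derivCoeff eulerCoeff
  rw [show m + 1 + k + 1 = m + k + 1 + 1 by ring, show m + 1 + (k + 1) = m + k + 1 + 1 by ring,
    show m + 1 + k = m + k + 1 by ring, show m + (k + 1) = m + k + 1 by ring,
    Nat.factorial_succ m, Nat.factorial_succ (m + k + 1)]
  push_cast
  field_simp
  ring

/-- Leibniz's rule: differentiating `(z - ζ) f'` `k` times leaves an extra `k f^(k)`, which the term
`-k f` cancels. The factor `z - ζ` matches the one in `greenKernel_succ`. -/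
theorem powerSum_eulerCoeff {a : ℕ → ℂ} {R : ℝ} (ha : AbsConv a R) (k : ℕ) (ζ : ℂ) {z : ℂ}
    (hz : ‖z‖ < R) : powerSum (derivCoeff k (eulerCoeff k ζ a)) z =
      (z - ζ) * powerSum (derivCoeff (k + 1) a) z := by
  have hc := ha.derivCoeff (k + 1)
  have hs := hc.shift 1
  rw [powerSum_eq_add_mul ((ha.eulerCoeff k ζ).derivCoeff k) hz, derivCoeff_eulerCoeff_zero]
  simp_rw [derivCoeff_eulerCoeff_succ, sub_eq_add_neg, ← neg_mul]
  rw [powerSum_add hc (hs.const_mul (-ζ)) hz, powerSum_const_mul]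
  have := powerSum_eq_add_mul hc hz
  linear_combination ζ * this

theorem quotCoeff_isQuot {a : ℕ → ℂ} {R : ℝ} (ha : AbsConv a R) {ζ : ℂ} (hζ : ‖ζ‖ < R) :
    IsQuot ζ a (quotCoeff ζ a) := quotCoeff_rec ha hζ

/-- With `f = f(ζ) + (z - ζ) g`, the difference quotient of `(z - ζ) f' - k f` is `(1 - k) g + (z -
ζ) g'`. The proof checks the quotient recurrence and uses uniqueness. -/
theorem quotCoeff_eulerCoeff {a : ℕ → ℂ} {R : ℝ} (hR : 1 < R) (ha : AbsConv a R) {ζ : ℂ}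
    (hζ : ‖ζ‖ ≤ 1) (k p : ℕ) : quotCoeff ζ (eulerCoeff k ζ a) p =
      (p + 1 - k) * quotCoeff ζ a p - ζ * ((p + 1) * quotCoeff ζ a (p + 1)) := by
  have hζR := hζ.trans_lt hR
  have hF := ha.eulerCoeff k ζ
  have hg := ha.quotCoeff hζR
  have hrec := quotCoeff_isQuot ha hζR
  have h1 : AbsConv (fun p : ℕ => (p + 1 - k : ℂ) * quotCoeff ζ a p -
      ζ * ((p + 1) * quotCoeff ζ a (p + 1))) R := by
    have := (hg.eulerCoeff k ζ).add hg
    intro r h0 h1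
    refine (this r h0 h1).congr fun m => ?_
    simp only [eulerCoeff]
    congr 2
    ring
  refine congrFun (IsQuot.unique hζ (quotCoeff_isQuot hF hζR) (fun p => ?_)
    ((hF.quotCoeff hζR).tendsto_zero hR) (h1.tendsto_zero hR)) p
  rw [HigherDirichlet.eulerCoeff, hrec p, hrec (p + 1)]
  push_cast
  ring

theorem summable_choose_mul_sq {g : ℕ → ℂ} {R : ℝ} (hR : 1 < R) (hg : AbsConv g R) (j : ℕ) :
    Summable fun p : ℕ => (p.choose j : ℝ) * ‖g p‖ ^ 2 := by
  have h1 := (hg.derivCoeff j).summable_norm hR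
  have h2 := hg.summable_norm hR
  rw [← summable_nat_add_iff j]
  refine Summable.of_nonneg_of_le (fun m => by positivity) (fun m => ?_)
    (h1.mul_left (∑' m, ‖g m‖))
  have h3 : ‖g (m + j)‖ ≤ ∑' m, ‖g m‖ := h2.le_tsum (m + j) fun _ _ => norm_nonneg _
  have h4 : ((m + j).choose j : ℝ) * ‖g (m + j)‖ ≤ ‖derivCoeff j g m‖ := by
    rw [derivCoeff, norm_mul, norm_div, Complex.norm_natCast, Complex.norm_natCast]
    refine mul_le_mul_of_nonneg_right ?_ (norm_nonneg _)
    rw [le_div_iff₀ (by positivity)]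
    have := Nat.choose_mul_factorial_mul_factorial (Nat.le_add_left j m)
    rw [Nat.add_sub_cancel] at this
    have h5 : (m + j).choose j * m ! ≤ (m + j)! := by
      rw [← this]
      exact Nat.mul_le_mul_right _ (Nat.le_mul_of_pos_right _ j.factorial_pos)
    exact_mod_cast h5
  calc ((m + j).choose j : ℝ) * ‖g (m + j)‖ ^ 2
      = ‖g (m + j)‖ * (((m + j).choose j : ℝ) * ‖g (m + j)‖) := by ring
    _ ≤ _ := by gcongr

theorem sq_norm_sub_identity (x y : ℂ) (q P : ℝ) :
    P * q * ‖x - y‖ ^ 2 - ‖(q : ℂ) * x - P * y‖ ^ 2 =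
      (P - q) * (q * ‖x‖ ^ 2 - P * ‖y‖ ^ 2) := by
  simp only [← Complex.normSq_eq_norm_sq, Complex.normSq_apply]
  simp
  ring

/-- For `x = g_p` and `y = g_{p+1}` the first norm is `|a_{p+1}|` and the second is the `p`-th
quotient coefficient of `(z - ζ) f' - k f`. The right side then telescopes up to the factor `|ζ|²`.
-/
theorem discEnergy_step_identity {k : ℕ} (hk : 1 ≤ k) (p : ℕ) (x y ζ : ℂ) :
    (k * (p + 1) * p.choose k : ℝ) * ‖x - ζ * y‖ ^ 2 -
      (p.choose (k - 1) : ℝ) * ‖(p + 1 - k) * x - ζ * ((p + 1) * y)‖ ^ 2 =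
      (k : ℝ) ^ 2 * ((p.choose k : ℝ) * ‖x‖ ^ 2 -
        ‖ζ‖ ^ 2 * (((p + 1).choose k : ℝ) * ‖y‖ ^ 2)) := by
  obtain ⟨j, rfl⟩ := Nat.exists_eq_add_of_le' hk
  have h1 : ((j + 1 : ℕ) : ℝ) * p.choose (j + 1) = (p + 1 - (j + 1 : ℕ)) * p.choose j := by
    rcases lt_or_ge p j with h | h
    · simp [Nat.choose_eq_zero_of_lt h, Nat.choose_eq_zero_of_lt (h.trans (Nat.lt_succ_self j))]
    · have := Nat.choose_succ_right_eq p j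
      have h2 : (p.choose (j + 1) * (j + 1) : ℝ) = p.choose j * ((p - j : ℕ) : ℝ) := by
        exact_mod_cast this
      rw [Nat.cast_sub h] at h2
      push_cast
      linarith
  have h2 : ((j + 1 : ℕ) : ℝ) * (p + 1).choose (j + 1) = (p + 1) * p.choose j := by
    have := Nat.add_one_mul_choose_eq p j
    have h2 : ((p + 1) * p.choose j : ℝ) = (p + 1).choose (j + 1) * (j + 1) := by
      exact_mod_cast this
    push_cast
    linarith
  have h3 := sq_norm_sub_identity x (ζ * y) (p + 1 - (j + 1 : ℕ)) (p + 1)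
  have e : (((p + 1 - (j + 1 : ℕ) : ℝ) : ℂ)) * x - ((p + 1 : ℝ) : ℂ) * (ζ * y) =
      (p + 1 - (j + 1 : ℕ)) * x - ζ * ((p + 1) * y) := by push_cast; ring
  rw [e, norm_mul ζ y, mul_pow] at h3
  simp only [Nat.add_sub_cancel]
  linear_combination (p.choose j : ℝ) * h3 + ((p + 1) * ‖x - ζ * y‖ ^ 2 - ((j + 1 : ℕ) : ℝ) *
    ‖x‖ ^ 2) * h1 + ((j + 1 : ℕ) : ℝ) * ‖ζ‖ ^ 2 * ‖y‖ ^ 2 * h2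

theorem measurable_greenKernel (k : ℕ) (ζ : ℂ) : Measurable fun z => greenKernel k z ζ := by
  unfold greenKernel greenAlmansi
  fun_prop

theorem aemeasurable_powerSum {a : ℕ → ℂ} (ha : AbsConv a 1) :
    AEMeasurable (powerSum a) areaMeasure := by
  have h1 : AEMeasurable (powerSum a) (volume.restrict (ball (0 : ℂ) 1)) :=
    ha.differentiableOn.continuousOn.aemeasurable measurableSet_ball
  exact h1.mono_ac Measure.smul_absolutelyContinuous

/-- By `greenKernel_succ` and `powerSum_eulerCoeff` the two integrands add up to `|f^(k+1)|² (1 -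
|z|²)^k / k`, a radial weight that Parseval evaluates. -/
theorem discEnergy_succ_add {k : ℕ} (hk : 1 ≤ k) {ζ : ℂ} (hζ : ‖ζ‖ < 1) {a : ℕ → ℂ}
    (ha : AbsConv a 1) :
    ENNReal.ofReal (1 - ‖ζ‖ ^ 2) * discEnergy (k + 1) ζ a + discEnergy k ζ (eulerCoeff k ζ a) =
      ∑' n, ‖derivCoeff (k + 1) a n‖ₑ ^ 2 *
        ENNReal.ofReal ((n ! : ℝ) * (k ! : ℝ) / ((n + k + 1)! : ℝ) / k) := by
  have hpos := one_sub_sq_pos hζ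
  have h1 : ∀ᵐ z ∂areaMeasure, ENNReal.ofReal (1 - ‖ζ‖ ^ 2) *
      (‖powerSum (derivCoeff (k + 1) a) z‖ₑ ^ 2 * ENNReal.ofReal (greenKernel (k + 1) z ζ)) +
      ‖powerSum (derivCoeff k (eulerCoeff k ζ a)) z‖ₑ ^ 2 * ENNReal.ofReal (greenKernel k z ζ) =
      ‖powerSum (derivCoeff (k + 1) a) z‖ₑ ^ 2 *
        (ENNReal.ofReal (1 / k) * ENNReal.ofReal ((1 - ‖z‖ ^ 2) ^ k)) := by
    refine ae_areaMeasure_of_forall ζ fun z hz hne => ?_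
    have h2 := greenKernel_nonneg hk hz hζ hne
    have h3 := greenKernel_nonneg (k.le_succ.trans' hk) hz hζ hne
    rw [powerSum_eulerCoeff ha k ζ hz, enorm_mul, mul_pow, mul_left_comm, mul_comm (‖z - ζ‖ₑ ^ 2),
      mul_assoc, ← mul_add]
    congr 1
    rw [← ofReal_norm (z - ζ), ← ENNReal.ofReal_pow (norm_nonneg _), ← ENNReal.ofReal_mul hpos.le,
      ← ENNReal.ofReal_mul (by positivity), ← ENNReal.ofReal_add (by positivity) (by positivity),
      ← ENNReal.ofReal_mul (by positivity), norm_sub_rev, greenKernel_succ hk z hζ]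
    congr 1
    ring
  have hm : AEMeasurable (fun z => ‖powerSum (derivCoeff k (eulerCoeff k ζ a)) z‖ₑ ^ 2 *
      ENNReal.ofReal (greenKernel k z ζ)) areaMeasure :=
    ((aemeasurable_powerSum ((ha.eulerCoeff k ζ).derivCoeff k)).enorm.pow_const 2).mul
      (measurable_greenKernel k ζ).ennreal_ofReal.aemeasurable
  rw [discEnergy, discEnergy, ← lintegral_const_mul' _ _ ENNReal.ofReal_ne_top,
    ← lintegral_add_right' _ hm, lintegral_congr_ae h1,
    lintegral_enorm_sq_mul_radial (ha.derivCoeff (k + 1))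
      (w := fun r => ENNReal.ofReal (1 / k) * ENNReal.ofReal ((1 - r ^ 2) ^ k)) (by fun_prop)]
  refine tsum_congr fun n => ?_
  congr 1
  simp_rw [mul_left_comm _ (ENNReal.ofReal (1 / k))]
  rw [lintegral_const_mul' _ _ ENNReal.ofReal_ne_top, lintegral_two_mul_pow,
    ← ENNReal.ofReal_mul (by positivity)]
  congr 1
  ring

/-- In the step, `discEnergy_succ_add` gives the sum of the new energy and an energy of order `k`
known by induction. Its right side is matched termwise with the quotient sums by
`discEnergy_step_identity`. Convergence beyond the circle makes all series finite, so the known one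
can be subtracted. -/
theorem discEnergy_eq_of_lt {k : ℕ} (hk : 1 ≤ k) {ζ : ℂ} (hζ : ‖ζ‖ < 1) {a : ℕ → ℂ} {R : ℝ}
    (hR : 1 < R) (ha : AbsConv a R) : discEnergy k ζ a =
      ENNReal.ofReal (((k - 1)! : ℝ) ^ 2 *
        ∑' p : ℕ, (p.choose (k - 1) : ℝ) * ‖quotCoeff ζ a p‖ ^ 2) := by
  have hζR : ‖ζ‖ < R := hζ.trans hR
  have hpos := one_sub_sq_pos hζ
  induction k, hk using Nat.le_induction generalizing a with
  | base =>
    have h := summable_choose_mul_sq hR (ha.quotCoeff hζR) 0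
    simp only [Nat.choose_zero_right, Nat.cast_one, one_mul] at h
    rw [discEnergy_one hζ hR ha]
    simp only [Nat.sub_self, Nat.choose_zero_right, Nat.cast_one, one_mul, Nat.factorial_zero,
      one_pow]
    rw [ENNReal.ofReal_tsum_of_nonneg (fun _ => by positivity) h]
    refine tsum_congr fun p => ?_
    rw [ENNReal.ofReal_pow (norm_nonneg _), ofReal_norm]
  | succ k hk ih =>
    have hF := ha.eulerCoeff k ζ
    have h1 := discEnergy_succ_add hk hζ (ha.mono hR.le)
    have hg := ha.quotCoeff hζR
    set g := quotCoeff ζ a with hgdef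
    have hkf : (k ! : ℝ) = k * (k - 1)! := by
      obtain ⟨j, rfl⟩ := Nat.exists_eq_add_of_le' hk
      rw [Nat.factorial_succ]; push_cast; rfl
    have hk0 : (k : ℝ) ≠ 0 := by positivity
    -- the three real series
    set t : ℕ → ℝ := fun p => (p.choose k : ℝ) * ‖g p‖ ^ 2 with ht
    set β : ℕ → ℝ := fun p => (p.choose (k - 1) : ℝ) * ‖quotCoeff ζ (eulerCoeff k ζ a) p‖ ^ 2 with hβ
    have hts : Summable t := summable_choose_mul_sq hR hg k
    have hβs : Summable β := summable_choose_mul_sq hR (hF.quotCoeff hζR) (k - 1)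
    set A : ℕ → ℝ := fun p => (k * (p + 1) * p.choose k : ℝ) * ‖a (p + 1)‖ ^ 2 with hA
    have hAe : ∀ p, A p = β p + (k : ℝ) ^ 2 * (t p - ‖ζ‖ ^ 2 * t (p + 1)) := fun p => by
      have := discEnergy_step_identity hk p (g p) (g (p + 1)) ζ
      rw [← quotCoeff_rec ha hζR p, ← quotCoeff_eulerCoeff hR ha hζ.le k p] at this
      simp only [hA, hβ, ht]
      linarith
    have hts1 := (summable_nat_add_iff 1).2 hts
    have hAs : HasSum A (∑' p, β p + (k : ℝ) ^ 2 * (∑' p, t p - ‖ζ‖ ^ 2 * ∑' p, t (p + 1))) := by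
      rw [funext hAe]
      exact hβs.hasSum.add ((hts.hasSum.sub (hts1.hasSum.mul_left _)).mul_left _)
    -- Since `k ≥ 1`, the term `t 0` vanishes, so the telescoping sum is `(1 - |ζ|²) ∑ t`.
    have ht1 : ∑' p, t (p + 1) = ∑' p, t p := by
      rw [hts.tsum_eq_zero_add]
      have : t 0 = 0 := by
        simp [ht, Nat.choose_eq_zero_of_lt (show 0 < k from hk)]
      rw [this, zero_add]
    have hAt : ∑' n, A (n + k) = ∑' p, A p := by
      rw [← hAs.summable.sum_add_tsum_nat_add k, Finset.sum_eq_zero (fun p hp => by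
        simp [hA, Nat.choose_eq_zero_of_lt (Finset.mem_range.1 hp)]), zero_add]
    have hR1 : ∑' n, ‖derivCoeff (k + 1) a n‖ₑ ^ 2 *
        ENNReal.ofReal ((n ! : ℝ) * (k ! : ℝ) / ((n + k + 1)! : ℝ) / k) =
        ENNReal.ofReal (((k - 1)! : ℝ) ^ 2 * ∑' p, A p) := by
      rw [← hAt, ← tsum_mul_left, ENNReal.ofReal_tsum_of_nonneg (fun _ => by positivity)
        (((summable_nat_add_iff k).2 hAs.summable).mul_left _)]
      refine tsum_congr fun n => ?_
      rw [← ofReal_norm, ← ENNReal.ofReal_pow (norm_nonneg _), ← ENNReal.ofReal_mul (by positivity)]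
      congr 1
      have h2 := Nat.choose_mul_factorial_mul_factorial (Nat.le_add_left k n)
      rw [Nat.add_sub_cancel] at h2
      have h3 : ((n + k).choose k : ℝ) = ((n + k)! : ℝ) / (k ! * n !) := by
        rw [eq_div_iff (by positivity), ← h2]
        push_cast
        ring
      simp only [hA]
      rw [derivCoeff, norm_mul, norm_div, Complex.norm_natCast, Complex.norm_natCast, h3, hkf,
        ← add_assoc, Nat.factorial_succ (n + k)]
      push_cast
      field_simp
    rw [ih hF, hR1] at h1
    have hβ0 : 0 ≤ ((k - 1)! : ℝ) ^ 2 * ∑' p, β p :=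
      mul_nonneg (by positivity) (tsum_nonneg fun _ => by positivity)
    have ht0 : 0 ≤ ((k)! : ℝ) ^ 2 * ∑' p, t p :=
      mul_nonneg (by positivity) (tsum_nonneg fun _ => by positivity)
    have hfin : ((k - 1)! : ℝ) ^ 2 * ∑' p, A p =
        (1 - ‖ζ‖ ^ 2) * ((k ! : ℝ) ^ 2 * ∑' p, t p) + ((k - 1)! : ℝ) ^ 2 * ∑' p, β p := by
      rw [hAs.tsum_eq, ht1, hkf]
      ring
    rw [hfin, ENNReal.ofReal_add (by positivity) hβ0, ENNReal.add_left_inj ENNReal.ofReal_ne_top,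
      ENNReal.ofReal_mul hpos.le,
      ENNReal.mul_right_inj (ENNReal.ofReal_pos.2 hpos).ne' ENNReal.ofReal_ne_top] at h1
    exact h1

/-! ### Interior points: arbitrary holomorphic functions by dilation -/

/-- The weighted sum `∑ (p choose k - 1) |g_p|²`, possibly infinite. -/
def quotEnergy (k : ℕ) (g : ℕ → ℂ) : ℝ≥0∞ := ∑' p : ℕ, (p.choose (k - 1) : ℝ≥0∞) * ‖g p‖ₑ ^ 2

theorem natCast_mul_enorm_sq (n : ℕ) (x : ℂ) :
    (n : ℝ≥0∞) * ‖x‖ₑ ^ 2 = ENNReal.ofReal ((n : ℝ) * ‖x‖ ^ 2) := by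
  rw [ENNReal.ofReal_mul (by positivity), ENNReal.ofReal_natCast,
    ENNReal.ofReal_pow (norm_nonneg _), ofReal_norm]

theorem quotEnergy_eq_ofReal {k : ℕ} {g : ℕ → ℂ}
    (hg : Summable fun p : ℕ => (p.choose (k - 1) : ℝ) * ‖g p‖ ^ 2) :
    quotEnergy k g = ENNReal.ofReal (∑' p : ℕ, (p.choose (k - 1) : ℝ) * ‖g p‖ ^ 2) := by
  rw [ENNReal.ofReal_tsum_of_nonneg (fun _ => by positivity) hg]
  exact tsum_congr fun p => natCast_mul_enorm_sq _ _

theorem summable_of_quotEnergy_ne_top {k : ℕ} {g : ℕ → ℂ} (h : quotEnergy k g ≠ ∞) :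
    Summable fun p : ℕ => (p.choose (k - 1) : ℝ) * ‖g p‖ ^ 2 := by
  have h1 := ENNReal.summable_toReal h
  refine h1.congr fun p => ?_
  rw [natCast_mul_enorm_sq, ENNReal.toReal_ofReal (by positivity)]

/-- The coefficients of `f(R z)`. -/
def dilate (R : ℝ) (a : ℕ → ℂ) (m : ℕ) : ℂ := a m * (R : ℂ) ^ m

theorem absConv_dilate {a : ℕ → ℂ} {R : ℝ} (hR : 0 < R) (ha : AbsConv a 1) :
    AbsConv (dilate R a) (1 / R) := fun r h0 h1 => by
  have h2 := ha (R * r) (by positivity) (by rw [lt_div_iff₀ hR] at h1; linarith)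
  refine h2.congr fun m => ?_
  rw [dilate, norm_mul, norm_pow, Complex.norm_real, Real.norm_of_nonneg hR.le, mul_pow]
  ring

theorem quotCoeff_dilate {R : ℝ} (hR : R ≠ 0) (a : ℕ → ℂ) (ζ : ℂ) (p : ℕ) :
    quotCoeff (ζ / R) (dilate R a) p = (R : ℂ) ^ (p + 1) * quotCoeff ζ a p := by
  have hRc : (R : ℂ) ≠ 0 := by exact_mod_cast hR
  unfold quotCoeff powerSum
  rw [← tsum_mul_left]
  refine tsum_congr fun m => ?_
  simp only [dilate]
  rw [div_pow, pow_add]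
  field_simp

theorem powerSum_dilate (k : ℕ) (R : ℝ) (a : ℕ → ℂ) (z : ℂ) :
    powerSum (derivCoeff k (dilate R a)) z = (R : ℂ) ^ k * powerSum (derivCoeff k a) (R * z) := by
  unfold powerSum
  rw [← tsum_mul_left]
  refine tsum_congr fun m => ?_
  rw [derivCoeff, derivCoeff, dilate, mul_pow, pow_add]
  ring

theorem discEnergy_dilate_eq {k : ℕ} (hk : 1 ≤ k) {ζ : ℂ} {a : ℕ → ℂ} (ha : AbsConv a 1) {R : ℝ}
    (hR : R < 1) (hζ : ‖ζ‖ < R) : discEnergy k (ζ / R) (dilate R a) =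
      ENNReal.ofReal (((k - 1)! : ℝ) ^ 2) *
        quotEnergy k (fun p => (R : ℂ) ^ (p + 1) * quotCoeff ζ a p) := by
  have hR0 : 0 < R := (norm_nonneg ζ).trans_lt hζ
  have hR1 : 1 < 1 / R := by rw [lt_div_iff₀ hR0]; linarith
  have hζR : ‖ζ / R‖ < 1 := by
    rw [norm_div, Complex.norm_real, Real.norm_of_nonneg hR0.le, div_lt_one hR0]; exact hζ
  have hc := absConv_dilate hR0 ha
  have h1 := summable_choose_mul_sq hR1 (hc.quotCoeff (hζR.trans hR1)) (k - 1)
  rw [discEnergy_eq_of_lt hk hζR hR1 hc, ENNReal.ofReal_mul (by positivity),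
    ← quotEnergy_eq_ofReal h1, funext (quotCoeff_dilate hR0.ne' a ζ)]

/-- Of the factor `R^(2k)` from the `k`-th derivative, `R²` is the Jacobian of `z ↦ R z`, and the
remaining `R^(2k-2)` is the one in `greenKernel_scale_le`. -/
theorem discEnergy_dilate_le {k : ℕ} (hk : 1 ≤ k) {ζ : ℂ} (a : ℕ → ℂ) {R : ℝ}
    (hR : R < 1) (hζ : ‖ζ‖ < R) : discEnergy k (ζ / R) (dilate R a) ≤
      ENNReal.ofReal ((1 - ‖ζ‖ ^ 2) / (1 - ‖ζ‖ ^ 2 / R ^ 2)) * discEnergy k ζ a := by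
  have hR0 : 0 < R := (norm_nonneg ζ).trans_lt hζ
  have hRc : (R : ℂ) ≠ 0 := by exact_mod_cast hR0.ne'
  set lam := (1 - ‖ζ‖ ^ 2) / (1 - ‖ζ‖ ^ 2 / R ^ 2) with hlam
  have hζ1 : ‖ζ‖ < 1 := hζ.trans hR
  have hlam0 : 0 ≤ lam := by
    refine div_nonneg (one_sub_sq_pos hζ1).le (sub_nonneg.2 ?_)
    rw [div_le_one (by positivity)]
    gcongr
  have h1 : discEnergy k (ζ / R) (dilate R a) ≤ ENNReal.ofReal lam *
      ∫⁻ z, ‖(R : ℂ)‖ₑ ^ 2 * (‖powerSum (derivCoeff k a) (R * z)‖ₑ ^ 2 *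
        ENNReal.ofReal (greenKernel k (R * z) ζ)) ∂areaMeasure := by
    rw [discEnergy, ← lintegral_const_mul' _ _ ENNReal.ofReal_ne_top]
    refine lintegral_mono_ae (ae_areaMeasure_of_forall (ζ / R) fun z hz hne => ?_)
    have h2 := greenKernel_scale_le hk hR hζ hz hne
    rw [powerSum_dilate, enorm_mul, mul_pow]
    have h3 : ‖(R : ℂ) ^ k‖ₑ ^ 2 * ENNReal.ofReal (greenKernel k z (ζ / R)) ≤
        ENNReal.ofReal lam * (‖(R : ℂ)‖ₑ ^ 2 * ENNReal.ofReal (greenKernel k (R * z) ζ)) := by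
      rw [← ofReal_norm, ← ofReal_norm, norm_pow, Complex.norm_real, Real.norm_of_nonneg hR0.le,
        ← ENNReal.ofReal_pow (by positivity), ← ENNReal.ofReal_pow (by positivity),
        ← ENNReal.ofReal_mul (by positivity), ← ENNReal.ofReal_mul (by positivity),
        ← ENNReal.ofReal_mul hlam0]
      refine ENNReal.ofReal_le_ofReal ?_
      obtain ⟨j, rfl⟩ := Nat.exists_eq_add_of_le' hk
      rw [show 2 * (j + 1) - 2 = 2 * j by omega] at h2
      calc (R ^ (j + 1)) ^ 2 * greenKernel (j + 1) z (ζ / R)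
          = R ^ 2 * (R ^ (2 * j) * greenKernel (j + 1) z (ζ / R)) := by ring
        _ ≤ R ^ 2 * (lam * greenKernel (j + 1) (R * z) ζ) := by gcongr
        _ = _ := by ring
    calc ‖(R : ℂ) ^ k‖ₑ ^ 2 * ‖powerSum (derivCoeff k a) (R * z)‖ₑ ^ 2 *
          ENNReal.ofReal (greenKernel k z (ζ / R))
        = ‖powerSum (derivCoeff k a) (R * z)‖ₑ ^ 2 * (‖(R : ℂ) ^ k‖ₑ ^ 2 *
          ENNReal.ofReal (greenKernel k z (ζ / R))) := by ring
      _ ≤ ‖powerSum (derivCoeff k a) (R * z)‖ₑ ^ 2 * (ENNReal.ofReal lam * (‖(R : ℂ)‖ₑ ^ 2 *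
          ENNReal.ofReal (greenKernel k (R * z) ζ))) := by gcongr
      _ = _ := by ring
  refine h1.trans (mul_le_mul' le_rfl ?_)
  rw [discEnergy, areaMeasure, lintegral_smul_measure, lintegral_smul_measure]
  refine mul_le_mul' le_rfl ?_
  have h2 := lintegral_image_eq_lintegral_enorm_deriv (s := ball (0 : ℂ) 1) measurableSet_ball
    (u := fun z => (R : ℂ) * z) (u' := fun _ => R)
    (fun z _ => by simpa using (hasDerivAt_id z).const_mul (R : ℂ))
    (fun x _ y _ h => mul_left_cancel₀ hRc h)
    (fun z => ‖powerSum (derivCoeff k a) z‖ₑ ^ 2 * ENNReal.ofReal (greenKernel k z ζ))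
  rw [← h2]
  refine lintegral_mono_set ?_
  rintro _ ⟨z, hz, rfl⟩
  have hz' : ‖z‖ < 1 := by simpa using hz
  rw [mem_ball_zero_iff, norm_mul, Complex.norm_real, Real.norm_of_nonneg hR0.le]
  nlinarith [norm_nonneg z]

/-- The formula is known for the dilates `f(R z)` at `ζ/R`; then `R → 1`. Fatou's lemma bounds the
energy by the quotient sum, because dilation only shrinks the quotient coefficients. The reverse
bound uses `discEnergy_dilate_le`, whose constant tends to one, on finite partial sums. -/
theorem discEnergy_eq {k : ℕ} (hk : 1 ≤ k) {ζ : ℂ} (hζ : ‖ζ‖ < 1) {a : ℕ → ℂ}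
    (ha : AbsConv a 1) : discEnergy k ζ a =
      ENNReal.ofReal (((k - 1)! : ℝ) ^ 2) * quotEnergy k (quotCoeff ζ a) := by
  -- radii increasing to one
  obtain ⟨R, -, hR, hRlim⟩ := exists_seq_strictMono_tendsto' hζ
  have hζR : ∀ n, ‖ζ‖ < R n := fun n => (hR n).1
  have hR1 : ∀ n, R n < 1 := fun n => (hR n).2
  have hR0 : ∀ n, 0 < R n := fun n => (norm_nonneg ζ).trans_lt (hζR n)
  have hpos := one_sub_sq_pos hζ
  have hRc : Filter.Tendsto (fun n => (R n : ℂ)) Filter.atTop (nhds 1) := by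
    have := (Complex.continuous_ofReal.tendsto 1).comp hRlim
    simpa [Function.comp_def] using this
  set V : ℕ → ℝ≥0∞ := fun n => discEnergy k (ζ / R n) (dilate (R n) a) with hV
  have hVe : ∀ n, V n = ENNReal.ofReal (((k - 1)! : ℝ) ^ 2) *
      quotEnergy k (fun p => (R n : ℂ) ^ (p + 1) * quotCoeff ζ a p) := fun n =>
    discEnergy_dilate_eq hk ha (hR1 n) (hζR n)
  have hf : ENNReal.ofReal (((k - 1)! : ℝ) ^ 2) ≠ 0 := (ENNReal.ofReal_pos.2 (by positivity)).ne'
  refine le_antisymm ?_ ?_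
  · have h1 : ∀ᵐ z ∂areaMeasure, ‖powerSum (derivCoeff k a) z‖ₑ ^ 2 *
        ENNReal.ofReal (greenKernel k z ζ) =
        Filter.liminf (fun n => ‖powerSum (derivCoeff k (dilate (R n) a)) z‖ₑ ^ 2 *
          ENNReal.ofReal (greenKernel k z (ζ / R n))) Filter.atTop := by
      refine ae_areaMeasure_of_forall ζ fun z hz hne => ?_
      symm
      refine Filter.Tendsto.liminf_eq ?_
      have h2 : Filter.Tendsto (fun n => ‖powerSum (derivCoeff k (dilate (R n) a)) z‖ₑ ^ 2)
          Filter.atTop (nhds (‖powerSum (derivCoeff k a) z‖ₑ ^ 2)) := by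
        simp_rw [powerSum_dilate]
        refine ((ENNReal.continuous_pow 2).comp continuous_enorm).continuousAt.tendsto.comp
          (x := Filter.atTop) ?_
        have h3 : ContinuousAt (powerSum (derivCoeff k a)) z :=
          ((ha.derivCoeff k).hasDerivAt hz).continuousAt
        have h4 : Filter.Tendsto (fun n => (R n : ℂ) * z) Filter.atTop (nhds z) := by
          simpa using hRc.mul_const z
        simpa using (hRc.pow k).mul (h3.tendsto.comp h4)
      have h5 : Filter.Tendsto (fun n => greenKernel k z (ζ / R n)) Filter.atTop
          (nhds (greenKernel k z ζ)) := by
        refine (continuousAt_greenKernel k hz hζ hne).tendsto.comp ?_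
        simpa [div_eq_mul_inv] using (hRc.inv₀ one_ne_zero).const_mul ζ
      refine ENNReal.Tendsto.mul h2 (Or.inr ENNReal.ofReal_ne_top) (ENNReal.tendsto_ofReal h5)
        (Or.inr (by simp))
    have h6 : discEnergy k ζ a ≤ Filter.liminf V Filter.atTop := by
      rw [discEnergy, lintegral_congr_ae h1]
      refine lintegral_liminf_le' fun n => ?_
      have hc : AbsConv (dilate (R n) a) 1 := (absConv_dilate (hR0 n) ha).mono (by
        rw [le_div_iff₀ (hR0 n)]; linarith [hR1 n])
      exact ((aemeasurable_powerSum (hc.derivCoeff k)).enorm.pow_const 2).mul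
        (measurable_greenKernel k _).ennreal_ofReal.aemeasurable
    refine h6.trans (Filter.liminf_le_of_frequently_le' (Filter.Frequently.of_forall fun n => ?_))
    rw [hVe]
    gcongr
    refine ENNReal.tsum_le_tsum fun p => ?_
    gcongr
    rw [enorm_mul]
    refine mul_le_of_le_one_left' ?_
    rw [← ofReal_norm, norm_pow, Complex.norm_real, Real.norm_of_nonneg (hR0 n).le,
      ENNReal.ofReal_le_one]
    exact pow_le_one₀ (hR0 n).le (hR1 n).le
  · have hlam : Filter.Tendsto (fun n => (1 - ‖ζ‖ ^ 2) / (1 - ‖ζ‖ ^ 2 / R n ^ 2)) Filter.atTop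
        (nhds 1) := by
      have h1 : Filter.Tendsto (fun n => 1 - ‖ζ‖ ^ 2 / R n ^ 2) Filter.atTop
          (nhds (1 - ‖ζ‖ ^ 2)) := by
        simpa using ((tendsto_const_nhds (x := ‖ζ‖ ^ 2)).div (hRlim.pow 2) (by simp)).const_sub 1
      have h2 := (tendsto_const_nhds (x := 1 - ‖ζ‖ ^ 2)).div h1 hpos.ne'
      rwa [div_self hpos.ne'] at h2
    rw [quotEnergy, ← ENNReal.tsum_mul_left]
    rw [ENNReal.tsum_eq_iSup_nat]
    refine iSup_le fun N => ?_
    have h3 : Filter.Tendsto (fun n => ∑ p ∈ Finset.range N, ENNReal.ofReal (((k - 1)! : ℝ) ^ 2) *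
        ((p.choose (k - 1) : ℝ≥0∞) * ‖(R n : ℂ) ^ (p + 1) * quotCoeff ζ a p‖ₑ ^ 2)) Filter.atTop
        (nhds (∑ p ∈ Finset.range N, ENNReal.ofReal (((k - 1)! : ℝ) ^ 2) *
        ((p.choose (k - 1) : ℝ≥0∞) * ‖quotCoeff ζ a p‖ₑ ^ 2))) := by
      refine tendsto_finsetSum _ fun p _ => ?_
      refine ENNReal.Tendsto.const_mul (ENNReal.Tendsto.const_mul ?_ (Or.inr (by simp)))
        (Or.inr ENNReal.ofReal_ne_top)
      refine ((ENNReal.continuous_pow 2).comp continuous_enorm).continuousAt.tendsto.comp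
          (x := Filter.atTop) ?_
      simpa using (hRc.pow (p + 1)).mul_const (quotCoeff ζ a p)
    by_cases htop : discEnergy k ζ a = ∞
    · rw [htop]; exact le_top
    have h4 := ENNReal.Tendsto.mul_const (b := discEnergy k ζ a) (ENNReal.tendsto_ofReal hlam)
      (Or.inr htop)
    rw [ENNReal.ofReal_one, one_mul] at h4
    refine le_of_tendsto_of_tendsto' h3 h4 fun n => ?_
    refine le_trans ?_ (discEnergy_dilate_le hk a (hR1 n) (hζR n))
    rw [← Finset.mul_sum]
    change _ ≤ V n
    rw [hVe]
    gcongr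
    exact ENNReal.sum_le_tsum _

/-! ### A discrete Hardy type identity -/

/-- The quotient `q! / (q + k)!`. -/
def invRising (k q : ℕ) : ℝ := (q ! : ℝ) / ((q + k)! : ℝ)

theorem invRising_pos (k q : ℕ) : 0 < invRising k q := by
  unfold invRising; positivity

theorem invRising_succ_left (k q : ℕ) :
    (q + k + 1) * invRising (k + 1) q = invRising k q := by
  unfold invRising
  rw [← add_assoc, Nat.factorial_succ (q + k)]
  push_cast
  field_simp

theorem invRising_succ_right (k q : ℕ) :
    (q + 1) * invRising (k + 1) q = invRising k (q + 1) := by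
  unfold invRising
  rw [show q + 1 + k = q + (k + 1) by ring, Nat.factorial_succ q]
  push_cast
  ring

theorem mul_invRising (k q : ℕ) :
    k * invRising (k + 1) q = invRising k q - invRising k (q + 1) := by
  linear_combination invRising_succ_left k q - invRising_succ_right k q

theorem sq_norm_combination (x y : ℂ) (P Q : ℝ) :
    ‖(P : ℂ) * y - Q * x‖ ^ 2 =
      P * Q * ‖y - x‖ ^ 2 - P * (Q - P) * ‖y‖ ^ 2 + Q * (Q - P) * ‖x‖ ^ 2 := by
  simp only [← Complex.normSq_eq_norm_sq, Complex.normSq_apply]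
  simp
  ring

/-- The combination `(q + 1) S_{q+1} - (q + 1 + k) S_q`. -/
def hardyDiff (k : ℕ) (S : ℕ → ℂ) (q : ℕ) : ℂ := (q + 1) * S (q + 1) - (q + 1 + k) * S q

/-- Expanding the square by `sq_norm_combination` with `P = N + 1` and `Q = N + K + 2` produces a
difference term, and the two pure squares are the increment of the boundary term. -/
theorem sum_invRising_mul_hardyDiff (K : ℕ) (S : ℕ → ℂ) (N : ℕ) :
    ∑ q ∈ Finset.range N, invRising (K + 2) q * ‖hardyDiff (K + 1) S q‖ ^ 2 +
      (K + 1) * invRising (K + 1) N * ‖S N‖ ^ 2 =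
      invRising K 0 * ‖S 0‖ ^ 2 +
        ∑ j ∈ Finset.range N, invRising K (j + 1) * ‖S (j + 1) - S j‖ ^ 2 := by
  induction N with
  | zero =>
    have := invRising_succ_left K 0
    push_cast at this
    simp only [Finset.range_zero, Finset.sum_empty, zero_add, add_zero]
    rw [← this]
    ring
  | succ N ih =>
    rw [Finset.sum_range_succ, Finset.sum_range_succ, ← add_assoc, ← ih]
    have h1 : ‖hardyDiff (K + 1) S N‖ ^ 2 = _ :=
      (by rw [hardyDiff]; push_cast; rfl :
        ‖hardyDiff (K + 1) S N‖ ^ 2 =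
          ‖((N + 1 : ℝ) : ℂ) * S (N + 1) - ((N + 1 + (K + 1) : ℝ) : ℂ) * S N‖ ^ 2).trans
        (sq_norm_combination _ _ _ _)
    have h2 := invRising_succ_left (K + 1) N
    have h3 := invRising_succ_right (K + 1) N
    have h4 := invRising_succ_left K (N + 1)
    push_cast at h2 h4
    rw [h1, ← h4, ← h3, ← h2]
    ring

theorem invRising_mul_hardyDiff (k : ℕ) (S : ℕ → ℂ) (q : ℕ) :
    (invRising (k + 1) q : ℂ) * hardyDiff k S q =
      invRising k (q + 1) * S (q + 1) - invRising k q * S q := by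
  have h1 : ((q + k + 1 : ℂ)) * invRising (k + 1) q = invRising k q := by
    exact_mod_cast congrArg Complex.ofReal (invRising_succ_left k q)
  have h2 : ((q + 1 : ℂ)) * invRising (k + 1) q = invRising k (q + 1) := by
    exact_mod_cast congrArg Complex.ofReal (invRising_succ_right k q)
  rw [hardyDiff]
  linear_combination S (q + 1) * h2 - S q * h1

theorem sum_Ico_invRising_le {k : ℕ} (N M : ℕ) :
    k * ∑ q ∈ Finset.Ico N M, invRising (k + 1) q ≤ invRising k N := by
  rcases le_total N M with h | h
  · rw [Finset.mul_sum, Finset.sum_congr rfl fun q _ => mul_invRising k q,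
      Finset.sum_Ico_eq_sum_range]
    have h1 := Finset.sum_range_sub' (fun i => invRising k (N + i)) (M - N)
    simp only [add_zero, ← add_assoc] at h1
    rw [h1]
    linarith [invRising_pos k (N + (M - N))]
  · rw [Finset.Ico_eq_empty (by omega)]
    simpa using (invRising_pos k N).le

/-- The Cauchy-Schwarz bound for the boundary term. -/
theorem sq_norm_sub_le (k : ℕ) (S : ℕ → ℂ) {N M : ℕ} (h : N ≤ M) :
    k * ‖invRising k M * S M - invRising k N * S N‖ ^ 2 ≤ invRising k N *
      ∑ q ∈ Finset.Ico N M, invRising (k + 1) q * ‖hardyDiff k S q‖ ^ 2 := by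
  have h1 : (invRising k M : ℂ) * S M - invRising k N * S N =
      ∑ q ∈ Finset.Ico N M, (invRising (k + 1) q : ℂ) * hardyDiff k S q := by
    rw [Finset.sum_congr rfl fun q _ => invRising_mul_hardyDiff k S q]
    exact (Finset.sum_Ico_sub (fun q => (invRising k q : ℂ) * S q) h).symm
  have h2 : ‖(invRising k M : ℂ) * S M - invRising k N * S N‖ ≤
      ∑ q ∈ Finset.Ico N M, invRising (k + 1) q * ‖hardyDiff k S q‖ := by
    rw [h1]
    refine (norm_sum_le _ _).trans (Finset.sum_le_sum fun q _ => ?_)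
    rw [norm_mul, Complex.norm_real, Real.norm_of_nonneg (invRising_pos _ _).le]
  have h3 := Finset.sum_sq_le_sum_mul_sum_of_sq_le_mul (Finset.Ico N M)
    (r := fun q => invRising (k + 1) q * ‖hardyDiff k S q‖) (f := fun q => invRising (k + 1) q)
    (g := fun q => invRising (k + 1) q * ‖hardyDiff k S q‖ ^ 2)
    (fun q _ => (invRising_pos _ _).le)
    (fun q _ => mul_nonneg (invRising_pos _ _).le (sq_nonneg _)) (fun q _ => le_of_eq (by ring))
  have h4 : 0 ≤ ∑ q ∈ Finset.Ico N M, invRising (k + 1) q * ‖hardyDiff k S q‖ ^ 2 :=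
    Finset.sum_nonneg fun q _ => mul_nonneg (invRising_pos _ _).le (sq_nonneg _)
  calc k * ‖(invRising k M : ℂ) * S M - invRising k N * S N‖ ^ 2
      ≤ k * (∑ q ∈ Finset.Ico N M, invRising (k + 1) q * ‖hardyDiff k S q‖) ^ 2 := by gcongr
    _ ≤ k * ((∑ q ∈ Finset.Ico N M, invRising (k + 1) q) *
        ∑ q ∈ Finset.Ico N M, invRising (k + 1) q * ‖hardyDiff k S q‖ ^ 2) := by gcongr
    _ = (k * ∑ q ∈ Finset.Ico N M, invRising (k + 1) q) *
        ∑ q ∈ Finset.Ico N M, invRising (k + 1) q * ‖hardyDiff k S q‖ ^ 2 := by ring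
    _ ≤ _ := mul_le_mul_of_nonneg_right (sum_Ico_invRising_le N M) h4

theorem summable_invRising (K : ℕ) : Summable (invRising (K + 2)) := by
  refine summable_of_sum_range_le (c := invRising (K + 1) 0) (fun q => (invRising_pos _ _).le)
    fun N => ?_
  have h := sum_Ico_invRising_le (k := K + 1) 0 N
  rw [← Finset.range_eq_Ico] at h
  refine le_trans ?_ h
  push_cast
  have : 0 ≤ ∑ q ∈ Finset.range N, invRising (K + 1 + 1) q :=
    Finset.sum_nonneg fun q _ => (invRising_pos _ _).le
  nlinarith [(Nat.cast_nonneg K : (0 : ℝ) ≤ K)]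

/-- By `invRising_mul_hardyDiff` these products are, up to a constant, partial sums of a series; it
converges absolutely because `w x ≤ w + w x²` and both majorants are summable. -/
theorem exists_tendsto_invRising_mul {K : ℕ} {S : ℕ → ℂ}
    (hS : Summable fun q => invRising (K + 2) q * ‖hardyDiff (K + 1) S q‖ ^ 2) :
    ∃ l, Filter.Tendsto (fun q => (invRising (K + 1) q : ℂ) * S q) Filter.atTop (nhds l) := by
  have h1 : Summable fun q => (invRising (K + 2) q : ℂ) * hardyDiff (K + 1) S q := by
    refine Summable.of_norm_bounded ((summable_invRising K).add hS) fun q => ?_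
    rw [norm_mul, Complex.norm_real, Real.norm_of_nonneg (invRising_pos _ _).le]
    have := invRising_pos (K + 2) q
    nlinarith [sq_nonneg (‖hardyDiff (K + 1) S q‖ - 1), sq_nonneg ‖hardyDiff (K + 1) S q‖]
  have h2 := h1.hasSum.tendsto_sum_nat.add_const ((invRising (K + 1) 0 : ℂ) * S 0)
  refine ⟨_, h2.congr fun N => ?_⟩
  rw [Finset.sum_congr rfl fun q _ => invRising_mul_hardyDiff (K + 1) S q,
    Finset.sum_range_sub (fun q => (invRising (K + 1) q : ℂ) * S q)]
  ring

/-- The finite identity passes to the limit once its boundary term is seen to vanish. Letting `M →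
∞` in the Cauchy-Schwarz bound `sq_norm_sub_le`, where the limit is zero by assumption, dominates
that term by a tail of a convergent series. -/
theorem hasSum_of_tendsto_invRising_mul {K : ℕ} {S : ℕ → ℂ}
    (hS : Summable fun q => invRising (K + 2) q * ‖hardyDiff (K + 1) S q‖ ^ 2)
    (h0 : Filter.Tendsto (fun q => (invRising (K + 1) q : ℂ) * S q) Filter.atTop (nhds 0)) :
    HasSum (fun j => invRising K (j + 1) * ‖S (j + 1) - S j‖ ^ 2)
      (∑' q, invRising (K + 2) q * ‖hardyDiff (K + 1) S q‖ ^ 2 - invRising K 0 * ‖S 0‖ ^ 2) := by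
  set A : ℕ → ℝ := fun q => invRising (K + 2) q * ‖hardyDiff (K + 1) S q‖ ^ 2 with hA
  have hA0 : ∀ q, 0 ≤ A q := fun q => mul_nonneg (invRising_pos _ _).le (sq_nonneg _)
  have hbd : ∀ N, (K + 1) * invRising (K + 1) N * ‖S N‖ ^ 2 ≤
      ∑' q, A q - ∑ q ∈ Finset.range N, A q := fun N => by
    have hv := invRising_pos (K + 1) N
    have h1 : ∀ M, N ≤ M → ((K + 1 : ℕ) : ℝ) * ‖(invRising (K + 1) M : ℂ) * S M -
        invRising (K + 1) N * S N‖ ^ 2 ≤ invRising (K + 1) N *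
        (∑' q, A q - ∑ q ∈ Finset.range N, A q) := fun M hM => by
      refine (sq_norm_sub_le (K + 1) S hM).trans ?_
      gcongr
      rw [Finset.sum_Ico_eq_sub _ hM]
      exact sub_le_sub_right (hS.sum_le_tsum _ fun q _ => hA0 q) _
    have h2 : Filter.Tendsto (fun M => ((K + 1 : ℕ) : ℝ) * ‖(invRising (K + 1) M : ℂ) * S M -
        invRising (K + 1) N * S N‖ ^ 2) Filter.atTop (nhds (((K + 1 : ℕ) : ℝ) *
          ‖0 - invRising (K + 1) N * S N‖ ^ 2)) :=
      ((h0.sub_const _).norm.pow 2).const_mul _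
    have h3 := le_of_tendsto h2 (Filter.eventually_atTop.2 ⟨N, h1⟩)
    rw [zero_sub, norm_neg, norm_mul, Complex.norm_real, Real.norm_of_nonneg hv.le] at h3
    push_cast at h3
    -- Cancels one of the two factors `invRising (K + 1) N` coming from the square.
    refine le_of_mul_le_mul_left ?_ hv
    linarith
  have hlim : Filter.Tendsto (fun N => (K + 1) * invRising (K + 1) N * ‖S N‖ ^ 2) Filter.atTop
      (nhds 0) := by
    refine squeeze_zero (fun N => ?_) hbd ?_
    · have := invRising_pos (K + 1) N
      positivity
    · simpa using hS.hasSum.tendsto_sum_nat.const_sub (∑' q, A q)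
  rw [hasSum_iff_tendsto_nat_of_nonneg (fun j => mul_nonneg (invRising_pos _ _).le (sq_nonneg _))]
  have h2 := (hS.hasSum.tendsto_sum_nat.add hlim).sub_const (invRising K 0 * ‖S 0‖ ^ 2)
  rw [add_zero] at h2
  refine h2.congr fun N => ?_
  rw [sum_invRising_mul_hardyDiff]
  ring

/-! ### Boundary points -/

/-- The weighted integral `∫ |f^(k)|² (1 - |z|²)^k / |z - ζ|² dA` of the power series `f` with
coefficients `a`. -/
def circleEnergy (k : ℕ) (ζ : ℂ) (a : ℕ → ℂ) : ℝ≥0∞ :=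
  ∫⁻ z, ‖powerSum (derivCoeff k a) z‖ₑ ^ 2 *
    ENNReal.ofReal ((1 - ‖z‖ ^ 2) ^ k / ‖z - ζ‖ ^ 2) ∂areaMeasure

theorem coeff_unique {b c : ℕ → ℂ} {R : ℝ} (hR : 0 < R) (hb : AbsConv b R) (hc : AbsConv c R)
    (h : ∀ z, ‖z‖ < R → powerSum b z = powerSum c z) : b = c := by
  funext n
  rw [← hb.taylorCoeff hR n, ← hc.taylorCoeff hR n]
  refine taylorCoeff_congr ?_ n
  filter_upwards [isOpen_ball.mem_nhds (mem_ball_self hR)] with z hz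
  exact h z (by simpa using hz)

theorem exists_quotient {b : ℕ → ℂ} (hb : AbsConv b 1) {ζ : ℂ} (hζ : ‖ζ‖ = 1) :
    ∃ h : ℕ → ℂ, AbsConv h 1 ∧ b 0 = -ζ * h 0 ∧ (∀ m, b (m + 1) = h m - ζ * h (m + 1)) ∧
      ∀ z, ‖z‖ < 1 → powerSum h z = powerSum b z / (z - ζ) := by
  have hne : ∀ z : ℂ, ‖z‖ < 1 → z - ζ ≠ 0 := fun z hz h => by
    rw [sub_eq_zero.1 h] at hz
    linarith
  have hd : DifferentiableOn ℂ (fun z => powerSum b z / (z - ζ)) (ball 0 1) :=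
    hb.differentiableOn.div (by fun_prop) fun z hz => hne z (by simpa using hz)
  set h := taylorCoeff (fun z => powerSum b z / (z - ζ)) with hh
  have hc : AbsConv h 1 := absConv_taylorCoeff hd
  have hps : ∀ z, ‖z‖ < 1 → powerSum h z = powerSum b z / (z - ζ) := fun z hz =>
    powerSum_taylorCoeff hd hz
  set c : ℕ → ℂ := fun m => (if m = 0 then 0 else h (m - 1)) with hcdef
  have hcc : AbsConv c 1 := AbsConv.of_shift (by simpa [hcdef] using hc)
  have hsum : AbsConv (fun m => c m + -ζ * h m) 1 := hcc.add (hc.const_mul _)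
  have heq : b = fun m => c m + -ζ * h m := by
    refine coeff_unique zero_lt_one hb hsum fun z hz => ?_
    rw [powerSum_add hcc (hc.const_mul _) hz, powerSum_const_mul, powerSum_eq_add_mul hcc hz]
    simp only [hcdef, if_true, Nat.add_eq_zero_iff, one_ne_zero, and_false, if_false,
      Nat.add_sub_cancel]
    change _ = 0 + z * powerSum h z + _
    have := hne z hz
    rw [hps z hz]
    field_simp
    ring
  refine ⟨h, hc, ?_, fun m => ?_, hps⟩
  · rw [heq]; simp [hcdef]
  · rw [heq]; simp [hcdef]; ring

/-- Dividing by `z - ζ` absorbs the singular part of the weight; what is left is radial, and its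
moments are Beta integrals. -/
theorem circleEnergy_eq_tsum {k : ℕ} {ζ : ℂ} {a h : ℕ → ℂ} (hh : AbsConv h 1)
    (hps : ∀ z, ‖z‖ < 1 → powerSum h z = powerSum (derivCoeff k a) z / (z - ζ)) :
    circleEnergy k ζ a = ENNReal.ofReal (k ! : ℝ) *
      ∑' q, ENNReal.ofReal (invRising (k + 1) q * ‖h q‖ ^ 2) := by
  have h1 : circleEnergy k ζ a =
      ∫⁻ z, ‖powerSum h z‖ₑ ^ 2 * ENNReal.ofReal ((1 - ‖z‖ ^ 2) ^ k) ∂areaMeasure := by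
    refine lintegral_congr_ae (ae_areaMeasure_of_forall ζ fun z hz hne => ?_)
    have h2 : 0 < ‖z - ζ‖ := norm_pos_iff.2 (sub_ne_zero.2 hne)
    have h3 := one_sub_sq_pos hz
    beta_reduce
    rw [hps z hz, ← ofReal_norm, ← ofReal_norm, ← ENNReal.ofReal_pow (norm_nonneg _),
      ← ENNReal.ofReal_pow (norm_nonneg _), ← ENNReal.ofReal_mul (by positivity),
      ← ENNReal.ofReal_mul (by positivity), norm_div]
    congr 1
    field_simp
  rw [h1, lintegral_enorm_sq_mul_radial hh (w := fun r => ENNReal.ofReal ((1 - r ^ 2) ^ k))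
    (by fun_prop), ← ENNReal.tsum_mul_left]
  refine tsum_congr fun q => ?_
  rw [lintegral_two_mul_pow, ← ofReal_norm, ← ENNReal.ofReal_pow (norm_nonneg _),
    ← ENNReal.ofReal_mul (by positivity), ← ENNReal.ofReal_mul (by positivity), invRising]
  congr 1
  rw [← add_assoc]
  ring

/-- The partial sums associated to a solution of the quotient recurrence at a boundary point. -/
def quotPartial (K : ℕ) (ζ : ℂ) (g : ℕ → ℂ) (q : ℕ) : ℂ :=
  ∑ j ∈ Finset.range (q + 1), derivCoeff K (fun p => ζ ^ p * g p) j

/-- For `ζ = 1` and `k = K + 1`, differentiating `f = f(1) + (z - 1) g` gives `h = g^(k) - k g^(k-1)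
/ (1 - z)`. The coefficients of the last quotient are the partial sums `S_q`, so `h_q =
(q+1)(S_{q+1} - S_q) - k S_q`. A general `ζ` only adds a rotation. -/
theorem hardyDiff_quotPartial {K : ℕ} {ζ : ℂ} {a g h : ℕ → ℂ} (hg : IsQuot ζ a g)
    (h0 : derivCoeff (K + 1) a 0 = -ζ * h 0)
    (h1 : ∀ m, derivCoeff (K + 1) a (m + 1) = h m - ζ * h (m + 1)) (q : ℕ) :
    hardyDiff (K + 1) (quotPartial K ζ g) q = ζ ^ (q + K + 1) * h q := by
  induction q with
  | zero =>
    have e := hg K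
    simp only [hardyDiff, quotPartial, Finset.sum_range_succ, Finset.sum_range_zero]
    simp only [derivCoeff, zero_add] at h0 ⊢
    rw [show 1 + K = K + 1 by ring]
    rw [Nat.factorial_succ, e] at h0
    rw [Nat.factorial_succ K]
    simp only [Nat.factorial_zero, Nat.factorial_one] at h0 ⊢
    push_cast at h0 ⊢
    linear_combination -ζ ^ K * h0
  | succ q ih =>
    have e := hg (q + K + 1)
    have h2 := h1 q
    have hq : (q ! : ℂ) ≠ 0 := by exact_mod_cast q.factorial_ne_zero
    have hq1 : (q + 1 : ℂ) ≠ 0 := by exact_mod_cast q.succ_ne_zero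
    have hq2 : (q + 1 + 1 : ℂ) ≠ 0 := by exact_mod_cast (q + 1).succ_ne_zero
    have e3 : hardyDiff (K + 1) (quotPartial K ζ g) (q + 1) -
        hardyDiff (K + 1) (quotPartial K ζ g) q =
        (q + 2) * derivCoeff K (fun p => ζ ^ p * g p) (q + 1 + 1) -
        (q + 1 + K + 1) * derivCoeff K (fun p => ζ ^ p * g p) (q + 1) := by
      simp only [hardyDiff, quotPartial]
      rw [Finset.sum_range_succ _ (q + 1 + 1), Finset.sum_range_succ _ (q + 1)]
      push_cast
      ring
    have e4 : (q + 2 : ℂ) * derivCoeff K (fun p => ζ ^ p * g p) (q + 1 + 1) -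
        (q + 1 + K + 1) * derivCoeff K (fun p => ζ ^ p * g p) (q + 1) =
        -ζ ^ (q + K + 1) * derivCoeff (K + 1) a (q + 1) := by
      simp only [derivCoeff]
      rw [show q + 1 + (K + 1) = q + K + 1 + 1 by ring, e,
        show q + 1 + 1 + K = q + K + 1 + 1 by ring, show q + 1 + K = q + K + 1 by ring,
        Nat.factorial_succ (q + K + 1), Nat.factorial_succ (q + 1), Nat.factorial_succ q]
      push_cast
      field_simp
      ring
    rw [show q + 1 + K + 1 = q + K + 1 + 1 by ring, pow_succ]
    linear_combination e3 + e4 + ih - ζ ^ (q + K + 1) * h2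

theorem quotPartial_succ_sub (K : ℕ) (ζ : ℂ) (g : ℕ → ℂ) (q : ℕ) :
    quotPartial K ζ g (q + 1) - quotPartial K ζ g q =
      derivCoeff K (fun p => ζ ^ p * g p) (q + 1) := by
  simp only [quotPartial]
  rw [Finset.sum_range_succ _ (q + 1)]
  ring

theorem quotPartial_zero (K : ℕ) (ζ : ℂ) (g : ℕ → ℂ) :
    quotPartial K ζ g 0 = derivCoeff K (fun p => ζ ^ p * g p) 0 := by
  simp [quotPartial]

theorem invRising_mul_norm_derivCoeff {ζ : ℂ} (hζ : ‖ζ‖ = 1) (K : ℕ) (g : ℕ → ℂ) (j : ℕ) :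
    invRising K j * ‖derivCoeff K (fun p => ζ ^ p * g p) j‖ ^ 2 =
      (K ! : ℝ) * (((j + K).choose K : ℝ) * ‖g (j + K)‖ ^ 2) := by
  have h2 := Nat.choose_mul_factorial_mul_factorial (Nat.le_add_left K j)
  rw [Nat.add_sub_cancel] at h2
  have h3 : ((j + K).choose K : ℝ) = ((j + K)! : ℝ) / (K ! * j !) := by
    rw [eq_div_iff (by positivity), ← h2]
    push_cast
    ring
  rw [h3, derivCoeff, invRising, norm_mul, norm_mul, norm_div, norm_pow, hζ, Complex.norm_natCast,
    Complex.norm_natCast, one_pow]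
  field_simp

theorem tsum_choose_eq_shift (K : ℕ) (g : ℕ → ℂ) :
    quotEnergy (K + 1) g =
      ∑' j : ℕ, ENNReal.ofReal (((j + K).choose K : ℝ) * ‖g (j + K)‖ ^ 2) := by
  rw [quotEnergy, ← ENNReal.summable.sum_add_tsum_nat_add' (k := K), Finset.sum_eq_zero, zero_add]
  · exact tsum_congr fun j => by rw [natCast_mul_enorm_sq, Nat.add_sub_cancel]
  · intro p hp
    rw [Nat.add_sub_cancel, Nat.choose_eq_zero_of_lt (Finset.mem_range.1 hp)]
    simp

/-- The contribution of the homogeneous solution `ζ^(-p)` of the recurrence: after normalization its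
partial sums are constant and nonzero, so a multiple of it can cancel any limit. -/
theorem sum_factorial_div (K q : ℕ) :
    (invRising (K + 1) q : ℂ) * ∑ j ∈ Finset.range (q + 1), ((j + K)! : ℂ) / (j ! : ℂ) =
      1 / (K + 1) := by
  have hK : (K + 1 : ℂ) ≠ 0 := by exact_mod_cast K.succ_ne_zero
  have h : ∀ q, (K + 1) * ∑ j ∈ Finset.range (q + 1), ((j + K)! : ℂ) / (j ! : ℂ) =
      ((q + K + 1)! : ℂ) / (q ! : ℂ) := fun q => by
    induction q with
    | zero => simp [Nat.factorial_succ]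
    | succ q ih =>
      have hq : (q ! : ℂ) ≠ 0 := by exact_mod_cast q.factorial_ne_zero
      have hq1 : (q + 1 : ℂ) ≠ 0 := by exact_mod_cast q.succ_ne_zero
      rw [Finset.sum_range_succ, mul_add, ih, show q + 1 + K + 1 = q + K + 1 + 1 by ring,
        show q + 1 + K = q + K + 1 by ring, Nat.factorial_succ (q + K + 1), Nat.factorial_succ q]
      push_cast
      field_simp
      ring
  have hq : (q ! : ℂ) ≠ 0 := by exact_mod_cast q.factorial_ne_zero
  have hq2 : ((q + K + 1)! : ℂ) ≠ 0 := by exact_mod_cast (q + K + 1).factorial_ne_zero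
  rw [eq_div_iff hK, mul_assoc, mul_comm _ (K + 1 : ℂ), h, invRising, ← add_assoc]
  push_cast
  field_simp

theorem tendsto_zero_of_quotEnergy_ne_top {k : ℕ} {g : ℕ → ℂ} (h : quotEnergy k g ≠ ∞) :
    Filter.Tendsto g Filter.atTop (nhds 0) := by
  have h1 := (summable_of_quotEnergy_ne_top h).tendsto_atTop_zero
  have h2 : Filter.Tendsto (fun p => ‖g p‖ ^ 2) Filter.atTop (nhds 0) := by
    refine squeeze_zero' (Filter.Eventually.of_forall fun p => sq_nonneg _) ?_ h1
    filter_upwards [Filter.eventually_ge_atTop (k - 1)] with p hp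
    have : (1 : ℝ) ≤ p.choose (k - 1) := by exact_mod_cast Nat.choose_pos hp
    exact le_mul_of_one_le_left (sq_nonneg _) this
  rw [tendsto_zero_iff_norm_tendsto_zero]
  simpa using h2.sqrt

theorem exists_isQuot_circle {ζ : ℂ} (hζ : ‖ζ‖ = 1) (a : ℕ → ℂ) : ∃ g, IsQuot ζ a g := by
  have hne : ζ ≠ 0 := fun h => by simp [h] at hζ
  -- The starting value is arbitrary; it is corrected later by a multiple of `ζ^(-p)`.
  refine ⟨fun p => Nat.rec 0 (fun p g => (g - a (p + 1)) / ζ) p, fun p => ?_⟩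
  simp only
  field_simp
  ring

/-- Finite energy makes the normalized partial sums of any solution converge. Subtracting the right
homogeneous solution makes the limit zero, and the Hardy type identity then holds without a boundary
term. -/
theorem circleEnergy_of_ne_top {K : ℕ} {ζ : ℂ} (hζ : ‖ζ‖ = 1) {a : ℕ → ℂ} (ha : AbsConv a 1)
    (hfin : circleEnergy (K + 1) ζ a ≠ ∞) : ∃ g, IsQuot ζ a g ∧
      circleEnergy (K + 1) ζ a = ENNReal.ofReal ((K + 1)! * K ! : ℝ) * quotEnergy (K + 1) g := by
  have hne : ζ ≠ 0 := fun h => by simp [h] at hζ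
  obtain ⟨h, hh, hb0, hb1, hps⟩ := exists_quotient (ha.derivCoeff (K + 1)) hζ
  have hE := circleEnergy_eq_tsum hh hps
  have hw0 : ∀ q, 0 ≤ invRising (K + 1 + 1) q * ‖h q‖ ^ 2 := fun q =>
    mul_nonneg (invRising_pos _ _).le (sq_nonneg _)
  have hws : Summable fun q => invRising (K + 2) q * ‖h q‖ ^ 2 := by
    have h1 : ∑' q, ENNReal.ofReal (invRising (K + 1 + 1) q * ‖h q‖ ^ 2) ≠ ∞ := fun h2 => by
      rw [hE, h2, ENNReal.mul_top (ENNReal.ofReal_pos.2 (by positivity)).ne'] at hfin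
      exact hfin rfl
    refine (ENNReal.summable_toReal h1).congr fun q => ?_
    rw [ENNReal.toReal_ofReal (hw0 q)]
  have hnorm : ∀ g, IsQuot ζ a g → ∀ q, ‖hardyDiff (K + 1) (quotPartial K ζ g) q‖ = ‖h q‖ :=
    fun g hg q => by
      rw [hardyDiff_quotPartial hg hb0 hb1, norm_mul, norm_pow, hζ, one_pow, one_mul]
  obtain ⟨g₀, hg₀⟩ := exists_isQuot_circle hζ a
  obtain ⟨l, hl⟩ := exists_tendsto_invRising_mul (K := K) (S := quotPartial K ζ g₀) (by
    simpa only [hnorm g₀ hg₀] using hws)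
  -- By `sum_factorial_div`, adding `c ζ^(-p)` shifts the limit `l` by `c / (K + 1)`.
  set c : ℂ := -(K + 1) * l with hc
  set g : ℕ → ℂ := fun p => g₀ p + c * (ζ ^ p)⁻¹ with hgdef
  have hg : IsQuot ζ a g := fun p => by
    rw [hg₀ p, hgdef]
    simp only [pow_succ]
    field_simp
    ring
  have hlim : Filter.Tendsto (fun q => (invRising (K + 1) q : ℂ) * quotPartial K ζ g q)
      Filter.atTop (nhds 0) := by
    have h1 := hl.add_const (c * (1 / (K + 1)))
    have hK : (K + 1 : ℂ) ≠ 0 := by exact_mod_cast K.succ_ne_zero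
    rw [show l + c * (1 / (K + 1)) = 0 by rw [hc]; field_simp; ring] at h1
    refine h1.congr fun q => ?_
    rw [← sum_factorial_div K q, mul_left_comm, ← mul_add]
    congr 1
    rw [quotPartial, quotPartial, Finset.mul_sum, ← Finset.sum_add_distrib]
    refine Finset.sum_congr rfl fun j _ => ?_
    simp only [derivCoeff, hgdef]
    have : ζ ^ (j + K) ≠ 0 := pow_ne_zero _ hne
    field_simp
  refine ⟨g, hg, ?_⟩
  have hS := hasSum_of_tendsto_invRising_mul (K := K) (S := quotPartial K ζ g) (by
    simpa only [hnorm g hg] using hws) hlim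
  simp only [hnorm g hg, quotPartial_succ_sub, quotPartial_zero, invRising_mul_norm_derivCoeff hζ]
    at hS
  -- The subtracted term `invRising K 0 * ‖S 0‖ ^ 2` is exactly the missing summand `j = 0`.
  have hS2 : HasSum (fun j => (K ! : ℝ) * (((j + K).choose K : ℝ) * ‖g (j + K)‖ ^ 2))
      (∑' q, invRising (K + 2) q * ‖h q‖ ^ 2) := by
    rw [← hasSum_nat_add_iff' 1]
    simpa using hS
  rw [hE, ENNReal.ofReal_mul (by positivity), mul_assoc, tsum_choose_eq_shift,
    ← ENNReal.ofReal_tsum_of_nonneg hw0 hws, ← ENNReal.tsum_mul_left, ← hS2.tsum_eq,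
    ENNReal.ofReal_tsum_of_nonneg (fun _ => by positivity) hS2.summable]
  congr 1
  exact tsum_congr fun j => ENNReal.ofReal_mul (by positivity)

/-- In the finite identity the boundary term is nonnegative, so a finite quotient sum bounds the
energy. The previous theorem then yields a solution of finite sum, which is the given one because
both tend to zero. -/
theorem circleEnergy_of_isQuot {K : ℕ} {ζ : ℂ} (hζ : ‖ζ‖ = 1) {a g : ℕ → ℂ} (ha : AbsConv a 1)
    (hg : IsQuot ζ a g) (hfin : quotEnergy (K + 1) g ≠ ∞) :
    circleEnergy (K + 1) ζ a = ENNReal.ofReal ((K + 1)! * K ! : ℝ) * quotEnergy (K + 1) g := by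
  obtain ⟨h, hh, hb0, hb1, hps⟩ := exists_quotient (ha.derivCoeff (K + 1)) hζ
  have hE := circleEnergy_eq_tsum hh hps
  have hw0 : ∀ q, 0 ≤ invRising (K + 1 + 1) q * ‖h q‖ ^ 2 := fun q =>
    mul_nonneg (invRising_pos _ _).le (sq_nonneg _)
  have hnorm : ∀ q, ‖hardyDiff (K + 1) (quotPartial K ζ g) q‖ = ‖h q‖ :=
    fun q => by
      rw [hardyDiff_quotPartial hg hb0 hb1, norm_mul, norm_pow, hζ, one_pow, one_mul]
  have hsum : Summable fun j => (K ! : ℝ) * (((j + K).choose K : ℝ) * ‖g (j + K)‖ ^ 2) := by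
    have h1 := summable_of_quotEnergy_ne_top hfin
    rw [Nat.add_sub_cancel, ← summable_nat_add_iff K] at h1
    exact h1.mul_left _
  have hws : Summable fun q => invRising (K + 1 + 1) q * ‖h q‖ ^ 2 := by
    refine summable_of_sum_range_le hw0
      (c := ∑' j, (K ! : ℝ) * (((j + K).choose K : ℝ) * ‖g (j + K)‖ ^ 2)) fun N => ?_
    have h1 := sum_invRising_mul_hardyDiff K (quotPartial K ζ g) N
    simp only [hnorm, quotPartial_succ_sub, quotPartial_zero, invRising_mul_norm_derivCoeff hζ] at h1
    have h2 : 0 ≤ (K + 1) * invRising (K + 1) N * ‖quotPartial K ζ g N‖ ^ 2 := by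
      have := invRising_pos (K + 1) N
      positivity
    have h3 := hsum.sum_le_tsum (Finset.range (N + 1)) fun _ _ => by positivity
    rw [Finset.sum_range_succ'] at h3
    linarith
  have hne : circleEnergy (K + 1) ζ a ≠ ∞ := by
    rw [hE, ← ENNReal.ofReal_tsum_of_nonneg hw0 hws, ← ENNReal.ofReal_mul (by positivity)]
    exact ENNReal.ofReal_ne_top
  obtain ⟨g', hg', hE'⟩ := circleEnergy_of_ne_top hζ ha hne
  have hfin' : quotEnergy (K + 1) g' ≠ ∞ := fun h => by
    rw [hE', h, ENNReal.mul_top (ENNReal.ofReal_pos.2 (by positivity)).ne'] at hne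
    exact hne rfl
  rw [hE', hg.unique hζ.le hg' (tendsto_zero_of_quotEnergy_ne_top hfin)
    (tendsto_zero_of_quotEnergy_ne_top hfin')]

/-! ### Local Dirichlet integrals and the local Douglas formula -/

/-- The contribution of the point `ζ` of the closed disc to the weight `U_{μ,k}`. -/
def localWeight (k : ℕ) (z ζ : ℂ) : ℝ≥0∞ :=
  (ball 0 1).indicator (fun ζ => ENNReal.ofReal (1 / ((k - 1)! : ℝ) ^ 2) *
    ENNReal.ofReal ((-1) ^ (k + 1) * greenAlmansi k z ζ / (1 - ‖ζ‖ ^ 2) ^ k)) ζ +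
  (sphere 0 1).indicator (fun ζ => ENNReal.ofReal (1 / ((k ! : ℝ) * ((k - 1)! : ℝ))) *
    ENNReal.ofReal ((1 - ‖z‖ ^ 2) ^ k / ‖z - ζ‖ ^ 2)) ζ

/-- The contribution of the point `ζ` of the closed disc to the Dirichlet integral. -/
def localEnergy (k : ℕ) (f : ℂ → ℂ) (ζ : ℂ) : ℝ≥0∞ :=
  ∫⁻ z, ‖iteratedDeriv k f z‖ₑ ^ 2 * localWeight k z ζ ∂areaMeasure

theorem measurable_greenAlmansi (k : ℕ) : Measurable fun p : ℂ × ℂ => greenAlmansi k p.1 p.2 := by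
  have hc : Measurable (fun p : ℂ × ℂ => conj p.2) :=
    (Complex.continuous_conj.comp continuous_snd).measurable
  unfold greenAlmansi
  fun_prop

theorem measurable_localWeight (k : ℕ) : Measurable fun p : ℂ × ℂ => localWeight k p.1 p.2 := by
  have hG := measurable_greenAlmansi k
  have h1 : Measurable fun p : ℂ × ℂ => ENNReal.ofReal (1 / ((k - 1)! : ℝ) ^ 2) *
      ENNReal.ofReal ((-1) ^ (k + 1) * greenAlmansi k p.1 p.2 / (1 - ‖p.2‖ ^ 2) ^ k) := by
    fun_prop
  have h2 : Measurable fun p : ℂ × ℂ => ENNReal.ofReal (1 / ((k ! : ℝ) * ((k - 1)! : ℝ))) *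
      ENNReal.ofReal ((1 - ‖p.1‖ ^ 2) ^ k / ‖p.1 - p.2‖ ^ 2) := by
    fun_prop
  exact (h1.indicator (measurableSet_ball.preimage measurable_snd)).add
    (h2.indicator (isClosed_sphere.measurableSet.preimage measurable_snd))

theorem measurable_localWeight_right (k : ℕ) (z : ℂ) : Measurable (localWeight k z) :=
  Measurable.of_uncurry_left (f := localWeight k) (measurable_localWeight k)

theorem weight_eq_lintegral_localWeight (μ : Measure ℂ) (k : ℕ) (z : ℂ) :
    weight μ k z = ∫⁻ ζ, localWeight k z ζ ∂μ := by
  have hG : Measurable fun ζ => greenAlmansi k z ζ :=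
    (measurable_greenAlmansi k).comp (measurable_prodMk_left (x := z))
  have h2 : Measurable fun ζ => ENNReal.ofReal (1 / ((k - 1)! : ℝ) ^ 2) *
      ENNReal.ofReal ((-1) ^ (k + 1) * greenAlmansi k z ζ / (1 - ‖ζ‖ ^ 2) ^ k) := by
    fun_prop
  unfold localWeight
  rw [lintegral_add_left (h2.indicator measurableSet_ball), lintegral_indicator measurableSet_ball,
    lintegral_indicator isClosed_sphere.measurableSet,
    lintegral_const_mul' _ _ ENNReal.ofReal_ne_top, lintegral_const_mul' _ _ ENNReal.ofReal_ne_top,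
    weight]

/-- The cut-off power series makes the integrand jointly measurable in `z` and `ζ`, as Tonelli's
theorem requires. -/
theorem localEnergy_eq_lintegral_indicator {f : ℂ → ℂ} (hf : f ∈ hol) (k : ℕ) (ζ : ℂ) :
    localEnergy k f ζ = ∫⁻ z, ‖(ball (0 : ℂ) 1).indicator
      (powerSum (derivCoeff k (taylorCoeff f))) z‖ₑ ^ 2 * localWeight k z ζ ∂areaMeasure := by
  refine lintegral_congr_ae (ae_areaMeasure_of_forall 0 fun z hz _ => ?_)
  beta_reduce
  rw [iteratedDeriv_eq_powerSum hf.1 k hz, Set.indicator_of_mem (by simpa using hz)]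

instance : IsFiniteMeasure areaMeasure := by
  have : IsFiniteMeasure (volume.restrict (ball (0 : ℂ) 1)) :=
    ⟨by simp⟩
  unfold areaMeasure
  exact Measure.smul_finite _ ENNReal.ofReal_ne_top

theorem measurable_energyDensity {f : ℂ → ℂ} (hf : f ∈ hol) (k : ℕ) :
    Measurable fun p : ℂ × ℂ => ‖(ball (0 : ℂ) 1).indicator
      (powerSum (derivCoeff k (taylorCoeff f))) p.1‖ₑ ^ 2 * localWeight k p.1 p.2 :=
  ((((absConv_taylorCoeff hf.1).derivCoeff k).measurable_indicator.comp
    measurable_fst).enorm.pow_const 2).mul (measurable_localWeight k)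

theorem measurable_localEnergy {f : ℂ → ℂ} (hf : f ∈ hol) (k : ℕ) :
    Measurable (localEnergy k f) := by
  rw [funext (localEnergy_eq_lintegral_indicator hf k)]
  exact Measurable.lintegral_prod_left' (measurable_energyDensity hf k)

/-- The Dirichlet integral is the average of the local Dirichlet integrals. -/
theorem dirichletIntegral_eq_lintegral_localEnergy (μ : Measure ℂ) [IsFiniteMeasure μ] (k : ℕ)
    {f : ℂ → ℂ} (hf : f ∈ hol) : dirichletIntegral μ k f = ∫⁻ ζ, localEnergy k f ζ ∂μ := by
  have h1 : dirichletIntegral μ k f = ∫⁻ z, ∫⁻ ζ, ‖(ball (0 : ℂ) 1).indicator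
      (powerSum (derivCoeff k (taylorCoeff f))) z‖ₑ ^ 2 * localWeight k z ζ ∂μ ∂areaMeasure := by
    refine lintegral_congr_ae (ae_areaMeasure_of_forall 0 fun z hz _ => ?_)
    beta_reduce
    rw [iteratedDeriv_eq_powerSum hf.1 k hz, Set.indicator_of_mem (by simpa using hz),
      weight_eq_lintegral_localWeight, lintegral_const_mul _ (measurable_localWeight_right k z)]
  rw [h1, lintegral_lintegral_swap (measurable_energyDensity hf k).aemeasurable]
  exact lintegral_congr fun ζ => (localEnergy_eq_lintegral_indicator hf k ζ).symm

theorem localEnergy_eq_quotEnergy_of_lt {k : ℕ} (hk : 1 ≤ k) {f : ℂ → ℂ} (hf : f ∈ hol) {ζ : ℂ}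
    (hζ : ‖ζ‖ < 1) : localEnergy k f ζ = quotEnergy k (quotCoeff ζ (taylorCoeff f)) := by
  have ha := absConv_taylorCoeff hf.1
  have h1 : localEnergy k f ζ = ENNReal.ofReal (1 / ((k - 1)! : ℝ) ^ 2) *
      discEnergy k ζ (taylorCoeff f) := by
    rw [discEnergy, ← lintegral_const_mul' _ _ ENNReal.ofReal_ne_top]
    refine lintegral_congr_ae (ae_areaMeasure_of_forall 0 fun z hz _ => ?_)
    beta_reduce
    rw [iteratedDeriv_eq_powerSum hf.1 k hz, localWeight, Set.indicator_of_mem (by simpa using hζ),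
      Set.indicator_of_notMem (by simpa using hζ.ne), add_zero, greenKernel]
    ring
  rw [h1, discEnergy_eq hk hζ ha, ← mul_assoc, ← ENNReal.ofReal_mul (by positivity),
    one_div_mul_cancel (by positivity), ENNReal.ofReal_one, one_mul]

theorem localEnergy_eq_circleEnergy {k : ℕ} {f : ℂ → ℂ} (hf : f ∈ hol) {ζ : ℂ}
    (hζ : ‖ζ‖ = 1) : localEnergy k f ζ = ENNReal.ofReal (1 / ((k ! : ℝ) * ((k - 1)! : ℝ))) *
      circleEnergy k ζ (taylorCoeff f) := by
  rw [circleEnergy, ← lintegral_const_mul' _ _ ENNReal.ofReal_ne_top]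
  refine lintegral_congr_ae (ae_areaMeasure_of_forall 0 fun z hz _ => ?_)
  beta_reduce
  rw [iteratedDeriv_eq_powerSum hf.1 k hz, localWeight, Set.indicator_of_notMem (by simp [hζ]),
    Set.indicator_of_mem (by simpa using hζ), zero_add]
  ring

/-- Iterating `d_p = ζ^n d_{n+p}` exhibits `d_p` as the `n`-th term of a convergent series at `ζ`.
Inside the disc no decay of the coefficients is needed. -/
theorem IsQuot.unique_of_absConv {ζ : ℂ} (hζ : ‖ζ‖ < 1) {a g h : ℕ → ℂ} (hg : IsQuot ζ a g)
    (hh : IsQuot ζ a h) (hg1 : AbsConv g 1) (hh1 : AbsConv h 1) : g = h := by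
  have h1 : ∀ p n, g p - h p = ζ ^ n * (g (n + p) - h (n + p)) := fun p n => by
    induction n with
    | zero => simp
    | succ n ih =>
      rw [ih, pow_succ, show n + 1 + p = n + p + 1 by ring]
      linear_combination ζ ^ n * (hh (n + p) - hg (n + p))
  funext p
  have h2 : Filter.Tendsto (fun n => ζ ^ n * (g (n + p) - h (n + p))) Filter.atTop (nhds 0) := by
    have h3 := ((hg1.shift p).summable hζ).tendsto_atTop_zero.sub
      ((hh1.shift p).summable hζ).tendsto_atTop_zero
    rw [sub_zero] at h3
    exact h3.congr fun n => by ring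
  exact sub_eq_zero.1 (tendsto_nhds_unique (tendsto_const_nhds.congr fun n => h1 p n) h2)

/-- If the local Dirichlet integral at `ζ` is finite, then the quotient recurrence has a solution
of finite energy. -/
theorem exists_isQuot_of_localEnergy_ne_top {k : ℕ} (hk : 1 ≤ k) {f : ℂ → ℂ} (hf : f ∈ hol) {ζ : ℂ}
    (hζ : ‖ζ‖ ≤ 1) (hfin : localEnergy k f ζ ≠ ∞) :
    ∃ g, IsQuot ζ (taylorCoeff f) g ∧ quotEnergy k g ≠ ∞ := by
  have ha := absConv_taylorCoeff hf.1
  rcases hζ.lt_or_eq with h | h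
  · exact ⟨_, quotCoeff_isQuot ha h, by rwa [← localEnergy_eq_quotEnergy_of_lt hk hf h]⟩
  · obtain ⟨K, rfl⟩ := Nat.exists_eq_add_of_le' hk
    rw [localEnergy_eq_circleEnergy hf h] at hfin
    have h1 : circleEnergy (K + 1) ζ (taylorCoeff f) ≠ ∞ := fun h1 => by
      rw [h1, ENNReal.mul_top (ENNReal.ofReal_pos.2 (by positivity)).ne'] at hfin
      exact hfin rfl
    obtain ⟨g, hg, hE⟩ := circleEnergy_of_ne_top h ha h1
    refine ⟨g, hg, fun h2 => ?_⟩
    rw [h2, ENNReal.mul_top (ENNReal.ofReal_pos.2 (by positivity)).ne'] at hE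
    exact h1 hE

/-- The local Douglas formula. -/
theorem localEnergy_eq_quotEnergy {k : ℕ} (hk : 1 ≤ k) {f : ℂ → ℂ} (hf : f ∈ hol) {ζ : ℂ}
    (hζ : ‖ζ‖ ≤ 1) {g : ℕ → ℂ} (hg : IsQuot ζ (taylorCoeff f) g) (hfin : quotEnergy k g ≠ ∞) :
    localEnergy k f ζ = quotEnergy k g := by
  have ha := absConv_taylorCoeff hf.1
  rcases hζ.lt_or_eq with h | h
  · obtain ⟨C, hC⟩ := (tendsto_zero_of_quotEnergy_ne_top hfin).norm.bddAbove_range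
    have hg1 : AbsConv g 1 := absConv_of_bounded fun m => hC ⟨m, rfl⟩
    rw [localEnergy_eq_quotEnergy_of_lt hk hf h,
      hg.unique_of_absConv h (quotCoeff_isQuot ha h) hg1 (ha.quotCoeff h)]
  · obtain ⟨K, rfl⟩ := Nat.exists_eq_add_of_le' hk
    rw [localEnergy_eq_circleEnergy hf h, circleEnergy_of_isQuot h ha hg hfin, ← mul_assoc,
      ← ENNReal.ofReal_mul (by positivity), Nat.add_sub_cancel,
      one_div_mul_cancel (by positivity), ENNReal.ofReal_one, one_mul]

/-! ### Multiplication by the coordinate function -/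

/-- Multiplication by the coordinate function. -/
def coordMul (f : ℂ → ℂ) (z : ℂ) : ℂ := z * f z

/-- The sequence `c, g 0, g 1, …`. -/
def consSeq (c : ℂ) (g : ℕ → ℂ) (p : ℕ) : ℂ := if p = 0 then c else g (p - 1)

@[simp] theorem consSeq_zero (c : ℂ) (g : ℕ → ℂ) : consSeq c g 0 = c := rfl

@[simp] theorem consSeq_succ (c : ℂ) (g : ℕ → ℂ) (p : ℕ) : consSeq c g (p + 1) = g p := by
  simp [consSeq]

theorem coordMul_mem_hol {f : ℂ → ℂ} (hf : f ∈ hol) : coordMul f ∈ hol :=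
  ⟨differentiableOn_id.mul hf.1, fun z hz => by simp [coordMul, hf.2 z hz]⟩

theorem taylorCoeff_coordMul {f : ℂ → ℂ} (hf : f ∈ hol) :
    taylorCoeff (coordMul f) = consSeq 0 (taylorCoeff f) := by
  have ha := absConv_taylorCoeff hf.1
  have hc : AbsConv (consSeq 0 (taylorCoeff f)) 1 := AbsConv.of_shift (by simpa using ha)
  refine coeff_unique zero_lt_one (absConv_taylorCoeff (coordMul_mem_hol hf).1) hc fun z hz => ?_
  rw [powerSum_taylorCoeff (coordMul_mem_hol hf).1 hz, powerSum_eq_add_mul hc hz]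
  simp only [consSeq_zero, consSeq_succ, zero_add]
  change z * f z = z * powerSum (taylorCoeff f) z
  rw [powerSum_taylorCoeff hf.1 hz]

theorem hardyNormSq_coordMul {f : ℂ → ℂ} (hf : f ∈ hol) :
    hardyNormSq (coordMul f) = hardyNormSq f := by
  unfold hardyNormSq
  rw [taylorCoeff_coordMul hf, tsum_eq_zero_add' ENNReal.summable]
  simp

/-- The number `a 0 + ζ * g 0` plays the role of `f(ζ)`, also at boundary points, and the new
sequence is that of `f(ζ) + z g = (z f - ζ f(ζ)) / (z - ζ)`. -/
theorem IsQuot.consSeq {ζ : ℂ} {a g : ℕ → ℂ} (hg : IsQuot ζ a g) :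
    IsQuot ζ (consSeq 0 a) (consSeq (a 0 + ζ * g 0) g) := fun p => by
  cases p with
  | zero => simp
  | succ p => simpa using hg p

theorem quotEnergy_consSeq_one (c : ℂ) (g : ℕ → ℂ) :
    quotEnergy 1 (consSeq c g) = quotEnergy 1 g + ‖c‖ₑ ^ 2 := by
  unfold quotEnergy
  rw [tsum_eq_zero_add' ENNReal.summable]
  simp [add_comm]

/-- Pascal's rule for the weights; at these orders the new entry has weight zero, whereas at order
one it counts fully. -/
theorem quotEnergy_consSeq_succ (k : ℕ) (c : ℂ) (g : ℕ → ℂ) :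
    quotEnergy (k + 2) (consSeq c g) = quotEnergy (k + 2) g + quotEnergy (k + 1) g := by
  unfold quotEnergy
  rw [tsum_eq_zero_add' ENNReal.summable, ← ENNReal.tsum_add]
  simp only [Nat.add_sub_cancel, show k + 2 - 1 = k + 1 by omega, consSeq_succ]
  rw [Nat.choose_eq_zero_of_lt (Nat.succ_pos k), Nat.cast_zero, zero_mul, zero_add]
  refine tsum_congr fun p => ?_
  rw [Nat.choose_succ_succ' p k]
  push_cast
  ring

theorem enorm_sub_sq_le (x y : ℂ) : ‖x - y‖ₑ ^ 2 ≤ 2 * ‖x‖ₑ ^ 2 + 2 * ‖y‖ₑ ^ 2 := by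
  simp only [← ofReal_norm]
  rw [← ENNReal.ofReal_pow (norm_nonneg _), ← ENNReal.ofReal_pow (norm_nonneg _),
    ← ENNReal.ofReal_pow (norm_nonneg _), ← ENNReal.ofReal_ofNat 2,
    ← ENNReal.ofReal_mul (by positivity), ← ENNReal.ofReal_mul (by positivity),
    ← ENNReal.ofReal_add (by positivity) (by positivity)]
  refine ENNReal.ofReal_le_ofReal ?_
  have := norm_sub_le x y
  nlinarith [sq_nonneg (‖x‖ - ‖y‖), norm_nonneg (x - y)]

theorem enorm_add_mul_sq_le {ζ : ℂ} (hζ : ‖ζ‖ ≤ 1) (x y : ℂ) :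
    ‖x + ζ * y‖ₑ ^ 2 ≤ 2 * ‖x‖ₑ ^ 2 + 2 * ‖y‖ₑ ^ 2 := by
  have h := enorm_sub_sq_le x (-ζ * y)
  rw [enorm_mul, enorm_neg] at h
  have h1 : ‖ζ‖ₑ ≤ 1 := by rw [← ofReal_norm]; exact ENNReal.ofReal_le_one.2 hζ
  have h2 : ‖ζ‖ₑ * ‖y‖ₑ ≤ ‖y‖ₑ := mul_le_of_le_one_left' h1
  calc ‖x + ζ * y‖ₑ ^ 2 = ‖x - -ζ * y‖ₑ ^ 2 := by congr 2; ring
    _ ≤ _ := h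
    _ ≤ _ := by gcongr

/-- For `p > j` one has `(p choose j) ≤ (j + 1) (p choose j + 1)`; only the term `p = j` escapes. -/
theorem quotEnergy_succ_le (j : ℕ) (g : ℕ → ℂ) :
    quotEnergy (j + 1) g ≤ ‖g j‖ₑ ^ 2 + (j + 1) * quotEnergy (j + 2) g := by
  unfold quotEnergy
  simp only [Nat.add_sub_cancel, show j + 2 - 1 = j + 1 by omega]
  have h1 : ‖g j‖ₑ ^ 2 = ∑' p, if p = j then ‖g p‖ₑ ^ 2 else 0 := by rw [tsum_ite_eq]
  rw [h1, ← ENNReal.tsum_mul_left, ← ENNReal.tsum_add]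
  refine ENNReal.tsum_le_tsum fun p => ?_
  rcases lt_trichotomy p j with h | h | h
  · simp [Nat.choose_eq_zero_of_lt h]
  · subst h
    simp
  · refine le_add_left ?_
    rw [← mul_assoc]
    gcongr
    have h2 := Nat.choose_succ_right_eq p j
    have h3 : p.choose j ≤ (j + 1) * p.choose (j + 1) := by
      rw [mul_comm, h2]
      exact Nat.le_mul_of_pos_right _ (by omega)
    exact_mod_cast h3

/-- Controls the escaping term: the recurrence trades `g j` for `a (j + 1)` and `g (j + 1)`, and the
latter has weight one at order `j + 2`. -/
theorem IsQuot.enorm_sq_le {ζ : ℂ} (hζ : ‖ζ‖ ≤ 1) {a g : ℕ → ℂ} (hg : IsQuot ζ a g) (j : ℕ) :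
    ‖g j‖ₑ ^ 2 ≤ 2 * ∑' n, ‖a n‖ₑ ^ 2 + 2 * quotEnergy (j + 2) g := by
  have e : g j = a (j + 1) + ζ * g (j + 1) := by rw [hg j]; ring
  rw [e]
  refine (enorm_add_mul_sq_le hζ _ _).trans ?_
  have h1 : ‖a (j + 1)‖ₑ ^ 2 ≤ ∑' n, ‖a n‖ₑ ^ 2 := ENNReal.le_tsum (f := fun n => ‖a n‖ₑ ^ 2) (j + 1)
  have h2 : ‖g (j + 1)‖ₑ ^ 2 ≤ quotEnergy (j + 2) g := by
    have := ENNReal.le_tsum (f := fun p : ℕ => (p.choose (j + 2 - 1) : ℝ≥0∞) * ‖g p‖ₑ ^ 2) (j + 1)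
    simpa [quotEnergy] using this
  gcongr

theorem quotEnergy_consSeq_le {k : ℕ} (hk : 1 ≤ k) {ζ : ℂ} (hζ : ‖ζ‖ ≤ 1) {a g : ℕ → ℂ}
    (hg : IsQuot ζ a g) : quotEnergy k (consSeq (a 0 + ζ * g 0) g) ≤
      (k + 2) * quotEnergy k g + 2 * ∑' n, ‖a n‖ₑ ^ 2 := by
  obtain ⟨K, rfl⟩ := Nat.exists_eq_add_of_le' hk
  cases K with
  | zero =>
    rw [zero_add, quotEnergy_consSeq_one]
    have h1 := enorm_add_mul_sq_le hζ (a 0) (g 0)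
    have h2 : ‖a 0‖ₑ ^ 2 ≤ ∑' n, ‖a n‖ₑ ^ 2 := ENNReal.le_tsum (f := fun n => ‖a n‖ₑ ^ 2) 0
    have h3 : ‖g 0‖ₑ ^ 2 ≤ quotEnergy 1 g := by
      have := ENNReal.le_tsum (f := fun p : ℕ => (p.choose (1 - 1) : ℝ≥0∞) * ‖g p‖ₑ ^ 2) 0
      simpa [quotEnergy] using this
    calc quotEnergy 1 g + ‖a 0 + ζ * g 0‖ₑ ^ 2
        ≤ quotEnergy 1 g + (2 * (∑' n, ‖a n‖ₑ ^ 2) + 2 * quotEnergy 1 g) := by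
          gcongr
          exact h1.trans (by gcongr)
      _ = _ := by push_cast; ring
  | succ j =>
    rw [quotEnergy_consSeq_succ]
    calc quotEnergy (j + 2) g + quotEnergy (j + 1) g
        ≤ quotEnergy (j + 2) g + ((2 * ∑' n, ‖a n‖ₑ ^ 2 + 2 * quotEnergy (j + 2) g) +
          (j + 1) * quotEnergy (j + 2) g) := by
          gcongr
          exact (quotEnergy_succ_le j g).trans (by gcongr; exact hg.enorm_sq_le hζ j)
      _ = (j + 4) * quotEnergy (j + 2) g + 2 * ∑' n, ‖a n‖ₑ ^ 2 := by ring
      _ ≤ _ := by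
        push_cast
        gcongr ?_ * _ + _
        exact le_of_eq (by ring)

theorem localEnergy_coordMul_le {k : ℕ} (hk : 1 ≤ k) {f : ℂ → ℂ} (hf : f ∈ hol) {ζ : ℂ}
    (hζ : ‖ζ‖ ≤ 1) :
    localEnergy k (coordMul f) ζ ≤ (k + 2) * localEnergy k f ζ + 2 * hardyNormSq f := by
  by_cases htop : localEnergy k f ζ = ∞
  · rw [htop, ENNReal.mul_top (by simp)]
    simp
  obtain ⟨g, hg, hfin⟩ := exists_isQuot_of_localEnergy_ne_top hk hf hζ htop
  by_cases hH : hardyNormSq f = ∞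
  · rw [hH]; simp
  have h1 := quotEnergy_consSeq_le hk hζ hg
  have h2 := hg.consSeq
  rw [← taylorCoeff_coordMul hf] at h2
  rw [localEnergy_eq_quotEnergy hk hf hζ hg hfin,
    localEnergy_eq_quotEnergy hk (coordMul_mem_hol hf) hζ h2 (ne_top_of_le_ne_top ?_ h1)]
  · exact h1
  · refine ENNReal.add_ne_top.2 ⟨ENNReal.mul_ne_top ?_ hfin, ENNReal.mul_ne_top (by simp) hH⟩
    exact_mod_cast ENNReal.natCast_ne_top (k + 2)

/-- From index `k - 1` on the binomial weights are at least one, so `g` is square summable, and so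
is `a` by the recurrence. -/
theorem hardyNormSq_lt_top_of_localEnergy_ne_top {k : ℕ} (hk : 1 ≤ k) {f : ℂ → ℂ} (hf : f ∈ hol)
    {ζ : ℂ} (hζ : ‖ζ‖ ≤ 1) (h : localEnergy k f ζ ≠ ∞) : hardyNormSq f < ∞ := by
  obtain ⟨g, hg, hfin⟩ := exists_isQuot_of_localEnergy_ne_top hk hf hζ h
  have h1 : Summable fun p => ‖g p‖ ^ 2 := by
    have h2 := (summable_nat_add_iff (k - 1)).2 (summable_of_quotEnergy_ne_top hfin)
    rw [← summable_nat_add_iff (k - 1)]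
    refine Summable.of_nonneg_of_le (fun p => sq_nonneg _) (fun p => ?_) h2
    have : (1 : ℝ) ≤ (p + (k - 1)).choose (k - 1) := by
      exact_mod_cast Nat.choose_pos (Nat.le_add_left _ _)
    exact le_mul_of_one_le_left (sq_nonneg _) this
  rw [hardyNormSq_lt_top_iff, ← summable_nat_add_iff 1]
  refine Summable.of_nonneg_of_le (fun p => sq_nonneg _) (fun p => ?_)
    ((h1.mul_left 2).add (((summable_nat_add_iff 1).2 h1).mul_left 2))
  rw [hg p]
  have h3 := norm_sub_le (g p) (ζ * g (p + 1))
  have h4 : ‖ζ * g (p + 1)‖ ≤ ‖g (p + 1)‖ := by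
    rw [norm_mul]; exact mul_le_of_le_one_left (norm_nonneg _) hζ
  nlinarith [sq_nonneg (‖g p‖ - ‖g (p + 1)‖), norm_nonneg (g p - ζ * g (p + 1)),
    norm_nonneg (g p), norm_nonneg (g (p + 1))]

/-! ### Alternating sums of energies -/

/-- The alternating binomial sum `∑ (-1)^i (n choose i) v i`. -/
def altSum (n : ℕ) (v : ℕ → ℝ) : ℝ :=
  ∑ i ∈ Finset.range (n + 1), (-1) ^ i * (n.choose i : ℝ) * v i

theorem altSum_eq_fwdDiff (n : ℕ) (v : ℕ → ℝ) : altSum n v = (-1) ^ n * (fwdDiff 1)^[n] v 0 := by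
  rw [fwdDiff_iter_eq_sum_shift, Finset.mul_sum, altSum]
  refine Finset.sum_congr rfl fun i hi => ?_
  have hi' : i ≤ n := Nat.lt_succ_iff.1 (Finset.mem_range.1 hi)
  simp only [zero_add, smul_eq_mul, mul_one, zsmul_eq_mul]
  push_cast
  have : (-1 : ℝ) ^ n * (-1) ^ (n - i) = (-1) ^ i := by
    rw [← pow_add, show n + (n - i) = 2 * (n - i) + i by omega, pow_add, pow_mul]
    simp
  rw [← this]
  ring

theorem altSum_succ (n : ℕ) (v : ℕ → ℝ) :
    altSum (n + 1) v = altSum n (fun i => v i - v (i + 1)) := by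
  have h : (fun i => v i - v (i + 1)) = (-1 : ℝ) • fwdDiff 1 v := by
    funext i
    simp [fwdDiff]
  rw [altSum_eq_fwdDiff, Function.iterate_succ_apply, altSum_eq_fwdDiff, h,
    fwdDiff_iter_const_smul, pow_succ]
  simp

theorem altSum_const_mul (n : ℕ) (c : ℝ) (v : ℕ → ℝ) :
    altSum n (fun i => c * v i) = c * altSum n v := by
  unfold altSum
  rw [Finset.mul_sum]
  exact Finset.sum_congr rfl fun i _ => by ring

/-- An alternating sum is an iterated difference. Each of the first `k` differences lowers the level
by one with a sign; each of the remaining `n - k` acts at level zero as multiplication by `1 - x`.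
-/
theorem altSum_of_recursion {k : ℕ} {x : ℝ} {v : ℕ → ℕ → ℝ}
    (h0 : ∀ i, v 0 (i + 1) = x * v 0 i)
    (h1 : ∀ j < k, ∀ i, v (j + 1) (i + 1) = v (j + 1) i + v j i) {n : ℕ} (hn : k ≤ n) :
    altSum n (v k) = (-1) ^ k * (1 - x) ^ (n - k) * v 0 0 := by
  obtain ⟨m, rfl⟩ := Nat.exists_eq_add_of_le' hn
  rw [Nat.add_sub_cancel]
  clear hn
  induction k with
  | zero =>
    clear h1
    induction m with
    | zero => simp [altSum]
    | succ m ih =>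
      rw [add_zero] at ih ⊢
      rw [altSum_succ, show (fun i => v 0 i - v 0 (i + 1)) = fun i => (1 - x) * v 0 i by
        funext i; rw [h0]; ring, altSum_const_mul, ih]
      ring
  | succ k ih =>
    rw [← add_assoc, altSum_succ, show (fun i => v (k + 1) i - v (k + 1) (i + 1)) =
      fun i => (-1) * v k i by funext i; rw [h1 k k.lt_succ_self]; ring, altSum_const_mul,
      ih fun j hj => h1 j (hj.trans k.lt_succ_self)]
    ring

theorem coordMul_iterate_mem_hol {f : ℂ → ℂ} (hf : f ∈ hol) (i : ℕ) : coordMul^[i] f ∈ hol := by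
  induction i with
  | zero => exact hf
  | succ i ih => rw [Function.iterate_succ_apply']; exact coordMul_mem_hol ih

theorem hardyNormSq_coordMul_iterate {f : ℂ → ℂ} (hf : f ∈ hol) (i : ℕ) :
    hardyNormSq (coordMul^[i] f) = hardyNormSq f := by
  induction i with
  | zero => rfl
  | succ i ih =>
    rw [Function.iterate_succ_apply', hardyNormSq_coordMul (coordMul_iterate_mem_hol hf i), ih]

theorem localEnergy_coordMul_iterate_ne_top {k : ℕ} (hk : 1 ≤ k) {f : ℂ → ℂ} (hf : f ∈ hol) {ζ : ℂ}
    (hζ : ‖ζ‖ ≤ 1) (h : localEnergy k f ζ ≠ ∞) (i : ℕ) :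
    localEnergy k (coordMul^[i] f) ζ ≠ ∞ := by
  induction i with
  | zero => exact h
  | succ i ih =>
    rw [Function.iterate_succ_apply']
    have hi := coordMul_iterate_mem_hol hf i
    refine ne_top_of_le_ne_top ?_ (localEnergy_coordMul_le hk hi hζ)
    refine ENNReal.add_ne_top.2 ⟨ENNReal.mul_ne_top ?_ ih, ENNReal.mul_ne_top (by simp) ?_⟩
    · exact_mod_cast ENNReal.natCast_ne_top (k + 2)
    · exact (hardyNormSq_lt_top_of_localEnergy_ne_top hk hi hζ ih).ne

theorem quotEnergy_ne_top_of_le {j k : ℕ} (hj : 1 ≤ j) (hjk : j ≤ k) {g : ℕ → ℂ}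
    (h : quotEnergy k g ≠ ∞) : quotEnergy j g ≠ ∞ := by
  refine Nat.decreasingInduction' (P := fun j => quotEnergy j g ≠ ∞) (fun i _ hi ih => ?_) hjk h
  obtain ⟨i, rfl⟩ := Nat.exists_eq_add_of_le' (hj.trans hi)
  refine ne_top_of_le_ne_top ?_ (quotEnergy_succ_le i g)
  refine ENNReal.add_ne_top.2 ⟨by simp, ENNReal.mul_ne_top ?_ ih⟩
  exact_mod_cast ENNReal.natCast_ne_top (i + 1)

/-- The alternating sum of the local energies of `f, z f, z² f, …`. -/
theorem altSum_localEnergy {k : ℕ} (hk : 1 ≤ k) {f : ℂ → ℂ} (hf : f ∈ hol) {ζ : ℂ}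
    (hζ : ‖ζ‖ ≤ 1) {g : ℕ → ℂ} (hg : IsQuot ζ (taylorCoeff f) g) (hfin : quotEnergy k g ≠ ∞)
    {n : ℕ} (hn : k ≤ n) :
    altSum n (fun i => (localEnergy k (coordMul^[i] f) ζ).toReal) =
      (-1) ^ k * (1 - ‖ζ‖ ^ 2) ^ (n - k) * ‖taylorCoeff f 0 + ζ * g 0‖ ^ 2 := by
  have hloc : localEnergy k f ζ ≠ ∞ := by rwa [localEnergy_eq_quotEnergy hk hf hζ hg hfin]
  have hex : ∀ i, ∃ G, IsQuot ζ (taylorCoeff (coordMul^[i] f)) G ∧ quotEnergy k G ≠ ∞ := fun i =>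
    exists_isQuot_of_localEnergy_ne_top hk (coordMul_iterate_mem_hol hf i) hζ
      (localEnergy_coordMul_iterate_ne_top hk hf hζ hloc i)
  choose G hG hGfin using hex
  have hGt := fun i => tendsto_zero_of_quotEnergy_ne_top (hGfin i)
  have hG0 : G 0 = g := IsQuot.unique hζ (hG 0) hg (hGt 0) (tendsto_zero_of_quotEnergy_ne_top hfin)
  have hGs : ∀ i, G (i + 1) =
      consSeq (taylorCoeff (coordMul^[i] f) 0 + ζ * G i 0) (G i) := fun i => by
    have h1 := (hG i).consSeq
    rw [← taylorCoeff_coordMul (coordMul_iterate_mem_hol hf i),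
      ← Function.iterate_succ_apply' coordMul] at h1
    refine IsQuot.unique hζ (hG (i + 1)) h1 (hGt (i + 1)) ?_
    rw [← Filter.tendsto_add_atTop_iff_nat 1]
    simpa using hGt i
  have hc : ∀ i, taylorCoeff (coordMul^[i + 1] f) 0 = 0 := fun i => by
    rw [Function.iterate_succ_apply', taylorCoeff_coordMul (coordMul_iterate_mem_hol hf i),
      consSeq_zero]
  -- Level zero is `|(z^i f)(ζ)|²`, which scales by `|ζ|²`; the levels above are the quotient sums
  -- of order `j`.
  let v : ℕ → ℕ → ℝ := fun j i => if j = 0 then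
    ‖taylorCoeff (coordMul^[i] f) 0 + ζ * G i 0‖ ^ 2 else (quotEnergy j (G i)).toReal
  have hv : (fun i => (localEnergy k (coordMul^[i] f) ζ).toReal) = v k := by
    funext i
    rw [localEnergy_eq_quotEnergy hk (coordMul_iterate_mem_hol hf i) hζ (hG i) (hGfin i)]
    simp [v, show k ≠ 0 by omega]
  rw [hv, altSum_of_recursion (x := ‖ζ‖ ^ 2) ?_ ?_ hn]
  · simp [v, hG0]
  · intro i
    simp only [v, if_true]
    rw [hc, hGs, consSeq_zero, zero_add, norm_mul, mul_pow]
  · intro j hj i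
    cases j with
    | zero =>
      simp only [v, if_true, zero_add, one_ne_zero, if_false]
      rw [hGs, quotEnergy_consSeq_one, ENNReal.toReal_add
        (quotEnergy_ne_top_of_le le_rfl hk (hGfin i)) (by simp)]
      simp
    | succ j =>
      simp only [v, Nat.succ_ne_zero, if_false]
      rw [hGs, quotEnergy_consSeq_succ, ENNReal.toReal_add
        (quotEnergy_ne_top_of_le (by omega) hj (hGfin i))
        (quotEnergy_ne_top_of_le (by omega) hj.le (hGfin i))]

theorem ae_norm_le_one {μ : Measure ℂ} (hμ : μ (closedBall (0 : ℂ) 1)ᶜ = 0) :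
    ∀ᵐ ζ ∂μ, ‖ζ‖ ≤ 1 := by
  filter_upwards [compl_mem_ae_iff.2 hμ] with ζ hζ
  simpa using hζ

theorem dirichletIntegral_coordMul_le {μ : Measure ℂ} [IsFiniteMeasure μ]
    (hμ : μ (closedBall (0 : ℂ) 1)ᶜ = 0) {k : ℕ} (hk : 1 ≤ k) {f : ℂ → ℂ} (hf : f ∈ hol) :
    dirichletIntegral μ k (coordMul f) ≤
      (k + 2) * dirichletIntegral μ k f + 2 * μ Set.univ * hardyNormSq f := by
  rw [dirichletIntegral_eq_lintegral_localEnergy μ k hf,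
    dirichletIntegral_eq_lintegral_localEnergy μ k (coordMul_mem_hol hf)]
  calc _ ≤ ∫⁻ ζ, ((k + 2) * localEnergy k f ζ + 2 * hardyNormSq f) ∂μ := by
        refine lintegral_mono_ae ?_
        filter_upwards [ae_norm_le_one hμ] with ζ hζ using localEnergy_coordMul_le hk hf hζ
    _ = _ := by
        rw [lintegral_add_right _ measurable_const,
          lintegral_const_mul _ (measurable_localEnergy hf k), lintegral_const]
        ring

/-- If the average is finite and `μ ≠ 0`, the local integral is finite at some point of the closed
disc, and one point suffices. -/
theorem finiteDirichlet_le_hardySpace {μ : Measure ℂ} [IsFiniteMeasure μ]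
    (hμ : μ (closedBall (0 : ℂ) 1)ᶜ = 0) {k : ℕ} (hk : 1 ≤ k) (h0 : μ ≠ 0) :
    finiteDirichlet μ k ≤ hardySpace := fun f hf => by
  refine ⟨hf.1, ?_⟩
  have h1 := hf.2
  rw [dirichletIntegral_eq_lintegral_localEnergy μ k hf.1] at h1
  have h2 := ae_lt_top (measurable_localEnergy hf.1 k) h1.ne
  have : NeZero μ := ⟨h0⟩
  obtain ⟨ζ, hζ, hζ'⟩ := (h2.and (ae_norm_le_one hμ)).exists
  exact hardyNormSq_lt_top_of_localEnergy_ne_top hk hf.1 hζ' hζ.ne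

section

variable {μ : Measure ℂ} [IsFiniteMeasure μ] {k : ℕ} {f : ℂ → ℂ}

theorem dirichletIntegral_coordMul_iterate_lt_top (hμ : μ (closedBall (0 : ℂ) 1)ᶜ = 0)
    (hk : 1 ≤ k) (hf : f ∈ hol) (hH : hardyNormSq f < ∞) (hD : dirichletIntegral μ k f < ∞)
    (i : ℕ) : dirichletIntegral μ k (coordMul^[i] f) < ∞ := by
  induction i with
  | zero => exact hD
  | succ i ih =>
    rw [Function.iterate_succ_apply']
    have hi := coordMul_iterate_mem_hol hf i
    refine (dirichletIntegral_coordMul_le hμ hk hi).trans_lt ?_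
    rw [hardyNormSq_coordMul_iterate hf]
    refine ENNReal.add_lt_top.2 ⟨ENNReal.mul_lt_top ?_ ih, ENNReal.mul_lt_top ?_ hH⟩
    · exact_mod_cast ENNReal.natCast_lt_top (k + 2)
    · exact ENNReal.mul_lt_top (by simp) (measure_lt_top _ _)

theorem altSum_dirichletIntegral (hμ : μ (closedBall (0 : ℂ) 1)ᶜ = 0)
    (hk : 1 ≤ k) (hf : f ∈ hol) (hH : hardyNormSq f < ∞) (hD : dirichletIntegral μ k f < ∞)
    (n : ℕ) : altSum n (fun i => (dirichletIntegral μ k (coordMul^[i] f)).toReal) =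
      ∫ ζ, altSum n (fun i => (localEnergy k (coordMul^[i] f) ζ).toReal) ∂μ := by
  have h := dirichletIntegral_coordMul_iterate_lt_top hμ hk hf hH hD
  have hi := coordMul_iterate_mem_hol hf
  simp only [fun i => dirichletIntegral_eq_lintegral_localEnergy μ k (hi i)] at h ⊢
  have hm := fun i => measurable_localEnergy (hi i) k
  unfold altSum
  rw [integral_finsetSum]
  · refine Finset.sum_congr rfl fun i _ => ?_
    rw [integral_const_mul, integral_toReal (hm i).aemeasurable (ae_lt_top (hm i) (h i).ne)]
  · intro i _
    exact (integrable_toReal_of_lintegral_ne_top (hm i).aemeasurable (h i).ne).const_mul _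

theorem ae_altSum_localEnergy (hμ : μ (closedBall (0 : ℂ) 1)ᶜ = 0) (hk : 1 ≤ k) (hf : f ∈ hol)
    (hD : dirichletIntegral μ k f < ∞) {n : ℕ} (hn : k ≤ n) :
    ∀ᵐ ζ ∂μ, ‖ζ‖ ≤ 1 ∧ ∃ c : ℂ, altSum n (fun i => (localEnergy k (coordMul^[i] f) ζ).toReal) =
      (-1) ^ k * (1 - ‖ζ‖ ^ 2) ^ (n - k) * ‖c‖ ^ 2 := by
  rw [dirichletIntegral_eq_lintegral_localEnergy μ k hf] at hD
  filter_upwards [ae_norm_le_one hμ, ae_lt_top (measurable_localEnergy hf k) hD.ne] with ζ hζ h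
  obtain ⟨g, hg, hfin⟩ := exists_isQuot_of_localEnergy_ne_top hk hf hζ h.ne
  exact ⟨hζ, _, altSum_localEnergy hk hf hζ hg hfin hn⟩

theorem altSum_dirichletIntegral_nonneg (hμ : μ (closedBall (0 : ℂ) 1)ᶜ = 0)
    (hk : 1 ≤ k) (hf : f ∈ hol) (hH : hardyNormSq f < ∞) (hD : dirichletIntegral μ k f < ∞)
    {n : ℕ} (hn : k ≤ n) :
    0 ≤ (-1) ^ k * altSum n (fun i => (dirichletIntegral μ k (coordMul^[i] f)).toReal) := by
  rw [altSum_dirichletIntegral hμ hk hf hH hD, ← integral_const_mul]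
  refine integral_nonneg_of_ae ?_
  filter_upwards [ae_altSum_localEnergy hμ hk hf hD hn] with ζ hζ
  obtain ⟨hζ, c, hc⟩ := hζ
  rw [hc, ← mul_assoc, ← mul_assoc, ← mul_pow]
  have : 0 ≤ 1 - ‖ζ‖ ^ 2 := by nlinarith [norm_nonneg ζ]
  simp only [mul_neg, mul_one, neg_neg, one_pow, one_mul, Pi.zero_apply]
  positivity

theorem altSum_dirichletIntegral_eq_zero (hμ : μ (sphere (0 : ℂ) 1)ᶜ = 0)
    (hk : 1 ≤ k) (hf : f ∈ hol) (hH : hardyNormSq f < ∞) (hD : dirichletIntegral μ k f < ∞) :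
    altSum (k + 1) (fun i => (dirichletIntegral μ k (coordMul^[i] f)).toReal) = 0 := by
  have hμ' : μ (closedBall (0 : ℂ) 1)ᶜ = 0 :=
    measure_mono_null (Set.compl_subset_compl.2 sphere_subset_closedBall) hμ
  rw [altSum_dirichletIntegral hμ' hk hf hH hD]
  refine integral_eq_zero_of_ae ?_
  filter_upwards [ae_altSum_localEnergy hμ' hk hf hD k.le_succ, compl_mem_ae_iff.2 hμ] with ζ h1 h2
  obtain ⟨-, c, hc⟩ := h1
  have h3 : ‖ζ‖ = 1 := by simpa using h2
  rw [hc]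
  simp [h3]

end

/-! ### The constant function and the support of the measure -/

/-- The constant function `1` on the unit disc. -/
def discOne : ℂ → ℂ := (ball 0 1).indicator 1

theorem discOne_mem_hol : discOne ∈ hol := by
  refine ⟨(differentiableOn_const 1).congr fun z hz => ?_, fun z hz => ?_⟩
  · simp only [discOne, Set.indicator_of_mem hz, Pi.one_apply]
  · simp only [discOne, Set.indicator_of_notMem hz]

theorem taylorCoeff_discOne : taylorCoeff discOne = fun n => if n = 0 then 1 else 0 := by
  have hb : AbsConv (fun n => if n = 0 then (1 : ℂ) else 0) 1 :=
    absConv_of_bounded (C := 1) fun n => by split_ifs <;> simp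
  refine coeff_unique zero_lt_one (absConv_taylorCoeff discOne_mem_hol.1) hb fun z hz => ?_
  rw [powerSum_taylorCoeff discOne_mem_hol.1 hz, discOne, Set.indicator_of_mem (by simpa using hz),
    powerSum, tsum_eq_single 0 (by simp +contextual)]
  simp

theorem hardyNormSq_discOne_lt_top : hardyNormSq discOne < ∞ := by
  rw [hardyNormSq, taylorCoeff_discOne, tsum_eq_single 0 (by simp +contextual)]
  simp

theorem isQuot_discOne (ζ : ℂ) : IsQuot ζ (taylorCoeff discOne) 0 := fun p => by
  simp [taylorCoeff_discOne]

theorem quotEnergy_zero (k : ℕ) : quotEnergy k 0 = 0 := by simp [quotEnergy]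

theorem dirichletIntegral_discOne {μ : Measure ℂ} [IsFiniteMeasure μ]
    (hμ : μ (closedBall (0 : ℂ) 1)ᶜ = 0) {k : ℕ} (hk : 1 ≤ k) :
    dirichletIntegral μ k discOne = 0 := by
  rw [dirichletIntegral_eq_lintegral_localEnergy μ k discOne_mem_hol, lintegral_eq_zero_iff
    (measurable_localEnergy discOne_mem_hol k)]
  filter_upwards [ae_norm_le_one hμ] with ζ hζ
  rw [localEnergy_eq_quotEnergy hk discOne_mem_hol hζ (isQuot_discOne ζ)] <;>
  simp [quotEnergy_zero]

/-- For `f = 1` the quotient is zero and `f(ζ) = 1`, so the alternating sum is `±∫ (1 - |ζ|²) dμ`,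
with a nonnegative integrand on the closed disc. -/
theorem measure_compl_sphere_eq_zero {μ : Measure ℂ} [IsFiniteMeasure μ]
    (hμ : μ (closedBall (0 : ℂ) 1)ᶜ = 0) {k : ℕ} (hk : 1 ≤ k)
    (h : altSum (k + 1) (fun i => (dirichletIntegral μ k (coordMul^[i] discOne)).toReal) = 0) :
    μ (sphere (0 : ℂ) 1)ᶜ = 0 := by
  rw [altSum_dirichletIntegral hμ hk discOne_mem_hol hardyNormSq_discOne_lt_top
    (by simp [dirichletIntegral_discOne hμ hk])] at h
  have h1 : ∫ ζ, (-1) ^ k * (1 - ‖ζ‖ ^ 2) ∂μ = 0 := by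
    rw [← h]
    refine integral_congr_ae ?_
    filter_upwards [ae_norm_le_one hμ] with ζ hζ
    rw [altSum_localEnergy hk discOne_mem_hol hζ (isQuot_discOne ζ) (by simp [quotEnergy_zero])
      k.le_succ]
    simp [taylorCoeff_discOne]
  rw [integral_const_mul] at h1
  have h2 : ∫ ζ, (1 - ‖ζ‖ ^ 2) ∂μ = 0 := by simpa using h1
  have h3 : 0 ≤ᵐ[μ] fun ζ => 1 - ‖ζ‖ ^ 2 := by
    filter_upwards [ae_norm_le_one hμ] with ζ hζ
    have : 0 ≤ 1 - ‖ζ‖ ^ 2 := by nlinarith [norm_nonneg ζ]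
    exact this
  have h4 : Integrable (fun ζ : ℂ => 1 - ‖ζ‖ ^ 2) μ := by
    refine Integrable.of_bound (by fun_prop) 1 ?_
    filter_upwards [ae_norm_le_one hμ] with ζ hζ
    rw [Real.norm_eq_abs, abs_le]
    constructor <;> nlinarith [norm_nonneg ζ]
  rw [integral_eq_zero_iff_of_nonneg_ae h3 h4] at h2
  refine measure_mono_null (fun ζ hζ => ?_) h2
  intro h5
  apply hζ
  have h6 : 1 - ‖ζ‖ ^ 2 = 0 := h5
  have : ‖ζ‖ = 1 := by nlinarith [norm_nonneg ζ]
  simpa using this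

/-! ### Completeness of the space and boundedness of the multiplication operator -/

theorem taylorCoeff_sub {f g : ℂ → ℂ} (hf : f ∈ hol) (hg : g ∈ hol) (n : ℕ) :
    taylorCoeff (f - g) n = taylorCoeff f n - taylorCoeff g n := by
  rw [sub_eq_add_neg, ← neg_one_smul ℂ g, taylorCoeff_add hf (hol.smul_mem _ hg), taylorCoeff_smul]
  ring

theorem powerSum_indicator_mem_hol {a : ℕ → ℂ} (ha : AbsConv a 1) :
    (ball (0 : ℂ) 1).indicator (powerSum a) ∈ hol :=
  ⟨ha.differentiableOn.congr fun _ hz => Set.indicator_of_mem hz _,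
    fun _ hz => Set.indicator_of_notMem hz _⟩

theorem taylorCoeff_powerSum_indicator {a : ℕ → ℂ} (ha : AbsConv a 1) (n : ℕ) :
    taylorCoeff ((ball (0 : ℂ) 1).indicator (powerSum a)) n = a n := by
  rw [← ha.taylorCoeff zero_lt_one n]
  refine taylorCoeff_congr ?_ n
  filter_upwards [isOpen_ball.mem_nhds (mem_ball_self zero_lt_one)] with z hz
  exact Set.indicator_of_mem hz _

/-- Convergence of derivatives under bounded convergence of the Taylor coefficients. -/
theorem tendsto_iteratedDeriv {v : ℕ → ℂ → ℂ} (hv : ∀ i, v i ∈ hol) {F : ℂ → ℂ} (hF : F ∈ hol)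
    {C : ℝ} (hC : ∀ᶠ i in Filter.atTop, ∀ n, ‖taylorCoeff (v i) n‖ ≤ C)
    (h : ∀ n, Filter.Tendsto (fun i => taylorCoeff (v i) n) Filter.atTop (nhds (taylorCoeff F n)))
    (k : ℕ) {z : ℂ} (hz : ‖z‖ < 1) :
    Filter.Tendsto (fun i => iteratedDeriv k (v i) z) Filter.atTop
      (nhds (iteratedDeriv k F z)) := by
  rw [iteratedDeriv_eq_powerSum hF.1 k hz]
  simp only [fun i => iteratedDeriv_eq_powerSum (hv i).1 k hz]
  have hb : AbsConv (fun _ => (C : ℂ)) 1 := absConv_of_bounded fun _ => le_rfl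
  refine tendsto_tsum_of_dominated_convergence ((hb.derivCoeff k) ‖z‖ (norm_nonneg z) hz) ?_ ?_
  · intro m
    exact ((h (m + k)).const_mul _).mul_const _
  · filter_upwards [hC] with i hi m
    rw [norm_mul, norm_pow, derivCoeff, derivCoeff, norm_mul, norm_mul]
    gcongr
    simpa using (hi (m + k)).trans (le_abs_self C)

namespace DirichletSpace

variable {μ : Measure ℂ} [IsFiniteMeasure μ] {k : ℕ}

theorem toFun_sub (f g : DirichletSpace μ k) : (f - g).toFun = f.toFun - g.toFun := rfl

theorem hardyNormSq_le (f : DirichletSpace μ k) :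
    hardyNormSq f.toFun ≤ ENNReal.ofReal (‖f‖ ^ 2) := by
  rw [norm_sq_eq]; exact le_self_add

theorem dirichletIntegral_le (f : DirichletSpace μ k) :
    dirichletIntegral μ k f.toFun ≤ ENNReal.ofReal (‖f‖ ^ 2) := by
  rw [norm_sq_eq]; exact le_add_self

theorem norm_taylorCoeff_le (f : DirichletSpace μ k) (n : ℕ) :
    ‖taylorCoeff f.toFun n‖ ≤ ‖f‖ := by
  have h1 := (ENNReal.le_tsum (f := fun n => ‖taylorCoeff f.toFun n‖ₑ ^ 2) n).trans f.hardyNormSq_le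
  rw [← ofReal_norm, ← ENNReal.ofReal_pow (norm_nonneg _),
    ENNReal.ofReal_le_ofReal_iff (sq_nonneg _)] at h1
  exact le_of_sq_le_sq h1 (norm_nonneg _)

/-- Lower semicontinuity of both parts of the norm. -/
theorem le_of_tendsto_taylorCoeff {v : ℕ → DirichletSpace μ k} {F : ℂ → ℂ} (hF : F ∈ hol)
    (h : ∀ n, Filter.Tendsto (fun i => taylorCoeff (v i).toFun n) Filter.atTop
      (nhds (taylorCoeff F n))) {C : ℝ} (hC : ∀ᶠ i in Filter.atTop, ‖v i‖ ≤ C) :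
    hardyNormSq F ≤ ENNReal.ofReal (C ^ 2) ∧ dirichletIntegral μ k F ≤ ENNReal.ofReal (C ^ 2) := by
  have hC2 : ∀ᶠ i in Filter.atTop, ENNReal.ofReal (‖v i‖ ^ 2) ≤ ENNReal.ofReal (C ^ 2) := by
    filter_upwards [hC] with i hi
    gcongr
  constructor
  · refine ENNReal.tsum_le_of_sum_range_le fun n => ?_
    refine le_of_tendsto (tendsto_finsetSum _ fun m _ => ENNReal.Tendsto.pow (h m).enorm) ?_
    filter_upwards [hC2] with i hi
    exact (ENNReal.sum_le_tsum _).trans ((v i).hardyNormSq_le.trans hi)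
  -- The derivatives converge pointwise on the disc, so Fatou's lemma applies to the Dirichlet part.
  · have h1 : ∀ᵐ z ∂weightedArea μ k, ‖iteratedDeriv k F z‖ₑ ^ 2 =
        Filter.liminf (fun i => ‖iteratedDeriv k (v i).toFun z‖ₑ ^ 2) Filter.atTop := by
      refine (withDensity_absolutelyContinuous _ _).ae_le
        (ae_areaMeasure_of_forall 0 fun z hz _ => ?_)
      refine (Filter.Tendsto.liminf_eq (ENNReal.Tendsto.pow (Filter.Tendsto.enorm ?_))).symm
      refine tendsto_iteratedDeriv (fun i => (v i).mem_hol) hF (C := C) ?_ h k hz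
      filter_upwards [hC] with i hi n using ((v i).norm_taylorCoeff_le n).trans hi
    rw [dirichletIntegral_eq μ k hF, lintegral_congr_ae h1]
    refine (lintegral_liminf_le' fun i =>
      ((aestronglyMeasurable_iteratedDeriv (v i).mem_hol μ k).enorm.pow_const 2)).trans ?_
    refine Filter.liminf_le_of_frequently_le' (Filter.Eventually.frequently ?_)
    filter_upwards [hC2] with i hi
    rw [← dirichletIntegral_eq μ k (v i).mem_hol]
    exact (v i).dirichletIntegral_le.trans hi

/-- The Taylor coefficients of a Cauchy sequence converge, with a bounded limit sequence. Lower
semicontinuity puts the resulting function in the space and, applied to the differences `u i - u n`,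
gives convergence in norm. -/
instance : CompleteSpace (DirichletSpace μ k) := by
  refine Metric.complete_of_cauchySeq_tendsto fun u hu => ?_
  have h1 : ∀ n, CauchySeq fun i => taylorCoeff (u i).toFun n := fun n => by
    rw [Metric.cauchySeq_iff'] at hu ⊢
    intro ε hε
    obtain ⟨N, hN⟩ := hu ε hε
    refine ⟨N, fun i hi => ?_⟩
    rw [dist_eq_norm, ← taylorCoeff_sub (u i).mem_hol (u N).mem_hol, ← toFun_sub]
    refine (norm_taylorCoeff_le _ n).trans_lt ?_
    rw [← dist_eq_norm]
    exact hN i hi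
  choose a ha using fun n => cauchySeq_tendsto_of_complete (h1 n)
  obtain ⟨C, hC⟩ := hu.norm_bddAbove
  have hC' : ∀ i, ‖u i‖ ≤ C := fun i => hC ⟨i, rfl⟩
  have hac : AbsConv a 1 := absConv_of_bounded (C := C) fun n =>
    le_of_tendsto (ha n).norm (Filter.Eventually.of_forall fun i =>
      ((u i).norm_taylorCoeff_le n).trans (hC' i))
  have hF := powerSum_indicator_mem_hol hac
  have hFa := taylorCoeff_powerSum_indicator hac
  set F := (ball (0 : ℂ) 1).indicator (powerSum a)
  have h2 := le_of_tendsto_taylorCoeff hF (v := u) (fun n => by rw [hFa]; exact ha n)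
    (Filter.Eventually.of_forall hC')
  let G : DirichletSpace μ k := ⟨F, ⟨hF, h2.1.trans_lt ENNReal.ofReal_lt_top⟩,
    ⟨hF, h2.2.trans_lt ENNReal.ofReal_lt_top⟩⟩
  refine ⟨G, Metric.tendsto_atTop.2 fun ε hε => ?_⟩
  obtain ⟨N, hN⟩ := Metric.cauchySeq_iff.1 hu (ε / 2) (by positivity)
  refine ⟨N, fun n hn => ?_⟩
  -- Both parts of the norm are at most `(ε/2)²`, so the squared distance is at most `ε²/2 < ε²`.
  have h3 := le_of_tendsto_taylorCoeff (v := fun i => u i - u n) (C := ε / 2) (G - u n).mem_hol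
    (fun m => by
      rw [toFun_sub, taylorCoeff_sub G.mem_hol (u n).mem_hol]
      simp only [fun i => (toFun_sub (u i) (u n)),
        fun i => taylorCoeff_sub (u i).mem_hol (u n).mem_hol]
      refine Filter.Tendsto.sub_const ?_ _
      rw [show taylorCoeff G.toFun m = a m from hFa m]
      exact ha m)
    (by
      filter_upwards [Filter.eventually_ge_atTop N] with i hi
      rw [← dist_eq_norm]
      exact (hN i hi n hn).le)
  have h4 : ENNReal.ofReal (‖G - u n‖ ^ 2) ≤ ENNReal.ofReal ((ε / 2) ^ 2 + (ε / 2) ^ 2) := by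
    rw [norm_sq_eq, ENNReal.ofReal_add (sq_nonneg _) (sq_nonneg _)]
    exact add_le_add h3.1 h3.2
  rw [ENNReal.ofReal_le_ofReal_iff (by positivity)] at h4
  rw [dist_comm, dist_eq_norm]
  refine lt_of_pow_lt_pow_left₀ 2 hε.le ?_
  nlinarith

/-- Multiplication by the coordinate function on `𝒟_{μ,k}`, as a linear map. -/
def coordMulLinear (hμ : μ (closedBall (0 : ℂ) 1)ᶜ = 0) (hk : 1 ≤ k) :
    DirichletSpace μ k →ₗ[ℂ] DirichletSpace μ k where
  toFun f := ⟨coordMul f.toFun,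
    ⟨coordMul_mem_hol f.mem_hol, (hardyNormSq_coordMul f.mem_hol).trans_lt f.2.1.2⟩,
    ⟨coordMul_mem_hol f.mem_hol,
      dirichletIntegral_coordMul_iterate_lt_top hμ hk f.mem_hol f.2.1.2 f.2.2.2 1⟩⟩
  map_add' f g := Subtype.ext (funext fun z => mul_add z (f.toFun z) (g.toFun z))
  map_smul' c f := Subtype.ext (funext fun z => mul_left_comm z c (f.toFun z))

theorem norm_coordMulLinear_le (hμ : μ (closedBall (0 : ℂ) 1)ᶜ = 0) (hk : 1 ≤ k)
    (f : DirichletSpace μ k) :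
    ‖coordMulLinear hμ hk f‖ ≤ √(k + 3 + 2 * μ.real Set.univ) * ‖f‖ := by
  have h1 : ENNReal.ofReal (‖coordMulLinear hμ hk f‖ ^ 2) ≤
      ENNReal.ofReal ((k + 3 + 2 * μ.real Set.univ) * ‖f‖ ^ 2) := by
    rw [ENNReal.ofReal_mul (by positivity), norm_sq_eq, norm_sq_eq]
    have e : ENNReal.ofReal (k + 3 + 2 * μ.real Set.univ) = k + 3 + 2 * μ Set.univ := by
      rw [ENNReal.ofReal_add (by positivity) (by positivity), ENNReal.ofReal_mul (by positivity),
        ofReal_measureReal, ENNReal.ofReal_add (by positivity) (by positivity)]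
      simp
    rw [e]
    change hardyNormSq (coordMul f.toFun) + dirichletIntegral μ k (coordMul f.toFun) ≤ _
    rw [hardyNormSq_coordMul f.mem_hol]
    set x := hardyNormSq f.toFun
    set y := dirichletIntegral μ k f.toFun
    set m := μ Set.univ
    calc x + dirichletIntegral μ k (coordMul f.toFun) ≤ x + ((k + 2) * y + 2 * m * x) :=
          add_le_add le_rfl (dirichletIntegral_coordMul_le hμ hk f.mem_hol)
      -- Padding makes the bound a multiple of `x + y`, with constant `k + 3 + 2m`.
      _ ≤ x + ((k + 2) * y + 2 * m * x) + ((k + 2) * x + (1 + 2 * m) * y) := le_self_add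
      _ = _ := by ring
  rw [ENNReal.ofReal_le_ofReal_iff (by positivity)] at h1
  refine le_of_sq_le_sq ?_ (by positivity)
  rwa [mul_pow, Real.sq_sqrt (by positivity)]

/-- Multiplication by the coordinate function on `𝒟_{μ,k}`. -/
def coordMulCLM (hμ : μ (closedBall (0 : ℂ) 1)ᶜ = 0) (hk : 1 ≤ k) :
    DirichletSpace μ k →L[ℂ] DirichletSpace μ k :=
  (coordMulLinear hμ hk).mkContinuous _ (norm_coordMulLinear_le hμ hk)

theorem toFun_coordMulCLM (hμ : μ (closedBall (0 : ℂ) 1)ᶜ = 0) (hk : 1 ≤ k)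
    (f : DirichletSpace μ k) : (coordMulCLM hμ hk f).toFun = coordMul f.toFun := rfl

theorem toFun_coordMulCLM_pow (hμ : μ (closedBall (0 : ℂ) 1)ᶜ = 0) (hk : 1 ≤ k)
    (f : DirichletSpace μ k) (j : ℕ) :
    ((coordMulCLM hμ hk ^ j) f).toFun = coordMul^[j] f.toFun := by
  induction j with
  | zero => rfl
  | succ j ih =>
    rw [pow_succ', mul_apply_eq_comp, toFun_coordMulCLM, ih,
      Function.iterate_succ_apply']

theorem norm_sq_coordMulCLM_pow (hμ : μ (closedBall (0 : ℂ) 1)ᶜ = 0) (hk : 1 ≤ k)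
    (f : DirichletSpace μ k) (j : ℕ) : ‖(coordMulCLM hμ hk ^ j) f‖ ^ 2 =
      (hardyNormSq f.toFun).toReal + (dirichletIntegral μ k (coordMul^[j] f.toFun)).toReal := by
  have h := norm_sq_eq ((coordMulCLM hμ hk ^ j) f)
  rw [toFun_coordMulCLM_pow, hardyNormSq_coordMul_iterate f.mem_hol] at h
  have hH : hardyNormSq f.toFun < ∞ := f.2.1.2
  rw [← ENNReal.toReal_add hH.ne (dirichletIntegral_coordMul_iterate_lt_top hμ hk f.mem_hol
    hH f.2.2.2 j).ne, ← h, ENNReal.toReal_ofReal (sq_nonneg _)]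

end DirichletSpace

/-! ### Backward differences of the multiplication operator -/

theorem altSum_add (n : ℕ) (v w : ℕ → ℝ) :
    altSum n (fun i => v i + w i) = altSum n v + altSum n w := by
  simp only [altSum, mul_add, Finset.sum_add_distrib]

theorem altSum_const {n : ℕ} (hn : 1 ≤ n) (c : ℝ) : altSum n (fun _ => c) = 0 := by
  obtain ⟨m, rfl⟩ := Nat.exists_eq_add_of_le' hn
  rw [altSum_succ]
  simp [altSum]

theorem inner_backwardDiff {H : Type*} [NormedAddCommGroup H] [InnerProductSpace ℂ H]
    [CompleteSpace H] (n : ℕ) (T : H →L[ℂ] H) (x : H) :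
    inner ℂ (backwardDiff n T x) x = (altSum n (fun j => ‖(T ^ j) x‖ ^ 2) : ℂ) := by
  rw [backwardDiff, altSum, sum_apply, sum_inner, Complex.ofReal_sum]
  refine Finset.sum_congr rfl fun j _ => ?_
  rw [smul_apply, inner_smul_left, mul_apply_eq_comp,
    ← ContinuousLinearMap.star_eq_adjoint, ← star_pow, ContinuousLinearMap.star_eq_adjoint,
    ContinuousLinearMap.adjoint_inner_left, inner_self_eq_norm_sq_to_K]
  simp only [map_mul, map_pow, map_neg, map_one, Complex.conj_natCast]
  push_cast
  rfl

/-- The Hardy part of `‖z^i f‖²` does not depend on `i`, so any difference of order at least one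
removes it. -/
theorem inner_backwardDiff_coordMulCLM {μ : Measure ℂ} [IsFiniteMeasure μ] {k : ℕ}
    (hμ : μ (closedBall (0 : ℂ) 1)ᶜ = 0) (hk : 1 ≤ k) {n : ℕ} (hn : 1 ≤ n)
    (f : DirichletSpace μ k) :
    inner ℂ (backwardDiff n (DirichletSpace.coordMulCLM hμ hk) f) f =
      (altSum n (fun i => (dirichletIntegral μ k (coordMul^[i] f.toFun)).toReal) : ℂ) := by
  rw [inner_backwardDiff]
  simp only [DirichletSpace.norm_sq_coordMulCLM_pow]
  rw [altSum_add, altSum_const hn, zero_add]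

theorem isDirichletType_coordMulCLM {μ : Measure ℂ} [IsFiniteMeasure μ] {k : ℕ}
    (hμ : μ (closedBall (0 : ℂ) 1)ᶜ = 0) (hk : 1 ≤ k) :
    IsDirichletType k (DirichletSpace.coordMulCLM hμ hk) := fun n hn => by
  rw [ContinuousLinearMap.nonneg_iff_isPositive, ContinuousLinearMap.isPositive_iff_complex]
  intro f
  rw [smul_apply, inner_smul_left,
    inner_backwardDiff_coordMulCLM hμ hk (hk.trans hn)]
  have h := altSum_dirichletIntegral_nonneg hμ hk f.mem_hol f.2.1.2 f.2.2.2 hn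
  have e : (starRingEnd ℂ) ((-1 : ℂ) ^ k) = (((-1) ^ k : ℝ) : ℂ) := by simp
  rw [e, ← Complex.ofReal_mul]
  exact ⟨by rw [RCLike.re_to_complex, Complex.ofReal_re], h⟩

theorem isMIsometry_coordMulCLM_iff {μ : Measure ℂ} [IsFiniteMeasure μ] {k : ℕ}
    (hμ : μ (closedBall (0 : ℂ) 1)ᶜ = 0) (hk : 1 ≤ k) :
    IsMIsometry (k + 1) (DirichletSpace.coordMulCLM hμ hk) ↔ μ (sphere (0 : ℂ) 1)ᶜ = 0 := by
  constructor
  · intro h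
    let one : DirichletSpace μ k := ⟨discOne, ⟨discOne_mem_hol, hardyNormSq_discOne_lt_top⟩,
      ⟨discOne_mem_hol, by simp [dirichletIntegral_discOne hμ hk]⟩⟩
    have h1 := inner_backwardDiff_coordMulCLM hμ hk (Nat.le_add_left 1 k) one
    rw [show backwardDiff (k + 1) _ = 0 from h, zero_apply, inner_zero_left,
      eq_comm, Complex.ofReal_eq_zero] at h1
    exact measure_compl_sphere_eq_zero hμ hk h1
  · intro h
    -- On a complex inner product space an operator with vanishing quadratic form is zero.
    refine ContinuousLinearMap.coe_injective ((inner_map_self_eq_zero _).1 fun f => ?_)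
    refine (inner_backwardDiff_coordMulCLM hμ hk (Nat.le_add_left 1 k) f).trans ?_
    rw [altSum_dirichletIntegral_eq_zero h hk f.mem_hol f.2.1.2 f.2.2.2, Complex.ofReal_zero]

end HigherDirichlet

end

theorem mainTheorem3 (k : ℕ) (hk : 1 ≤ k) (μ : Measure ℂ) [IsFiniteMeasure μ]
    (hμ : μ (closedBall (0 : ℂ) 1)ᶜ = 0) :
    (μ ≠ 0 → HigherDirichlet.finiteDirichlet μ k ≤ HigherDirichlet.hardySpace) ∧
    ∃ (_ : CompleteSpace (HigherDirichlet.DirichletSpace μ k))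
      (M : HigherDirichlet.DirichletSpace μ k →L[ℂ] HigherDirichlet.DirichletSpace μ k),
      (∀ (f : HigherDirichlet.DirichletSpace μ k) (z : ℂ), (M f) z = z * f z) ∧
      HigherDirichlet.IsDirichletType k M ∧
      (Odd k → HigherDirichlet.IsCompletelyHyperexpansive k M) ∧
      (Even k → HigherDirichlet.IsCompletelyHypercontractive k M) ∧
      (HigherDirichlet.IsMIsometry (k + 1) M ↔ μ (sphere (0 : ℂ) 1)ᶜ = 0) := by
  have h := HigherDirichlet.isDirichletType_coordMulCLM hμ hk
  refine ⟨HigherDirichlet.finiteDirichlet_le_hardySpace hμ hk, inferInstance,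
    HigherDirichlet.DirichletSpace.coordMulCLM hμ hk, fun _ _ => rfl, h, fun hodd n hn => ?_,
    fun heven n hn => ?_, HigherDirichlet.isMIsometry_coordMulCLM_iff hμ hk⟩
  · have h1 := h n hn
    rw [hodd.neg_one_pow, neg_one_smul] at h1
    exact neg_nonneg.1 h1
  · have h1 := h n hn
    rwa [heven.neg_one_pow, one_smul] at h1
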